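/- **Setting.** Let $U=[0,1]^3$ with periodic boundary conditions, $|\cdot|$ the Euclidean distance on $U$, and $0<T<\infty$. Let $f_0$ on $U\times\mathbb R^3$ and $g_0$ on $\mathbb R^3$ be probability densities with $\int f_0(x,v)(1+|v|^2)\,dx\,dv<\infty$, $\int g_0(v)(1+|v|^2)\,dv<\infty$ and $\operatorname{ess\,sup}_v g_0(v)(1+|v|^{3+\eta})<\infty$ for some $\eta>0$. Let $V,M:(0,\infty)\to[0,\infty)$ be non-increasing, tend to $\infty$ at $0$, and satisfy $\varepsilon V(\varepsilon)^3\le\frac18$ and $M(\varepsilon)\le\varepsilon^{-1/2}$ for $0<\varepsilon<1$. **Trees.** A collision tree is $\Phi=((x_0,v_0),(t_1,\nu_1,v_1),\dots,(t_n,\nu_n,v_n))$ with $n=n(\Phi)\ge 0$, $(x_0,v_0)\in U\times\mathbb R^3$, $0<t_1<\dots<t_n\le T$, $\nu_j\in\mathbb S^2$, $v_j\in\mathbb R^3$; $\tau=t_n$ ($\tau=0$ if $n=0$). It determines the trajectory $(x(s),v(s))$ of the tagged particle: $x(0)=x_0$, $v(0)=v_0$, $\dot x=v$, with $v$ constant except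 that $v(t_j)=v(t_j^-)-\big(\nu_j\cdot(v(t_j^-)-v_j)\big)\nu_j$. For a diameter $\varepsilon\ge0$, let $x_j^{\varepsilon}=x(t_j)+\varepsilon\nu_j-t_jv_j$ be the initial position of the $j$-th background particle. For $n\ge1$, $\bar\Phi$ is $\Phi$ without its last collision $(\tau,\nu,v')=(t_n,\nu_n,v_n)$. Trees carry Lebesgue measure $\lambda$ (surface measure in each $\nu_j$). **Good trees.** $\mathcal G(\varepsilon)$ is the set of trees with $n(\Phi)\le M(\varepsilon)$; $|v_j|\le V(\varepsilon)$ for all $j$ and $|v(s)|\le V(\varepsilon)$ for all $s\in[0,T]$; $|x(s)-(x_j^{\varepsilon'}+sv_j)|>\varepsilon'$ for all $0\le\varepsilon'\le\varepsilon$, all $j$ and all $0\le s<t_j$; $|x_0-x_j^{\varepsilon}|>\varepsilon$ for all $j$; and $\nu_j\cdot(v(t_j^-)-v_j)>0$ for all $j$. **Idealized distribution.** Put $\Lambda(v)=\int_{\mathbb S^2}\int_{\mathbb R^3}g_0(\bar v)[(v-\bar v)\cdot\nu]_+\,d\bar v\,d\nu$. Define $P_t(\Phi)=e^{-t\Lambda(v_0)}f_0(x_0,v_0)$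 if $n(\Phi)=0$, and otherwise $$P_t(\Phi)=\mathbf 1_{t\ge\tau}\,e^{-(t-\tau)\Lambda(v(\tau))}\,P_\tau(\bar\Phi)\,g_0(v')\,[(v(\tau^-)-v')\cdot\nu]_+ .$$ **Empirical distribution.** Let $N\in\mathbb N$ and $N\varepsilon^2=1$. The tagged particle starts with density $f_0$; independently, $N$ independent background particles start uniformly distributed in $U$ with velocity density $g_0$, and move freely forever. The tagged particle moves freely except that, when its centre reaches distance $\varepsilon$ from the centre of a background particle with velocity $u$, its velocity $v$ becomes $v-(\nu\cdot(v-u))\nu$, where $\varepsilon\nu$ is the vector from the centre of the tagged particle to that of the background particle. $\hat P^\varepsilon_t$ is the law, restricted to initial data without overlap of the tagged particle with a background particle, of the tree formed by the initial data of the tagged particle and all its collisions up to time $t$; $\hat P^\varepsilon_t(\Phi)$ denotes its density with respect to $\lambda$. **Error term.** Let $\zeta(\varepsilon)=(1-\tfrac43\pi\varepsilon^3)^N$; let $\eta^\varepsilon_t(\Phi)=\int_{U\times\mathbb R^3}g_0(\bar v)\big(1-\mathbf 1^\varepsilon_t[\Phi](\bar x,\bar v)\big)\,d\bar x\,d\bar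 v$, where $\mathbf 1^\varepsilon_t[\Phi](\bar x,\bar v)=1$ if $|x(s)-(\bar x+s\bar v)|>\varepsilon$ for all $s\in(0,t)$, and $0$ otherwise; let $C(\Phi)=2\sup_{s\in[0,T]}\Lambda(v(s))$. Put $\rho^{\varepsilon,0}_t(\Phi)=\eta^\varepsilon_t(\Phi)\,C(\Phi)\,t$, $\rho^{\varepsilon,k}_t(\Phi)=(1-\varepsilon)\rho^{\varepsilon,k-1}_t(\Phi)+\rho^{\varepsilon,0}_t(\Phi)+\varepsilon$ for $k\ge1$, and $\hat\rho^\varepsilon_t(\Phi)=\rho^{\varepsilon,n(\Phi)}_t(\Phi)$. **Proposition.** There is $\varepsilon_0>0$, depending only on $T,f_0,g_0,V,M$, such that for all $N\in\mathbb N$ and $0<\varepsilon<\varepsilon_0$ with $N\varepsilon^2=1$ and all $t\in[0,T]$, for $\lambda$-almost every $\Phi\in\mathcal G(\varepsilon)$ such that the tagged particle does not meet a background particle of $\Phi$ again up to time $t$ (that is, $|x(s)-(x_j^\varepsilon+sv_j)|>\varepsilon$ for all $j$ and all $t_j<s\le t$), $$\hat P^\varepsilon_t(\Phi)-\zeta(\varepsilon)P_t(\Phi)\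 \ge\ -\hat\rho^\varepsilon_t(\Phi)\,\zeta(\varepsilon)P_t(\Phi).$$ -/

import Mathlib

open MeasureTheory Set Filter Topology

noncomputable section

namespace RayleighGas

/-! Geometry: the unit cube with periodic boundary conditions, velocities, impact directions. -/

/-- The position space `[0,1]^3` with periodic boundary conditions. -/
abbrev Torus := Fin 3 → UnitAddCircle

/-- The velocity space, with the Euclidean norm. -/
abbrev Vel := EuclideanSpace ℝ (Fin 3)

/-- The unit sphere of `Vel`. -/
abbrev Direction := Metric.sphere (0 : Vel) 1

/-- Surface measure on the unit sphere (total mass `4π`). -/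
def sphereMeasure : Measure Direction := (volume : Measure Vel).toSphere

/-- The projection of `ℝ^3` onto the torus. -/
def toTorus (y : Vel) : Torus := fun i => (y i : UnitAddCircle)

/-- The Euclidean distance on the flat torus (the norm of an element of `UnitAddCircle` is its
distance to the nearest integer). -/
def torusDist (x y : Torus) : ℝ := √(∑ i, ‖x i - y i‖ ^ 2)

/-! Collision trees. -/

/-- A marker `(t_j, ν_j, v_j)`: collision time, collision parameter (pointing from the tagged
particle to the background particle), velocity of the background particle. -/
abbrev Marker := ℝ × Direction × Vel

/-- The number of collisions, the initial data `(x₀, v₀)` of the tagged particle, and the list of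
markers. -/
abbrev CollisionTree := Σ n : ℕ, (Torus × Vel) × (Fin n → Marker)

/-- Lebesgue measure on the space of trees. -/
def treeMeasure : Measure CollisionTree :=
  Measure.sum fun n : ℕ =>
    Measure.map (Sigma.mk n)
      ((volume : Measure (Torus × Vel)).prod
        (Measure.pi fun _ : Fin n =>
          (volume : Measure ℝ).prod (sphereMeasure.prod (volume : Measure Vel))))

/-- `n(Φ)`. -/
abbrev numColl (Φ : CollisionTree) : ℕ := Φ.1

/-- Initial position `x₀` of the tagged particle. -/
def rootPos (Φ : CollisionTree) : Torus := Φ.2.1.1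

/-- Initial velocity `v₀` of the tagged particle. -/
def rootVel (Φ : CollisionTree) : Vel := Φ.2.1.2

/-- The collision time `t_j`. -/
def collTime (Φ : CollisionTree) (j : Fin (numColl Φ)) : ℝ := (Φ.2.2 j).1

/-- The collision parameter `ν_j`. -/
def collDir (Φ : CollisionTree) (j : Fin (numColl Φ)) : Vel := (Φ.2.2 j).2.1

/-- The velocity `v_j` of the background particle of the `j`-th collision. -/
def collVel (Φ : CollisionTree) (j : Fin (numColl Φ)) : Vel := (Φ.2.2 j).2.2

/-- The collision times lie in `(0, T]` and are listed in increasing order. -/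
def IsTree (T : ℝ) (Φ : CollisionTree) : Prop :=
  (∀ j, 0 < collTime Φ j ∧ collTime Φ j ≤ T) ∧ StrictMono (collTime Φ)

/-- The velocity of the tagged particle after colliding, with collision parameter `ν`, with a
background particle of velocity `u`, if its velocity before was `v`. -/
def collide (ν u v : Vel) : Vel := v - (inner ℝ ν (v - u)) • ν

/-- The velocity of the tagged particle after the first `k` collisions of the tree. -/
def velAfter (Φ : CollisionTree) : ℕ → Vel
  | 0 => rootVel Φ
  | k + 1 =>
    if h : k < numColl Φ then collide (collDir Φ ⟨k, h⟩) (collVel Φ ⟨k, h⟩) (velAfter Φ k)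
    else velAfter Φ k

/-- The velocity `v(s)` of the tagged particle (post-collisional at collision times). -/
def vel (Φ : CollisionTree) (s : ℝ) : Vel :=
  velAfter Φ (Finset.univ.filter fun j => collTime Φ j ≤ s).card

/-- The velocity `v(s⁻)` of the tagged particle. -/
def velBefore (Φ : CollisionTree) (s : ℝ) : Vel :=
  velAfter Φ (Finset.univ.filter fun j => collTime Φ j < s).card

/-- The position `x(s) = x₀ + ∫₀ˢ v(r) dr` of the tagged particle, `s ≥ 0`: each collision `j`
adds its velocity jump times the time `(s - t_j)₊` elapsed since. -/
def pos (Φ : CollisionTree) (s : ℝ) : Torus :=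
  rootPos Φ + toTorus (s • rootVel Φ +
    ∑ j : Fin (numColl Φ), max (s - collTime Φ j) 0 • (velAfter Φ ((j : ℕ) + 1) - velAfter Φ (j : ℕ)))

/-- The initial position `x_j` of the background particle of the `j`-th collision, if the
particles have diameter `ε`. -/
def partnerStart (ε : ℝ) (Φ : CollisionTree) (j : Fin (numColl Φ)) : Torus :=
  pos Φ (collTime Φ j) + toTorus (ε • collDir Φ j - collTime Φ j • collVel Φ j)

/-- The position `x_j + s v_j` of that particle at time `s`. -/
def partnerPos (ε : ℝ) (Φ : CollisionTree) (j : Fin (numColl Φ)) (s : ℝ) : Torus :=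
  partnerStart ε Φ j + toTorus (s • collVel Φ j)

/-! Good trees. -/

/-- For every diameter `ε' ≤ ε`, the tagged particle does not meet the background particle of the
`j`-th collision before time `t_j`. -/
def RecollisionFree (ε : ℝ) (Φ : CollisionTree) : Prop :=
  ∀ ε' : ℝ, 0 ≤ ε' → ε' ≤ ε → ∀ j, ∀ s : ℝ, 0 ≤ s → s < collTime Φ j →
    ε' < torusDist (pos Φ s) (partnerPos ε' Φ j s)

/-- The tagged particle does not initially overlap a background particle of the tree. -/
def NoInitialOverlap (ε : ℝ) (Φ : CollisionTree) : Prop :=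
  ∀ j, ε < torusDist (rootPos Φ) (partnerStart ε Φ j)

/-- All collisions are non-grazing. -/
def NonGrazing (Φ : CollisionTree) : Prop :=
  ∀ j, 0 < inner ℝ (collDir Φ j) (velBefore Φ (collTime Φ j) - collVel Φ j)

/-- The set `𝒢(ε)` of good trees; the second and third conditions say `𝒱(Φ) ≤ V(ε)`. -/
def goodTrees (T : ℝ) (V M : ℝ → ℝ) (ε : ℝ) : Set CollisionTree :=
  {Φ | IsTree T Φ ∧ (numColl Φ : ℝ) ≤ M ε ∧
    (∀ j, ‖collVel Φ j‖ ≤ V ε) ∧ (∀ s ∈ Icc 0 T, ‖vel Φ s‖ ≤ V ε) ∧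
    RecollisionFree ε Φ ∧ NoInitialOverlap ε Φ ∧ NonGrazing Φ}

/-- Up to time `t`, the tagged particle does not meet a background particle of the tree again
after having collided with it. -/
def NoLaterContact (ε t : ℝ) (Φ : CollisionTree) : Prop :=
  ∀ j, ∀ s : ℝ, collTime Φ j < s → s ≤ t → ε < torusDist (pos Φ s) (partnerPos ε Φ j s)

/-- The standing assumptions on the cut-off functions `V` and `M`. -/
structure IsCutoff (V M : ℝ → ℝ) : Prop where
  V_nonneg : ∀ ε, 0 < ε → 0 ≤ V ε
  M_nonneg : ∀ ε, 0 < ε → 0 ≤ M ε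
  V_anti : AntitoneOn V (Ioi 0)
  M_anti : AntitoneOn M (Ioi 0)
  V_tendsto : Tendsto V (𝓝[>] 0) atTop
  M_tendsto : Tendsto M (𝓝[>] 0) atTop
  V_le : ∀ ε, 0 < ε → ε < 1 → ε * V ε ^ 3 ≤ 1 / 8
  M_le : ∀ ε, 0 < ε → ε < 1 → M ε ≤ 1 / √ε

/-- Admissible probability densities. The last condition with `η = 1` is the bound on
`g₀(v)(1 + |v|^4)`; the weaker bounds with `0 < η < 1` are allowed as well. -/
structure Admissible (f₀ : Torus × Vel → ℝ) (g₀ : Vel → ℝ) : Prop where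
  f_meas : Measurable f₀
  f_nonneg : ∀ p, 0 ≤ f₀ p
  f_integral : ∫ p, f₀ p = 1
  f_moment : Integrable fun p : Torus × Vel => f₀ p * (1 + ‖p.2‖ ^ 2)
  g_meas : Measurable g₀
  g_nonneg : ∀ v, 0 ≤ g₀ v
  g_integral : ∫ v, g₀ v = 1
  g_moment : Integrable fun v : Vel => g₀ v * (1 + ‖v‖ ^ 2)
  g_bound : ∃ η : ℝ, 0 < η ∧ ∃ K : ℝ, ∀ᵐ v : Vel, g₀ v * (1 + ‖v‖ ^ (3 + η)) ≤ K

/-! The idealized distribution. -/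

/-- The collision rate `∫_{S²} ∫_{ℝ³} g₀(u) [(v - u)·ν]₊ du dν` at velocity `v`. -/
def rate (g₀ : Vel → ℝ) (v : Vel) : ℝ :=
  ∫ ν : Direction, (∫ u : Vel, g₀ u * max (inner ℝ (v - u) (ν : Vel)) 0) ∂sphereMeasure

/-- The density `P_t(Φ)` of the idealized distribution, recursively in the number of collisions:
the tree without its final collision has the markers `Fin.init c`. -/
def idealAux (f₀ : Torus × Vel → ℝ) (g₀ : Vel → ℝ) (r : Torus × Vel) :
    (n : ℕ) → (Fin n → Marker) → ℝ → ℝ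
  | 0, _, t => Real.exp (-(t * rate g₀ r.2)) * f₀ r
  | n + 1, c, t =>
    let τ : ℝ := (c (Fin.last n)).1
    let ν : Vel := (c (Fin.last n)).2.1
    let v' : Vel := (c (Fin.last n)).2.2
    let Φ : CollisionTree := ⟨n + 1, (r, c)⟩
    if τ ≤ t then
      Real.exp (-((t - τ) * rate g₀ (vel Φ τ))) * idealAux f₀ g₀ r n (Fin.init c) τ *
        g₀ v' * max (inner ℝ (velBefore Φ τ - v') ν) 0
    else 0

/-- The density `P_t(Φ)` as a function on trees. -/
def idealDensity (f₀ : Torus × Vel → ℝ) (g₀ : Vel → ℝ) (t : ℝ) (Φ : CollisionTree) : ℝ :=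
  idealAux f₀ g₀ Φ.2.1 Φ.1 Φ.2.2 t

/-! The particle dynamics and the empirical distribution. -/

/-- Initial data of the tagged particle and of the `N` background particles. -/
abbrev Config (N : ℕ) := (Torus × Vel) × (Fin N → Torus × Vel)

/-- The law of the initial data: all particles are independent, the tagged particle has density
`f₀`, the background particles are uniform in space with density `g₀` in velocity. -/
def configLaw (f₀ : Torus × Vel → ℝ) (g₀ : Vel → ℝ) (N : ℕ) : Measure (Config N) :=
  ((volume : Measure (Torus × Vel)).withDensity fun p => ENNReal.ofReal (f₀ p)).prod
    (Measure.pi fun _ : Fin N =>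
      (volume : Measure (Torus × Vel)).withDensity fun p => ENNReal.ofReal (g₀ p.2))

/-- The position at time `s` of the `i`-th background particle, which moves freely. -/
def bgPos {N : ℕ} (z : Config N) (i : Fin N) (s : ℝ) : Torus :=
  (z.2 i).1 + toTorus (s • (z.2 i).2)

/-- `Φ` is the history of collisions of the tagged particle in the time interval `[0, t]` in the
hard-sphere dynamics with diameter `ε` started from `z`: there is no initial overlap, the `j`-th
collision of `Φ` takes place with the background particle `p j`, whose centre is then at
`x(t_j) + ε ν_j`, and the tagged particle, which moves along the trajectory determined by `Φ`,
stays at distance more than `ε` from all background particles except at these collisions. In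
particular all collisions are binary and only finitely many occur. -/
def IsHistory {N : ℕ} (ε t : ℝ) (z : Config N) (Φ : CollisionTree) : Prop :=
  Φ.2.1 = z.1 ∧ IsTree t Φ ∧ (∀ i, ε < torusDist z.1.1 (z.2 i).1) ∧
    ∃ p : Fin (numColl Φ) → Fin N,
      (∀ j, (z.2 (p j)).2 = collVel Φ j ∧
        bgPos z (p j) (collTime Φ j) = pos Φ (collTime Φ j) + toTorus (ε • collDir Φ j)) ∧
      ∀ s ∈ Icc 0 t, ∀ i, torusDist (pos Φ s) (bgPos z i s) ≤ ε → ∃ j, p j = i ∧ collTime Φ j = s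

open Classical in
/-- The history of collisions up to time `t`, where there is one (it is unique if `ε < 1/2`);
a dummy value otherwise. -/
def history {N : ℕ} (ε t : ℝ) (z : Config N) : CollisionTree :=
  if h : ∃ Φ, IsHistory ε t z Φ then h.choose else ⟨0, (z.1, Fin.elim0)⟩

/-- The empirical distribution: the law of the history of collisions up to time `t`. Initial data
with an overlap and the null set where the dynamics is not well defined are discarded, so it has
mass at most one. -/
def empiricalLaw (f₀ : Torus × Vel → ℝ) (g₀ : Vel → ℝ) (N : ℕ) (ε t : ℝ) :
    Measure CollisionTree :=
  Measure.map (history ε t)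
    ((configLaw f₀ g₀ N).restrict {z | ∃ Φ, IsHistory ε t z Φ})

/-- The density `P̂_t^ε(Φ)` of the empirical distribution with respect to the Lebesgue measure on
trees. -/
def empiricalDensity (f₀ : Torus × Vel → ℝ) (g₀ : Vel → ℝ) (N : ℕ) (ε t : ℝ)
    (Φ : CollisionTree) : ℝ :=
  ((empiricalLaw f₀ g₀ N ε t).rnDeriv treeMeasure Φ).toReal

/-! The error term. -/

/-- `ζ(ε) = (1 - (4/3) π ε³)^N`. -/
def zeta (N : ℕ) (ε : ℝ) : ℝ := (1 - 4 / 3 * Real.pi * ε ^ 3) ^ N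

/-- The set of initial data for which a background particle does not meet the tagged particle of
the tree during `(0, t)`. -/
def avoidSet (ε t : ℝ) (Φ : CollisionTree) : Set (Torus × Vel) :=
  {p | ∀ s ∈ Ioo 0 t, ε < torusDist (pos Φ s) (p.1 + toTorus (s • p.2))}

/-- `η_t^ε(Φ)`. -/
def etaErr (g₀ : Vel → ℝ) (ε t : ℝ) (Φ : CollisionTree) : ℝ :=
  ∫ p : Torus × Vel, g₀ p.2 * (1 - (avoidSet ε t Φ).indicator (fun _ => (1 : ℝ)) p)

/-- `C(Φ)`, twice the maximal collision rate along the trajectory. -/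
def maxRate (g₀ : Vel → ℝ) (T : ℝ) (Φ : CollisionTree) : ℝ :=
  2 * ⨆ s : Icc (0 : ℝ) T, rate g₀ (vel Φ s)

/-- `ρ_t^{ε,k}(Φ)`. -/
def rho (g₀ : Vel → ℝ) (T ε t : ℝ) (Φ : CollisionTree) : ℕ → ℝ
  | 0 => etaErr g₀ ε t Φ * maxRate g₀ T Φ * t
  | k + 1 =>
    (1 - ε) * rho g₀ T ε t Φ k + etaErr g₀ ε t Φ * maxRate g₀ T Φ * t + ε

/-- `ρ̂_t^ε(Φ)`. -/
def rhoHat (g₀ : Vel → ℝ) (T ε t : ℝ) (Φ : CollisionTree) : ℝ :=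
  rho g₀ T ε t Φ (numColl Φ)

end RayleighGas

end

/-! Only a lower bound for the density is needed, so every step may lose mass. Fix a tree with n
collisions whose background particles each meet the tagged particle exactly once up to time t. The
history is this tree as soon as the tagged particle starts at (x₀, v₀), n distinct background
particles start at the points (x_j^ε, v_j), and the other N - n miss the trajectory during [0, t].
Each of the N(N-1)⋯(N-n+1) labellings contributes at least f₀(x₀, v₀) ∏ ε² [ν_j·(v(t_j⁻) - v_j)]₊
g₀(v_j) · (1 - b)^(N-n). Here ε² [·]₊ is the Jacobian of the passage from a marker to initial data,
and b is the probability that a single background particle hits (`labelledDensity_le_rnDeriv`).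

This is compared with P_t = e^{-L} f₀ ∏ g₀(v_j) [·]₊, where L is the integral of Λ along the
trajectory (`idealAux_eq`). Since Nε² = 1 and nε ≤ 1, the number of labellings times ε^(2n) is at
least (1 - ε)^n (`pow_le_descFactorial_mul`). A particle that hits either overlaps initially or lies
in the tube swept out afterwards, so b ≤ (4/3)πε³ + ε²L (`hitProb_le`). Hence (1 - b)^N ≥ ζ(ε)
e^{-L} (1 - 2bL) (`exp_mul_le_pow`). Finally 2bL ≤ η C t, and (1 - ε)^n (1 - η C t) ≥ 1 - ρ̂ by the
recursion for ρ (`one_sub_rho_le`).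

The Jacobian and the tube volume both come from one identity, `lintegral_flux`. The change of
variables is built one marker at a time (`lintegral_startMap_le`): the start of the j-th partner
depends on the first j markers only, and the first-contact condition makes the map injective.
Uniqueness of the history (`IsHistoryVia.tree_unique`) makes the events of different labellings
disjoint and, by the Lusin–Souslin theorem, measurable. -/

namespace RayleighGas

/-! ### The flat torus as a quotient of Euclidean space: distances and volumes. -/

theorem toTorus_add (a b : Vel) : toTorus (a + b) = toTorus a + toTorus b := by
  funext i
  simp [toTorus]

theorem toTorus_zero : toTorus 0 = 0 := by
  funext i
  simp [toTorus]

theorem toTorus_neg (a : Vel) : toTorus (-a) = -toTorus a := by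
  funext i
  simp [toTorus]

theorem toTorus_sub (a b : Vel) : toTorus (a - b) = toTorus a - toTorus b := by
  funext i
  simp [toTorus]

theorem continuous_toTorus : Continuous toTorus := by
  unfold toTorus
  refine continuous_pi fun i => ?_
  exact (AddCircle.continuous_mk' (1 : ℝ)).comp (by fun_prop)

theorem measurable_toTorus : Measurable toTorus := continuous_toTorus.measurable

theorem continuous_torusDist {X : Type*} [TopologicalSpace X] {f g : X → Torus}
    (hf : Continuous f) (hg : Continuous g) : Continuous fun x => torusDist (f x) (g x) := by
  have h1 : ∀ i, Continuous fun x => f x i := fun i => (continuous_apply i).comp hf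
  have h2 : ∀ i, Continuous fun x => g x i := fun i => (continuous_apply i).comp hg
  unfold torusDist
  exact Real.continuous_sqrt.comp
    (continuous_finsetSum _ fun i _ => (((h1 i).sub (h2 i)).norm).pow 2)

theorem torusDist_comm (x y : Torus) : torusDist x y = torusDist y x := by
  unfold torusDist
  simp only [norm_sub_rev]

theorem torusDist_congr {x y x' y' : Torus} (h : x - y = x' - y') :
    torusDist x y = torusDist x' y' := by
  unfold torusDist
  congr 1
  refine Finset.sum_congr rfl fun i _ => ?_
  have := congrFun h i
  simp only [Pi.sub_apply] at this
  rw [this]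

/-- Subtracting the nearest integer in each coordinate attains the quotient norm, so the torus
distance is the length of a shortest lift. -/
theorem exists_lift (x y : Torus) : ∃ z : Vel, ‖z‖ = torusDist x y ∧ x - y = toTorus z := by
  have h : ∀ i, ∃ a : ℝ, |a| = ‖x i - y i‖ ∧ x i - y i = (a : UnitAddCircle) := by
    intro i
    obtain ⟨a, ha⟩ := QuotientAddGroup.mk_surjective (x i - y i)
    have ha' : (a : UnitAddCircle) = x i - y i := ha
    refine ⟨a - round a, ?_, ?_⟩
    · rw [← ha', UnitAddCircle.norm_eq]
    · rw [← ha', AddCircle.coe_sub]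
      have : ((round a : ℝ) : UnitAddCircle) = 0 := by
        rw [AddCircle.coe_eq_zero_iff]
        exact ⟨round a, by simp⟩
      rw [this, sub_zero]
  choose a ha hxa using h
  refine ⟨WithLp.toLp 2 a, ?_, ?_⟩
  · rw [EuclideanSpace.norm_eq]
    unfold torusDist
    congr 1
    refine Finset.sum_congr rfl fun i _ => ?_
    simp [← ha i]
  · funext i
    simp [toTorus, ← hxa i]

theorem torusDist_le_norm {x y : Torus} {z : Vel} (h : x - y = toTorus z) :
    torusDist x y ≤ ‖z‖ := by
  rw [EuclideanSpace.norm_eq]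
  unfold torusDist
  refine Real.sqrt_le_sqrt (Finset.sum_le_sum fun i _ => ?_)
  have h1 := congrFun h i
  simp only [Pi.sub_apply, toTorus] at h1
  rw [h1]
  gcongr
  rw [UnitAddCircle.norm_eq]
  exact (round_le (z i) 0).trans (by simp)

/-- This is why ε < 1/2 is required later: the direction of a collision has to be recoverable from
the contact point on the torus. -/
theorem toTorus_injOn_small {a b : Vel} {r : ℝ} (hr : r < 1 / 2) (ha : ‖a‖ ≤ r) (hb : ‖b‖ ≤ r)
    (h : toTorus a = toTorus b) : a = b := by
  ext i
  have h1 := congrFun h i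
  simp only [toTorus] at h1
  rw [AddCircle.coe_eq_coe_iff_of_mem_Ico (a := -(1 / 2))] at h1
  · exact h1
  · have := (abs_le.1 ((PiLp.norm_apply_le a i).trans ha))
    constructor <;> linarith [this.1, this.2]
  · have := (abs_le.1 ((PiLp.norm_apply_le b i).trans hb))
    constructor <;> linarith [this.1, this.2]

/-- The half-open unit cube, a fundamental domain of `toTorus`. -/
def unitCell : Set Vel := {y | ∀ i, y i ∈ Ioc (0 : ℝ) 1}

/-- The lattice vectors. -/
def latticeVec (k : Fin 3 → ℤ) : Vel := WithLp.toLp 2 fun i => (k i : ℝ)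

theorem toTorus_latticeVec (k : Fin 3 → ℤ) : toTorus (latticeVec k) = 0 := by
  funext i
  simp only [toTorus, latticeVec, Pi.zero_apply]
  rw [AddCircle.coe_eq_zero_iff]
  exact ⟨k i, by simp⟩

theorem toTorus_add_latticeVec (y : Vel) (k : Fin 3 → ℤ) :
    toTorus (y + latticeVec k) = toTorus y := by
  rw [toTorus_add, toTorus_latticeVec, add_zero]

theorem latticeVec_injective : Function.Injective latticeVec := by
  intro k l h
  funext i
  have := congrArg (fun v : Vel => v i) h
  simpa [latticeVec] using this

theorem measurableSet_unitCell : MeasurableSet unitCell := by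
  have : unitCell = ⋂ i, (fun y : Vel => y i) ⁻¹' Ioc (0 : ℝ) 1 := by
    ext y
    simp [unitCell]
  rw [this]
  exact MeasurableSet.iInter fun i => (by fun_prop : Measurable fun y : Vel => y i) measurableSet_Ioc

theorem exists_sub_latticeVec_mem (y : Vel) : ∃ k, y - latticeVec k ∈ unitCell := by
  -- The cell is open on the left, so `⌈y i⌉ - 1` takes the place of the floor.
  refine ⟨fun i => ⌈y i⌉ - 1, fun i => ?_⟩
  simp only [latticeVec, PiLp.sub_apply, Int.cast_sub, Int.cast_one]
  constructor
  · linarith [Int.ceil_lt_add_one (y i)]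
  · linarith [Int.le_ceil (y i)]

theorem latticeVec_unique {y : Vel} {k l : Fin 3 → ℤ} (hk : y - latticeVec k ∈ unitCell)
    (hl : y - latticeVec l ∈ unitCell) : k = l := by
  funext i
  have h1 := hk i
  have h2 := hl i
  simp only [latticeVec, PiLp.sub_apply, mem_Ioc] at h1 h2
  have a1 : (k i : ℝ) < l i + 1 := by linarith [h1.1, h2.2]
  have a2 : (l i : ℝ) < k i + 1 := by linarith [h1.2, h2.1]
  have b1 : k i < l i + 1 := by exact_mod_cast a1
  have b2 : l i < k i + 1 := by exact_mod_cast a2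
  omega

theorem measurePreserving_toTorus :
    MeasurePreserving toTorus (volume.restrict unitCell) (volume : Measure Torus) := by
  have h2 : MeasurePreserving (fun (y : Fin 3 → ℝ) (i : Fin 3) => (y i : UnitAddCircle))
      (Measure.pi fun _ => (volume : Measure ℝ).restrict (Ioc (0 : ℝ) (0 + 1)))
      (Measure.pi fun _ => volume) :=
    measurePreserving_pi _ _ fun i => UnitAddCircle.measurePreserving_mk 0
  rw [← Measure.restrict_pi_pi (μ := fun _ : Fin 3 => (volume : Measure ℝ))] at h2
  have h3 := (EuclideanSpace.volume_preserving_symm_measurableEquiv_toLp (Fin 3))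
  have h4 := h3.restrict_preimage
    (s := Set.univ.pi fun _ => Ioc (0 : ℝ) (0 + 1))
    (MeasurableSet.univ_pi fun _ => measurableSet_Ioc)
  have h5 : unitCell = (MeasurableEquiv.toLp 2 (Fin 3 → ℝ)).symm ⁻¹'
      (Set.univ.pi fun _ => Ioc (0 : ℝ) (0 + 1)) := by
    ext y
    simp [unitCell]
  rw [h5]
  exact h2.comp h4

theorem volume_torus_eq {B : Set Torus} (hB : MeasurableSet B) :
    volume B = volume (toTorus ⁻¹' B ∩ unitCell) := by
  rw [← measurePreserving_toTorus.measure_preimage hB.nullMeasurableSet,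
    Measure.restrict_apply (measurable_toTorus hB)]

/-- Cut the set along the lattice cells and shift all pieces into the unit cell. Shifts preserve
volume, and injectivity of the projection keeps the shifted pieces disjoint. -/
theorem volume_inter_preimage_toTorus_le {Q : Set Vel} (hQ : MeasurableSet Q)
    (hinj : InjOn toTorus Q) {B : Set Torus} (hB : MeasurableSet B) :
    volume (Q ∩ toTorus ⁻¹' B) ≤ volume B := by
  set R : (Fin 3 → ℤ) → Set Vel := fun k =>
    (fun y => y + latticeVec k) ⁻¹' (Q ∩ toTorus ⁻¹' B) ∩ unitCell with hR
  have hQB : MeasurableSet (Q ∩ toTorus ⁻¹' B) := hQ.inter (measurable_toTorus hB)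
  have hRm : ∀ k, MeasurableSet (R k) := fun k =>
    (hQB.preimage (measurable_add_const _)).inter measurableSet_unitCell
  have hcov : Q ∩ toTorus ⁻¹' B ⊆ ⋃ k, (fun y => y + latticeVec (-k)) ⁻¹' (R k) := by
    intro y hy
    obtain ⟨k, hk⟩ := exists_sub_latticeVec_mem y
    refine mem_iUnion.2 ⟨k, ?_⟩
    have hneg : latticeVec (-k) = -latticeVec k := by
      ext i; simp [latticeVec]
    refine ⟨?_, ?_⟩
    · change y + latticeVec (-k) + latticeVec k ∈ Q ∩ toTorus ⁻¹' B
      rw [hneg, neg_add_cancel_right]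
      exact hy
    · change y + latticeVec (-k) ∈ unitCell
      rw [hneg, ← sub_eq_add_neg]
      exact hk
  calc volume (Q ∩ toTorus ⁻¹' B) ≤ ∑' k, volume ((fun y => y + latticeVec (-k)) ⁻¹' (R k)) :=
        (measure_mono hcov).trans (measure_iUnion_le _)
    _ = ∑' k, volume (R k) := by simp_rw [measure_preimage_add_right]
    _ = volume (⋃ k, R k) := by
        rw [measure_iUnion _ hRm]
        intro k l hkl
        refine Set.disjoint_left.2 fun y hk hl => hkl ?_
        have := hinj hk.1.1 hl.1.1 (by simp only [toTorus_add_latticeVec])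
        exact latticeVec_injective (add_left_cancel this)
    _ ≤ volume (toTorus ⁻¹' B ∩ unitCell) := by
        refine measure_mono (iUnion_subset fun k y hy => ⟨?_, hy.2⟩)
        have := hy.1.2
        simpa only [mem_preimage, toTorus_add_latticeVec] using this
    _ = volume B := (volume_torus_eq hB).symm

/-- The opposite comparison: the pieces of `A` in different cells are disjoint, and once shifted
they cover the part of the unit cell above `B`. -/
theorem volume_torus_le {A : Set Vel} (hA : MeasurableSet A) {B : Set Torus}
    (hB : MeasurableSet B) (h : B ⊆ toTorus '' A) : volume B ≤ volume A := by
  rw [volume_torus_eq hB]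
  set R : (Fin 3 → ℤ) → Set Vel := fun k => A ∩ (fun y => y + latticeVec k) ⁻¹' unitCell with hR
  have hRm : ∀ k, MeasurableSet (R k) := fun k =>
    hA.inter (measurableSet_unitCell.preimage (measurable_add_const _))
  have hneg : ∀ k, latticeVec (-k) = -latticeVec k := fun k => by
    ext i; simp [latticeVec]
  have hcov : toTorus ⁻¹' B ∩ unitCell ⊆ ⋃ k, (fun y => y + latticeVec (-k)) ⁻¹' (R k) := by
    rintro y ⟨hyB, hyc⟩
    obtain ⟨a, ha, hay⟩ := h hyB
    obtain ⟨k, hk⟩ := exists_sub_latticeVec_mem a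
    obtain ⟨l, hl⟩ : ∃ l, a = y + latticeVec l := by
      have hi : ∀ i, ∃ m : ℤ, (m : ℝ) = a i - y i := by
        intro i
        have h1 := congrFun hay i
        simp only [toTorus] at h1
        rw [← sub_eq_zero, ← AddCircle.coe_sub, AddCircle.coe_eq_zero_iff] at h1
        obtain ⟨m, hm⟩ := h1
        exact ⟨m, by simpa using hm⟩
      choose m hm using hi
      refine ⟨m, ?_⟩
      ext i
      simp [latticeVec, hm i]
    refine mem_iUnion.2 ⟨-l, ?_, ?_⟩
    · change y + latticeVec (- -l) ∈ A
      rw [neg_neg, ← hl]; exact ha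
    · change y + latticeVec (- -l) + latticeVec (-l) ∈ unitCell
      rw [hneg (-l), neg_add_cancel_right]
      exact hyc
  calc volume (toTorus ⁻¹' B ∩ unitCell)
      ≤ ∑' k, volume ((fun y => y + latticeVec (-k)) ⁻¹' (R k)) :=
        (measure_mono hcov).trans (measure_iUnion_le _)
    _ = ∑' k, volume (R k) := by simp_rw [measure_preimage_add_right]
    _ = volume (⋃ k, R k) := by
        rw [measure_iUnion _ hRm]
        intro k l hkl
        refine Set.disjoint_left.2 fun y hk hl => hkl ?_
        have h1 : y - latticeVec (-k) ∈ unitCell := by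
          rw [hneg, sub_neg_eq_add]; exact hk.2
        have h2 : y - latticeVec (-l) ∈ unitCell := by
          rw [hneg, sub_neg_eq_add]; exact hl.2
        simpa using latticeVec_unique h1 h2
    _ ≤ volume A := measure_mono (iUnion_subset fun k => inter_subset_left)

/-! ### Polar coordinates and the flux identity. -/

instance : IsFiniteMeasure sphereMeasure := by
  unfold sphereMeasure
  infer_instance

theorem norm_direction (ν : Direction) : ‖(ν : Vel)‖ = 1 := by
  simp

/-- Integration in polar coordinates. -/
theorem lintegral_polar {G : Vel → ENNReal} (hG : Measurable G) :
    ∫⁻ x, G x = ∫⁻ ν : Direction, (∫⁻ r in Ioi (0 : ℝ), ENNReal.ofReal (r ^ 2) * G (r • (ν : Vel)))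
      ∂sphereMeasure := by
  have h0 : ∫⁻ x, G x = ∫⁻ x in ({0}ᶜ : Set Vel), G x := by
    rw [restrict_compl_singleton]
  have hmp := (volume : Measure Vel).measurePreserving_homeomorphUnitSphereProd
  have h1 := hmp.lintegral_comp_emb (Homeomorph.measurableEmbedding _)
    (fun p : Direction × Ioi (0 : ℝ) => G (((homeomorphUnitSphereProd Vel).symm p : Vel)))
  simp only [Homeomorph.symm_apply_apply] at h1
  rw [h0, ← lintegral_subtype_comap (measurableSet_singleton _).compl, h1, lintegral_prod]
  · refine lintegral_congr fun ν => ?_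
    have hd : Module.finrank ℝ Vel - 1 = 2 := by simp
    rw [hd, Measure.volumeIoiPow, lintegral_withDensity_eq_lintegral_mul]
    · rw [← lintegral_subtype_comap measurableSet_Ioi
        (fun r : ℝ => ENNReal.ofReal (r ^ 2) * G (r • (ν : Vel)))]
      refine lintegral_congr fun r => ?_
      simp
    · fun_prop
    · refine hG.comp (measurable_subtype_coe.comp ?_)
      exact (homeomorphUnitSphereProd Vel).symm.measurable.comp measurable_prodMk_left
  · refine (hG.comp (measurable_subtype_coe.comp ?_)).aemeasurable
    exact (homeomorphUnitSphereProd Vel).symm.measurable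

theorem lintegral_comp_smul_addHaar {E : Type*} [NormedAddCommGroup E] [NormedSpace ℝ E]
    [FiniteDimensional ℝ E] [MeasurableSpace E] [BorelSpace E] (μ : Measure E)
    [μ.IsAddHaarMeasure] {f : E → ENNReal} (hf : Measurable f) {c : ℝ} (hc : 0 < c) :
    ∫⁻ y, f (c • y) ∂μ = ENNReal.ofReal ((c ^ Module.finrank ℝ E)⁻¹) * ∫⁻ y, f y ∂μ := by
  rw [← lintegral_map hf (measurable_const_smul c), Measure.map_addHaar_smul μ hc.ne',
    lintegral_smul_measure, abs_of_pos (by positivity)]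
  simp

/-- The distance of `y` to the line spanned by `w ≠ 0`. -/
noncomputable def lineDist (w y : Vel) : ℝ := ‖y - (inner ℝ y w / ‖w‖ ^ 2) • w‖

theorem measurable_lineDist (w : Vel) : Measurable (lineDist w) := by
  unfold lineDist
  fun_prop

theorem lineDist_smul (w y : Vel) {c : ℝ} (hc : 0 ≤ c) : lineDist w (c • y) = c * lineDist w y := by
  unfold lineDist
  rw [inner_smul_left, ← norm_smul_of_nonneg hc, smul_sub, smul_smul]
  simp [mul_div_assoc]

theorem norm_sub_smul_sq {w : Vel} (hw : w ≠ 0) (y : Vel) (t : ℝ) :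
    ‖y - t • w‖ ^ 2 = lineDist w y ^ 2 + ((inner ℝ y w / ‖w‖ ^ 2 - t) * ‖w‖) ^ 2 := by
  have hw' : ‖w‖ ^ 2 ≠ 0 := by positivity
  have e : y - t • w = (y - (inner ℝ y w / ‖w‖ ^ 2) • w) + (inner ℝ y w / ‖w‖ ^ 2 - t) • w := by
    module
  have horth : inner ℝ (y - (inner ℝ y w / ‖w‖ ^ 2) • w)
      ((inner ℝ y w / ‖w‖ ^ 2 - t) • w) = (0 : ℝ) := by
    rw [inner_smul_right, inner_sub_left, inner_smul_left, real_inner_self_eq_norm_sq]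
    simp only [conj_trivial]
    rw [div_mul_cancel₀ _ hw']
    simp
  have := norm_add_sq_eq_norm_sq_add_norm_sq_real horth
  rw [e, sq, this, norm_smul, mul_pow ((inner ℝ y w / ‖w‖ ^ 2 - t)), Real.norm_eq_abs,
    mul_mul_mul_comm, abs_mul_abs_self, lineDist]
  ring

theorem inner_sub_smul {w : Vel} (hw : w ≠ 0) (y : Vel) (t : ℝ) :
    inner ℝ (y - t • w) w = (inner ℝ y w / ‖w‖ ^ 2 - t) * ‖w‖ ^ 2 := by
  have hw' : ‖w‖ ^ 2 ≠ 0 := by positivity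
  rw [inner_sub_left, inner_smul_left, real_inner_self_eq_norm_sq]
  simp only [conj_trivial]
  field_simp

/-- Approaching the line `ℝ w` along itself: change of variables from time to distance. -/
theorem lintegral_approach {w : Vel} (hw : w ≠ 0) (y : Vel) (F : ℝ → ENNReal) :
    ∫⁻ t : ℝ, ENNReal.ofReal (max (inner ℝ (y - t • w) w) 0 / ‖y - t • w‖) * F ‖y - t • w‖
      = ∫⁻ r in Ioi (lineDist w y), F r := by
  set τ := inner ℝ y w / ‖w‖ ^ 2 with hτ
  have hwp : 0 < ‖w‖ := norm_pos_iff.2 hw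
  have hin : ∀ t, inner ℝ (y - t • w) w = (τ - t) * ‖w‖ ^ 2 := inner_sub_smul hw y
  have hns : ∀ t, ‖y - t • w‖ ^ 2 = lineDist w y ^ 2 + ((τ - t) * ‖w‖) ^ 2 := norm_sub_smul_sq hw y
  have hd0 : 0 ≤ lineDist w y := norm_nonneg _
  have hne : ∀ t ∈ Iio τ, y - t • w ≠ 0 := by
    intro t ht h
    have := hin t
    rw [h, inner_zero_left] at this
    have : 0 < (τ - t) * ‖w‖ ^ 2 := mul_pos (sub_pos.2 ht) (by positivity)
    linarith
  -- Only times before the closest approach `τ` count: afterwards the positive part vanishes, and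
  -- before it the distance decreases strictly through all values above `lineDist w y`.
  have himg : (fun t : ℝ => ‖y - t • w‖) '' Iio τ = Ioi (lineDist w y) := by
    ext r
    constructor
    · rintro ⟨t, ht, rfl⟩
      have h1 := hns t
      have h2 : 0 < (τ - t) * ‖w‖ := mul_pos (sub_pos.2 ht) hwp
      exact lt_of_pow_lt_pow_left₀ 2 (norm_nonneg _) (by nlinarith)
    · intro hr
      have hr' : lineDist w y < r := hr
      refine ⟨τ - √(r ^ 2 - lineDist w y ^ 2) / ‖w‖, ?_, ?_⟩
      · have : 0 < √(r ^ 2 - lineDist w y ^ 2) := Real.sqrt_pos.2 (by nlinarith)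
        have : 0 < √(r ^ 2 - lineDist w y ^ 2) / ‖w‖ := by positivity
        simp [this]
      · have h1 := hns (τ - √(r ^ 2 - lineDist w y ^ 2) / ‖w‖)
        rw [sub_sub_cancel, div_mul_cancel₀ _ hwp.ne', Real.sq_sqrt (by nlinarith)] at h1
        have h2 : ‖y - (τ - √(r ^ 2 - lineDist w y ^ 2) / ‖w‖) • w‖ ^ 2 = r ^ 2 := by linarith
        exact (pow_left_inj₀ (norm_nonneg _) (by linarith) two_ne_zero).1 h2
  have hinj : InjOn (fun t : ℝ => ‖y - t • w‖) (Iio τ) := by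
    intro t ht s hs hts
    have h1 := hns t
    have h2 := hns s
    simp only at hts
    rw [hts, h2] at h1
    have h3 : ((τ - t) * ‖w‖) ^ 2 = ((τ - s) * ‖w‖) ^ 2 := by linarith
    have h4 := (pow_left_inj₀ (mul_pos (sub_pos.2 ht) hwp).le (mul_pos (sub_pos.2 hs) hwp).le
      two_ne_zero).1 h3
    have := mul_right_cancel₀ hwp.ne' h4
    linarith
  have hder : ∀ t ∈ Iio τ, HasDerivWithinAt (fun t : ℝ => ‖y - t • w‖)
      (-(inner ℝ (y - t • w) w / ‖y - t • w‖)) (Iio τ) t := by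
    intro t ht
    have h1 : HasDerivAt (fun t : ℝ => y - t • w) (-w) t := by
      simpa using ((hasDerivAt_id t).smul_const w).const_sub y
    have h2 := h1.norm_sq.sqrt (by simpa using hne t ht)
    simp only [Real.sqrt_sq (norm_nonneg _)] at h2
    refine (h2.congr_deriv ?_).hasDerivWithinAt
    rw [inner_neg_right]
    field_simp
  rw [← himg, lintegral_image_eq_lintegral_abs_deriv_mul measurableSet_Iio hder hinj,
    ← lintegral_indicator measurableSet_Iio]
  refine lintegral_congr fun t => ?_
  by_cases ht : t ∈ Iio τ
  · have h1 : 0 ≤ inner ℝ (y - t • w) w := by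
      rw [hin]
      exact mul_nonneg (sub_nonneg.2 (le_of_lt ht)) (by positivity)
    rw [indicator_of_mem ht, max_eq_left h1, abs_neg, abs_of_nonneg (by positivity)]
  · have h1 : inner ℝ (y - t • w) w ≤ 0 := by
      rw [hin]
      exact mul_nonpos_of_nonpos_of_nonneg (sub_nonpos.2 (not_lt.1 ht)) (by positivity)
    rw [indicator_of_notMem ht, max_eq_right h1]
    simp

/-- The map (t, ν) ↦ t w + ε ν on the leading hemisphere parametrizes the tube of radius ε about the
line, with Jacobian ε² (ν·w)₊. Calculus on the sphere is avoided by averaging over radii: the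
integral of `K` over (x, t) is evaluated once in polar coordinates for x, and once with the end
point y = t w + x fixed, where `lintegral_approach` turns time into distance. Rescaling by ε/r
reduces every radius r to radius ε, and the two values share the factor `κ`. -/
theorem lintegral_flux {w : Vel} (hw : w ≠ 0) {ε : ℝ} (hε : 0 < ε) {f : Vel → ENNReal}
    (hf : Measurable f) :
    ENNReal.ofReal (ε ^ 2) * ∫⁻ ν : Direction,
        (∫⁻ t : ℝ, ENNReal.ofReal (max (inner ℝ (ν : Vel) w) 0) * f (t • w + ε • (ν : Vel)))
          ∂sphereMeasure
      = ∫⁻ y in {y | lineDist w y < ε}, f y := by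
  -- The auxiliary radius r = ‖x‖ is restricted to (0, 1), so that κ = ∫₀¹ r³ dr is neither 0 nor ∞
  -- and can be cancelled.
  set χ : ℝ → ENNReal := (Ioo (0 : ℝ) 1).indicator 1 with hχ
  have hχm : Measurable χ := measurable_one.indicator measurableSet_Ioo
  have hL : MeasurableSet {y | lineDist w y < ε} :=
    measurableSet_lt (measurable_lineDist w) measurable_const
  set κ : ENNReal := ∫⁻ r, χ r * ENNReal.ofReal (r ^ 3) with hκ
  set A : Direction → ENNReal := fun ν =>
    ∫⁻ t : ℝ, ENNReal.ofReal (max (inner ℝ (ν : Vel) w) 0) * f (t • w + ε • (ν : Vel)) with hA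
  have hAm : Measurable A := by
    rw [hA]
    refine Measurable.lintegral_prod_right' (f := fun p : Direction × ℝ =>
      ENNReal.ofReal (max (inner ℝ (p.1 : Vel) w) 0) * f (p.2 • w + ε • (p.1 : Vel))) ?_
    fun_prop
  set K : Vel → ℝ → ENNReal := fun x t => ENNReal.ofReal (max (inner ℝ x w) 0 / ‖x‖) *
    (χ ‖x‖ * f ((ε / ‖x‖) • (t • w + x))) with hK
  have hKm : Measurable (Function.uncurry K) := by
    simp only [hK, Function.uncurry_def]
    fun_prop
  -- first evaluation: polar coordinates
  have e1 : ∫⁻ x, ∫⁻ t, K x t = ENNReal.ofReal ε⁻¹ * κ * ∫⁻ ν, A ν ∂sphereMeasure := by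
    rw [lintegral_polar (G := fun x => ∫⁻ t, K x t) hKm.lintegral_prod_right', ← lintegral_const_mul _ hAm]
    refine lintegral_congr fun ν => ?_
    have h1 : ∀ r ∈ Ioi (0 : ℝ), ENNReal.ofReal (r ^ 2) * ∫⁻ t, K (r • (ν : Vel)) t
        = χ r * ENNReal.ofReal (r ^ 3) * (ENNReal.ofReal ε⁻¹ * A ν) := by
      intro r hr
      have hr : 0 < r := hr
      have hfm : Measurable fun t : ℝ => ENNReal.ofReal (max (inner ℝ (ν : Vel) w) 0) *
          f (t • w + ε • (ν : Vel)) := by fun_prop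
      have h2 := lintegral_comp_smul_addHaar (volume : Measure ℝ) hfm (c := ε / r) (by positivity)
      have h3 : ∀ t, K (r • (ν : Vel)) t = χ r * (ENNReal.ofReal (max (inner ℝ (ν : Vel) w) 0) *
          f (((ε / r) • t) • w + ε • (ν : Vel))) := by
        intro t
        have hnr : ‖r • (ν : Vel)‖ = r := by rw [norm_smul_of_nonneg hr.le, norm_direction, mul_one]
        have hi : max (inner ℝ (r • (ν : Vel)) w) 0 / r = max (inner ℝ (ν : Vel) w) 0 := by
          rw [real_inner_smul_left, ← mul_zero r, ← mul_max_of_nonneg _ _ hr.le, mul_zero]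
          field_simp
        simp only [hK]
        rw [hnr, hi, smul_add, smul_smul, smul_smul, div_mul_cancel₀ _ hr.ne', smul_eq_mul]
        ring
      simp_rw [h3]
      rw [lintegral_const_mul _ (by fun_prop), h2]
      simp only [Module.finrank_self, pow_one, inv_div]
      rw [div_eq_mul_inv, ENNReal.ofReal_mul hr.le, pow_succ r 2, ENNReal.ofReal_mul (by positivity)]
      ring
    rw [setLIntegral_congr_fun measurableSet_Ioi h1, lintegral_mul_const _ (by fun_prop)]
    have h4 : ∫⁻ r in Ioi (0 : ℝ), χ r * ENNReal.ofReal (r ^ 3) = κ := by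
      rw [hκ, ← lintegral_indicator measurableSet_Ioi]
      refine lintegral_congr fun r => ?_
      by_cases hr : r ∈ Ioi (0 : ℝ)
      · rw [indicator_of_mem hr]
      · rw [indicator_of_notMem hr, hχ, indicator_of_notMem (fun h => hr h.1), zero_mul]
    rw [h4]
    ring
  -- second evaluation: for a fixed end point, integrate over the starting point on the line
  have e2 : ∫⁻ x, ∫⁻ t, K x t = ENNReal.ofReal (ε ^ 3)⁻¹ * κ *
      ∫⁻ y in {y | lineDist w y < ε}, f y := by
    rw [lintegral_lintegral_swap hKm.aemeasurable]
    have h1 : ∀ t, ∫⁻ x, K x t = ∫⁻ y, K (y - t • w) t := fun t =>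
      (lintegral_sub_right_eq_self (fun x => K x t) (t • w)).symm
    simp_rw [h1]
    rw [lintegral_lintegral_swap (by
      have : Measurable fun p : ℝ × Vel => K (p.2 - p.1 • w) p.1 :=
        hKm.comp (f := fun p : ℝ × Vel => (p.2 - p.1 • w, p.1)) (by fun_prop)
      exact this.aemeasurable)]
    have h2 : ∀ y, ∫⁻ t, K (y - t • w) t = ∫⁻ r, χ r *
        ({y | lineDist w y < ε}.indicator f ((ε / r) • y)) := by
      intro y
      have h3 := lintegral_approach hw y (fun r => χ r * f ((ε / r) • y))
      simp only [hK, add_sub_cancel]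
      rw [h3, ← lintegral_indicator measurableSet_Ioi]
      refine lintegral_congr fun r => ?_
      by_cases hr : r ∈ Ioo (0 : ℝ) 1
      · have hr0 : 0 < r := hr.1
        by_cases hy : lineDist w y < r
        · rw [indicator_of_mem (mem_Ioi.2 hy), indicator_of_mem]
          change lineDist w ((ε / r) • y) < ε
          rw [lineDist_smul _ _ (by positivity), div_mul_eq_mul_div, div_lt_iff₀ hr0]
          exact mul_lt_mul_of_pos_left hy hε
        · rw [indicator_of_notMem (by simpa using hy), indicator_of_notMem, mul_zero]
          change ¬ lineDist w ((ε / r) • y) < ε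
          rw [lineDist_smul _ _ (by positivity), div_mul_eq_mul_div, div_lt_iff₀ hr0]
          intro h
          exact hy (lt_of_mul_lt_mul_left h hε.le)
      · rw [hχ, indicator_of_notMem hr, zero_mul]
        simp [indicator, hr]
    simp_rw [h2]
    have hgm : Measurable ({y | lineDist w y < ε}.indicator f) := hf.indicator hL
    rw [lintegral_lintegral_swap (by
      have : Measurable fun p : Vel × ℝ => χ p.2 *
        ({y | lineDist w y < ε}.indicator f ((ε / p.2) • p.1)) := by fun_prop
      exact this.aemeasurable)]
    have h3 : ∀ r, ∫⁻ y, χ r * ({y | lineDist w y < ε}.indicator f ((ε / r) • y))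
        = χ r * ENNReal.ofReal (r ^ 3) * (ENNReal.ofReal (ε ^ 3)⁻¹ *
          ∫⁻ y in {y | lineDist w y < ε}, f y) := by
      intro r
      rw [lintegral_const_mul _ (by fun_prop)]
      by_cases hr : r ∈ Ioo (0 : ℝ) 1
      · have hr0 : 0 < r := hr.1
        rw [lintegral_comp_smul_addHaar _ hgm (by positivity), lintegral_indicator hL,
          show Module.finrank ℝ Vel = 3 by simp, div_pow, inv_div, div_eq_mul_inv,
          ENNReal.ofReal_mul (by positivity)]
        ring
      · rw [hχ, indicator_of_notMem hr, zero_mul, zero_mul, zero_mul]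
    simp_rw [h3]
    rw [lintegral_mul_const _ (by fun_prop)]
    ring
  have hκ0 : κ ≠ 0 := by
    rw [hκ, Ne, lintegral_eq_zero_iff (by fun_prop)]
    intro h
    have h1 : ∀ᵐ r : ℝ, r ∉ Ioo (0 : ℝ) 1 := by
      filter_upwards [h] with r hr hmem
      rw [hχ, indicator_of_mem hmem] at hr
      have : (0 : ℝ) < r ^ 3 := pow_pos hmem.1 3
      simp only [Pi.one_apply, one_mul, Pi.zero_apply, ENNReal.ofReal_eq_zero] at hr
      linarith
    have h2 : volume (Ioo (0 : ℝ) 1) = 0 := by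
      rw [← compl_compl (Ioo (0 : ℝ) 1)]
      exact h1
    simp at h2
  have hκt : κ ≠ ⊤ := by
    have : κ ≤ ∫⁻ r in Ioo (0 : ℝ) 1, 1 := by
      rw [hκ, ← lintegral_indicator measurableSet_Ioo]
      refine lintegral_mono fun r => ?_
      by_cases hr : r ∈ Ioo (0 : ℝ) 1
      · rw [hχ, indicator_of_mem hr, indicator_of_mem hr, Pi.one_apply, one_mul,
          ENNReal.ofReal_le_one]
        exact pow_le_one₀ hr.1.le hr.2.le
      · rw [hχ, indicator_of_notMem hr, zero_mul]
        simp
    refine ne_top_of_le_ne_top ?_ this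
    simp
  rw [e1] at e2
  have e3 : (∫⁻ ν, A ν ∂sphereMeasure) * ENNReal.ofReal ε⁻¹ =
      ENNReal.ofReal (ε ^ 3)⁻¹ * ∫⁻ y in {y | lineDist w y < ε}, f y := by
    refine (ENNReal.mul_right_inj hκ0 hκt).1 ?_
    calc _ = _ := by ring
      _ = _ := e2
      _ = _ := by ring
  have e4 : ENNReal.ofReal (ε ^ 2) = ENNReal.ofReal (ε ^ 3) * ENNReal.ofReal ε⁻¹ := by
    rw [← ENNReal.ofReal_mul (by positivity)]
    congr 1
    field_simp
  have e5 : ENNReal.ofReal (ε ^ 3) * ENNReal.ofReal (ε ^ 3)⁻¹ = 1 := by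
    rw [← ENNReal.ofReal_mul (by positivity), mul_inv_cancel₀ (by positivity), ENNReal.ofReal_one]
  rw [e4, mul_assoc, mul_comm (ENNReal.ofReal ε⁻¹), e3, ← mul_assoc, e5, one_mul]

/-! ### Volumes swept by a moving ball, and collision coordinates on the torus. -/

/-- The flux of a beam of velocity `w` through the unit sphere. -/
noncomputable def flux (w : Vel) : ENNReal :=
  ∫⁻ ν : Direction, ENNReal.ofReal (max (inner ℝ (ν : Vel) w) 0) ∂sphereMeasure

theorem flux_le (w : Vel) : flux w ≤ ENNReal.ofReal ‖w‖ * sphereMeasure univ := by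
  rw [← lintegral_const]
  refine lintegral_mono fun ν => ENNReal.ofReal_le_ofReal (max_le ?_ (norm_nonneg _))
  simpa using real_inner_le_norm (ν : Vel) w

theorem flux_ne_top (w : Vel) : flux w ≠ ⊤ :=
  ne_top_of_le_ne_top (ENNReal.mul_ne_top ENNReal.ofReal_ne_top (measure_ne_top _ _)) (flux_le w)

theorem volume_vel_closedBall {r : ℝ} (hr : 0 ≤ r) :
    volume (Metric.closedBall (0 : Vel) r) = ENNReal.ofReal (4 / 3 * Real.pi * r ^ 3) := by
  rw [EuclideanSpace.volume_closedBall_fin_three, ← ENNReal.ofReal_pow hr,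
    ← ENNReal.ofReal_mul (by positivity)]
  congr 1
  ring

/-- A point enters a moving ball through its leading hemisphere. If it lies outside the initial ball
and inside at some time in [0, δ], its entry time is in [0, δ], so the flux identity for the
indicator sees only these times. -/
theorem volume_tube_diff_le {w : Vel} (hw : w ≠ 0) {ε δ : ℝ} (hε : 0 < ε) :
    volume ({y : Vel | ∃ s ∈ Icc 0 δ, ‖y - s • w‖ < ε} \ Metric.closedBall 0 ε)
      ≤ ENNReal.ofReal (ε ^ 2) * (ENNReal.ofReal δ * flux w) := by
  set O : Set Vel := {y : Vel | ∃ s ∈ Icc 0 δ, ‖y - s • w‖ < ε} with hO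
  have hOo : IsOpen O := by
    have : O = ⋃ s ∈ Icc 0 δ, {y : Vel | ‖y - s • w‖ < ε} := by
      ext y; simp [hO]
    rw [this]
    exact isOpen_biUnion fun s _ => isOpen_lt (by fun_prop) continuous_const
  have hm : MeasurableSet (O \ Metric.closedBall 0 ε) :=
    hOo.measurableSet.diff measurableSet_closedBall
  have h1 := lintegral_flux hw hε (measurable_one.indicator hm : Measurable
    ((O \ Metric.closedBall 0 ε).indicator (1 : Vel → ENNReal)))
  have h2 : volume (O \ Metric.closedBall 0 ε) = ∫⁻ y in {y | lineDist w y < ε},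
      (O \ Metric.closedBall 0 ε).indicator (1 : Vel → ENNReal) y := by
    rw [lintegral_indicator_one hm, Measure.restrict_apply hm, inter_eq_left.2]
    rintro y ⟨⟨s, _, hs⟩, _⟩
    have h3 := norm_sub_smul_sq hw y s
    refine lt_of_le_of_lt ?_ hs
    have h0 : 0 ≤ lineDist w y := norm_nonneg _
    refine (pow_le_pow_iff_left₀ h0 (norm_nonneg _) two_ne_zero).1 ?_
    nlinarith [sq_nonneg ((inner ℝ y w / ‖w‖ ^ 2 - s) * ‖w‖)]
  rw [h2, ← h1]
  refine mul_le_mul_right ?_ _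
  have h3 : ∀ ν : Direction, ∀ t : ℝ, ENNReal.ofReal (max (inner ℝ (ν : Vel) w) 0) *
      (O \ Metric.closedBall 0 ε).indicator (1 : Vel → ENNReal) (t • w + ε • (ν : Vel))
      ≤ (Icc 0 δ).indicator (fun _ => ENNReal.ofReal (max (inner ℝ (ν : Vel) w) 0)) t := by
    intro ν t
    by_cases hν : inner ℝ (ν : Vel) w ≤ 0
    · simp [max_eq_right hν]
    by_cases hmem : t • w + ε • (ν : Vel) ∈ O \ Metric.closedBall 0 ε
    swap
    · rw [indicator_of_notMem hmem, mul_zero]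
      simp
    have ht : t ∈ Icc 0 δ := by
      push Not at hν
      obtain ⟨⟨s, hs, hlt⟩, hnot⟩ := hmem
      have hwp : 0 < ‖w‖ := norm_pos_iff.2 hw
      -- The point is inside the ball at time s exactly when the product is negative for a = t - s.
      -- As ν·w > 0, this forces a < 0 and a positive bracket. The bracket stays positive for a = t
      -- because s ≥ 0, and then lying outside initially excludes t < 0.
      have key : ∀ a : ℝ, ‖a • w + ε • (ν : Vel)‖ ^ 2
          = a * (a * ‖w‖ ^ 2 + 2 * ε * inner ℝ (ν : Vel) w) + ε ^ 2 := by
        intro a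
        rw [norm_add_sq_real, norm_smul, norm_smul, inner_smul_left, inner_smul_right,
          norm_direction, real_inner_comm, mul_pow, Real.norm_eq_abs, sq_abs, mul_one,
          Real.norm_eq_abs, sq_abs]
        simp only [conj_trivial]
        ring
      have hs' : t • w + ε • (ν : Vel) - s • w = (t - s) • w + ε • (ν : Vel) := by module
      rw [hs'] at hlt
      have k1 := key (t - s)
      have k2 := key t
      have hlt2 : ‖(t - s) • w + ε • (ν : Vel)‖ ^ 2 < ε ^ 2 := by gcongr
      have hgt2 : ε ^ 2 < ‖t • w + ε • (ν : Vel)‖ ^ 2 := by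
        have : ε < ‖t • w + ε • (ν : Vel)‖ := by simpa using hnot
        gcongr
      have hεν : 0 < 2 * ε * inner ℝ (ν : Vel) w := by positivity
      have a1 : t - s < 0 := by
        by_contra hcon
        push Not at hcon
        have : 0 ≤ (t - s) * ((t - s) * ‖w‖ ^ 2 + 2 * ε * inner ℝ (ν : Vel) w) := by positivity
        linarith
      have a2 : 0 < (t - s) * ‖w‖ ^ 2 + 2 * ε * inner ℝ (ν : Vel) w := by
        by_contra hcon
        push Not at hcon
        have := mul_nonneg_of_nonpos_of_nonpos a1.le hcon
        linarith
      have a3 : 0 < t * ‖w‖ ^ 2 + 2 * ε * inner ℝ (ν : Vel) w := by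
        have : 0 ≤ s * ‖w‖ ^ 2 := mul_nonneg hs.1 (by positivity)
        nlinarith
      refine ⟨?_, by linarith [hs.2]⟩
      by_contra hcon
      push Not at hcon
      have := mul_neg_of_neg_of_pos hcon a3
      linarith
    rw [indicator_of_mem ht, indicator_of_mem hmem, Pi.one_apply, mul_one]
  calc _ ≤ ∫⁻ ν : Direction, (∫⁻ t : ℝ, (Icc 0 δ).indicator
            (fun _ => ENNReal.ofReal (max (inner ℝ (ν : Vel) w) 0)) t) ∂sphereMeasure :=
        lintegral_mono fun ν => lintegral_mono fun t => h3 ν t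
    _ = ENNReal.ofReal δ * flux w := by
        simp_rw [lintegral_indicator measurableSet_Icc, lintegral_const]
        rw [flux, ← lintegral_const_mul _ (by fun_prop)]
        refine lintegral_congr fun ν => ?_
        simp [mul_comm]

/-- Closed balls of radius ε lie in open balls of radius r > ε. The price is the shell between the
two radii, whose volume vanishes as r decreases to ε. -/
theorem volume_swept_le (w : Vel) {ε δ : ℝ} (hε : 0 < ε) :
    volume {y : Vel | ∃ s ∈ Icc 0 δ, ‖y - s • w‖ ≤ ε ∧ ε < ‖y‖}
      ≤ ENNReal.ofReal (ε ^ 2) * (ENNReal.ofReal δ * flux w) := by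
  by_cases hw : w = 0
  · have : {y : Vel | ∃ s ∈ Icc 0 δ, ‖y - s • w‖ ≤ ε ∧ ε < ‖y‖} = ∅ := by
      ext y
      simp only [hw, smul_zero, sub_zero, mem_ofPred_eq, mem_empty_iff_false, iff_false]
      rintro ⟨s, _, h1, h2⟩
      linarith
    rw [this]
    simp
  set C := ENNReal.ofReal δ * flux w with hC
  have hCt : C ≠ ⊤ := ENNReal.mul_ne_top ENNReal.ofReal_ne_top (flux_ne_top w)
  have hlim : Tendsto (fun r : ℝ => ENNReal.ofReal (r ^ 2) * C +
      ENNReal.ofReal (4 / 3 * Real.pi * r ^ 3 - 4 / 3 * Real.pi * ε ^ 3)) (𝓝[>] ε)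
      (𝓝 (ENNReal.ofReal (ε ^ 2) * C + ENNReal.ofReal (4 / 3 * Real.pi * ε ^ 3 - 4 / 3 * Real.pi * ε ^ 3))) := by
    refine Tendsto.mono_left ?_ nhdsWithin_le_nhds
    refine Tendsto.add (ENNReal.Tendsto.mul_const ?_ (Or.inr hCt)) ?_
    · exact ENNReal.tendsto_ofReal (Continuous.tendsto (by fun_prop) ε)
    · exact ENNReal.tendsto_ofReal (Continuous.tendsto (by fun_prop) ε)
  rw [sub_self, ENNReal.ofReal_zero, add_zero] at hlim
  refine ge_of_tendsto hlim ?_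
  filter_upwards [self_mem_nhdsWithin] with r hr
  have hr : ε < r := hr
  have hr0 : 0 < r := hε.trans hr
  have hsub : {y : Vel | ∃ s ∈ Icc 0 δ, ‖y - s • w‖ ≤ ε ∧ ε < ‖y‖} ⊆
      ({y : Vel | ∃ s ∈ Icc 0 δ, ‖y - s • w‖ < r} \ Metric.closedBall 0 r) ∪
        (Metric.closedBall 0 r \ Metric.closedBall 0 ε) := by
    rintro y ⟨s, hs, h1, h2⟩
    by_cases hy : y ∈ Metric.closedBall (0 : Vel) r
    · exact Or.inr ⟨hy, by simpa using h2⟩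
    · exact Or.inl ⟨⟨s, hs, h1.trans_lt hr⟩, hy⟩
  refine (measure_mono hsub).trans ((measure_union_le _ _).trans
    (add_le_add (volume_tube_diff_le hw hr0) ?_))
  rw [measure_sdiff (Metric.closedBall_subset_closedBall hr.le)
    measurableSet_closedBall.nullMeasurableSet measure_closedBall_lt_top.ne,
    volume_vel_closedBall hr0.le, volume_vel_closedBall hε.le,
    ENNReal.ofReal_sub _ (by positivity)]

/-- The change of variables from the time and the direction of a collision to the initial position
of the background particle, as an inequality for an injective parametrization. -/
theorem lintegral_collision_le {w : Vel} {ε : ℝ} (hε : 0 < ε) (a : Torus)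
    {R : Set (ℝ × Direction)} (hR : MeasurableSet R)
    (hinj : InjOn (fun p : ℝ × Direction => a + toTorus (p.1 • w + ε • (p.2 : Vel))) R)
    (hpos : ∀ p ∈ R, 0 < inner ℝ (p.2 : Vel) w) {q : Torus → ENNReal} (hq : Measurable q) :
    ∫⁻ p in R, ENNReal.ofReal (ε ^ 2 * max (inner ℝ (p.2 : Vel) w) 0) *
        q (a + toTorus (p.1 • w + ε • (p.2 : Vel))) ∂((volume : Measure ℝ).prod sphereMeasure)
      ≤ ∫⁻ x, q x := by
  rcases R.eq_empty_or_nonempty with hR0 | ⟨p₀, hp₀⟩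
  · simp [hR0]
  have hw : w ≠ 0 := by
    rintro rfl
    simpa using hpos p₀ hp₀
  set φ : ℝ × Direction → Vel := fun p => p.1 • w + ε • (p.2 : Vel) with hφ
  have hφm : Measurable φ := by fun_prop
  have hφinj : InjOn φ R := fun p hp p' hp' h => hinj hp hp' (by
    have : p.1 • w + ε • (p.2 : Vel) = p'.1 • w + ε • (p'.2 : Vel) := h
    simp only [this])
  -- Injectivity into the torus implies injectivity into `Vel`, so the image is measurable by
  -- Lusin–Souslin.
  have hQ : MeasurableSet (φ '' R) := hR.image_of_measurable_injOn hφm hφinj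
  have hTinj : InjOn toTorus (φ '' R) := by
    rintro _ ⟨p, hp, rfl⟩ _ ⟨p', hp', rfl⟩ h
    rw [hinj hp hp' (by simp only [hφ] at h; simp only [h])]
  have hf : Measurable ((φ '' R).indicator fun y => q (a + toTorus y)) :=
    (hq.comp (measurable_toTorus.const_add a)).indicator hQ
  have hgm : Measurable fun p : ℝ × Direction =>
      ENNReal.ofReal (max (inner ℝ (p.2 : Vel) w) 0) *
        (φ '' R).indicator (fun y => q (a + toTorus y)) (φ p) :=
    Measurable.mul (by fun_prop) (hf.comp hφm)
  calc _ = ∫⁻ p, R.indicator (fun p : ℝ × Direction =>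
            ENNReal.ofReal (ε ^ 2 * max (inner ℝ (p.2 : Vel) w) 0) *
            q (a + toTorus (p.1 • w + ε • (p.2 : Vel)))) p
            ∂((volume : Measure ℝ).prod sphereMeasure) := (lintegral_indicator hR _).symm
    _ ≤ ∫⁻ p : ℝ × Direction, ENNReal.ofReal (ε ^ 2) *
          (ENNReal.ofReal (max (inner ℝ (p.2 : Vel) w) 0) *
          (φ '' R).indicator (fun y => q (a + toTorus y)) (φ p))
            ∂((volume : Measure ℝ).prod sphereMeasure) := by
        refine lintegral_mono fun p => ?_
        by_cases hp : p ∈ R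
        · simp only
          rw [indicator_of_mem hp, indicator_of_mem (mem_image_of_mem φ hp),
            ENNReal.ofReal_mul (by positivity), mul_assoc]
        · simp [indicator_of_notMem hp]
    _ = ENNReal.ofReal (ε ^ 2) * ∫⁻ ν : Direction,
        (∫⁻ t : ℝ, ENNReal.ofReal (max (inner ℝ (ν : Vel) w) 0) *
          (φ '' R).indicator (fun y => q (a + toTorus y)) (t • w + ε • (ν : Vel)))
          ∂sphereMeasure := by
        rw [lintegral_const_mul _ hgm, lintegral_prod_symm _ hgm.aemeasurable]
    _ = ∫⁻ y in {y | lineDist w y < ε}, (φ '' R).indicator (fun y => q (a + toTorus y)) y :=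
        lintegral_flux hw hε hf
    _ ≤ ∫⁻ y, (φ '' R).indicator (fun y => q (a + toTorus y)) y := setLIntegral_le_lintegral _ _
    _ = ∫⁻ x, q (a + x) ∂(Measure.map toTorus (volume.restrict (φ '' R))) := by
        rw [lintegral_indicator hQ, lintegral_map (by fun_prop) measurable_toTorus]
    _ ≤ ∫⁻ x, q (a + x) := by
        refine lintegral_mono' (Measure.le_iff.2 fun B hB => ?_) le_rfl
        rw [Measure.map_apply measurable_toTorus hB,
          Measure.restrict_apply (measurable_toTorus hB), inter_comm]
        exact volume_inter_preimage_toTorus_le hQ hTinj hB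
    _ = ∫⁻ x, q x := lintegral_add_left_eq_self _ a

/-! ### Prefixes of trees and causality of the trajectory. -/

/-- The tree with initial data `r` and markers `c`. -/
abbrev treeOf {n : ℕ} (r : Torus × Vel) (c : Fin n → Marker) : CollisionTree := ⟨n, (r, c)⟩

/-- Two trees have the same initial data and the same first `k` markers. -/
structure AgreeUpTo (k : ℕ) (Φ Ψ : CollisionTree) : Prop where
  root : Φ.2.1 = Ψ.2.1
  le_left : k ≤ numColl Φ
  le_right : k ≤ numColl Ψ
  marker : ∀ i (h : i < numColl Φ) (h' : i < numColl Ψ), i < k → Φ.2.2 ⟨i, h⟩ = Ψ.2.2 ⟨i, h'⟩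

theorem AgreeUpTo.symm {k : ℕ} {Φ Ψ : CollisionTree} (h : AgreeUpTo k Φ Ψ) : AgreeUpTo k Ψ Φ :=
  ⟨h.root.symm, h.le_right, h.le_left, fun i h1 h2 h3 => (h.marker i h2 h1 h3).symm⟩

theorem agreeUpTo_init {n : ℕ} (r : Torus × Vel) (c : Fin (n + 1) → Marker) :
    AgreeUpTo n (treeOf r c) (treeOf r (Fin.init c)) :=
  ⟨rfl, Nat.le_succ n, le_rfl, fun _ _ _ _ => rfl⟩

theorem AgreeUpTo.velAfter_eq {k : ℕ} {Φ Ψ : CollisionTree} (h : AgreeUpTo k Φ Ψ) :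
    ∀ i, i ≤ k → velAfter Φ i = velAfter Ψ i
  | 0, _ => by
    unfold velAfter rootVel
    rw [h.root]
  | i + 1, hi => by
    have h1 : i < numColl Φ := lt_of_lt_of_le hi h.le_left
    have h2 : i < numColl Ψ := lt_of_lt_of_le hi h.le_right
    have h3 := h.marker i h1 h2 hi
    have h4 := h.velAfter_eq i (by omega)
    rw [velAfter, velAfter, dif_pos h1, dif_pos h2, h4]
    unfold collDir collVel
    rw [h3]

/-- The collision time with a natural number index. -/
noncomputable def timeN (Φ : CollisionTree) (i : ℕ) : ℝ :=
  if h : i < numColl Φ then collTime Φ ⟨i, h⟩ else 0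

theorem pos_eq_sum_range (Φ : CollisionTree) (s : ℝ) :
    pos Φ s = rootPos Φ + toTorus (s • rootVel Φ + ∑ i ∈ Finset.range (numColl Φ),
      max (s - timeN Φ i) 0 • (velAfter Φ (i + 1) - velAfter Φ i)) := by
  rw [pos, ← Fin.sum_univ_eq_sum_range
    (fun i => max (s - timeN Φ i) 0 • (velAfter Φ (i + 1) - velAfter Φ i))]
  simp [timeN]

theorem pos_eq_sum_of_le {Φ : CollisionTree} {k : ℕ} (hk : k ≤ numColl Φ) {s : ℝ}
    (h : ∀ j : Fin (numColl Φ), k ≤ j → s ≤ collTime Φ j) :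
    pos Φ s = rootPos Φ + toTorus (s • rootVel Φ + ∑ i ∈ Finset.range k,
      max (s - timeN Φ i) 0 • (velAfter Φ (i + 1) - velAfter Φ i)) := by
  rw [pos_eq_sum_range]
  congr 3
  symm
  refine Finset.sum_subset (Finset.range_mono hk) fun i hi hik => ?_
  have hi' : i < numColl Φ := Finset.mem_range.1 hi
  have hik' : k ≤ i := by simpa using hik
  have := h ⟨i, hi'⟩ hik'
  rw [timeN, dif_pos hi', max_eq_right (by linarith), zero_smul]

/-- Causality: up to and including the next collision time, the later velocity jumps enter the
position with the factor (s - t_j)₊ = 0. -/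
theorem AgreeUpTo.pos_eq {k : ℕ} {Φ Ψ : CollisionTree} (h : AgreeUpTo k Φ Ψ) {s : ℝ}
    (h1 : ∀ j : Fin (numColl Φ), k ≤ j → s ≤ collTime Φ j)
    (h2 : ∀ j : Fin (numColl Ψ), k ≤ j → s ≤ collTime Ψ j) : pos Φ s = pos Ψ s := by
  rw [pos_eq_sum_of_le h.le_left h1, pos_eq_sum_of_le h.le_right h2, rootPos, rootPos, rootVel,
    rootVel, h.root]
  congr 3
  refine Finset.sum_congr rfl fun i hi => ?_
  have hi : i < k := Finset.mem_range.1 hi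
  rw [h.velAfter_eq (i + 1) hi, h.velAfter_eq i hi.le, timeN, timeN,
    dif_pos (lt_of_lt_of_le hi h.le_left), dif_pos (lt_of_lt_of_le hi h.le_right)]
  unfold collTime
  rw [h.marker i _ _ hi]

theorem pos_init {n : ℕ} (r : Torus × Vel) (c : Fin (n + 1) → Marker) {s : ℝ}
    (hs : s ≤ (c (Fin.last n)).1) : pos (treeOf r c) s = pos (treeOf r (Fin.init c)) s := by
  refine (agreeUpTo_init r c).pos_eq (fun j hj => ?_) (fun j hj => absurd j.2 (not_lt.2 hj))
  have : j = Fin.last n := by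
    have h1 : (j : ℕ) < n + 1 := j.2
    apply Fin.ext
    simp only [Fin.val_last]
    omega
  rw [this]
  exact hs

theorem pos_zero (Φ : CollisionTree) (h : ∀ j, 0 < collTime Φ j) : pos Φ 0 = rootPos Φ := by
  rw [pos_eq_sum_of_le (k := 0) (Nat.zero_le _) fun j _ => (h j).le]
  simp [toTorus_zero]

/-- The position at time `0` obtained by extending the last free flight of the tree backwards. -/
noncomputable def flightBase (Φ : CollisionTree) : Torus :=
  rootPos Φ - toTorus (∑ j : Fin (numColl Φ),
    collTime Φ j • (velAfter Φ ((j : ℕ) + 1) - velAfter Φ (j : ℕ)))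

theorem pos_eq_flightBase {Φ : CollisionTree} {s : ℝ} (h : ∀ j, collTime Φ j ≤ s) :
    pos Φ s = flightBase Φ + toTorus (s • velAfter Φ (numColl Φ)) := by
  have h1 : ∀ j : Fin (numColl Φ), max (s - collTime Φ j) 0 = s - collTime Φ j := fun j =>
    max_eq_left (sub_nonneg.2 (h j))
  have h2 : ∑ j : Fin (numColl Φ), (velAfter Φ ((j : ℕ) + 1) - velAfter Φ (j : ℕ))
      = velAfter Φ (numColl Φ) - rootVel Φ := by
    rw [Fin.sum_univ_eq_sum_range (fun i => velAfter Φ (i + 1) - velAfter Φ i),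
      Finset.sum_range_sub]
    rfl
  rw [pos, flightBase]
  simp_rw [h1, sub_smul]
  rw [Finset.sum_sub_distrib, ← Finset.smul_sum, h2, sub_add_eq_add_sub, add_sub_assoc,
    ← toTorus_sub]
  congr 2
  module

/-! Joint continuity, for a fixed number of collisions. -/

theorem continuous_collTime (n : ℕ) (j : Fin n) :
    Continuous fun p : (Torus × Vel) × (Fin n → Marker) => collTime ⟨n, p⟩ j := by
  unfold collTime
  dsimp only
  fun_prop

theorem continuous_collVel (n : ℕ) (j : Fin n) :
    Continuous fun p : (Torus × Vel) × (Fin n → Marker) => collVel ⟨n, p⟩ j := by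
  unfold collVel
  dsimp only
  fun_prop

theorem continuous_collDir (n : ℕ) (j : Fin n) :
    Continuous fun p : (Torus × Vel) × (Fin n → Marker) => collDir ⟨n, p⟩ j := by
  unfold collDir
  dsimp only
  fun_prop

theorem continuous_velAfter (n k : ℕ) :
    Continuous fun p : (Torus × Vel) × (Fin n → Marker) => velAfter ⟨n, p⟩ k := by
  induction k with
  | zero =>
    exact continuous_snd.comp continuous_fst
  | succ k ih =>
    by_cases h : k < n
    · have : (fun p : (Torus × Vel) × (Fin n → Marker) => velAfter ⟨n, p⟩ (k + 1)) = fun p =>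
          collide (collDir ⟨n, p⟩ ⟨k, h⟩) (collVel ⟨n, p⟩ ⟨k, h⟩) (velAfter ⟨n, p⟩ k) := by
        funext p
        rw [velAfter, dif_pos h]
      rw [this]
      have h1 := continuous_collDir n ⟨k, h⟩
      have h2 := continuous_collVel n ⟨k, h⟩
      unfold collide
      have h3 : Continuous fun p : (Torus × Vel) × (Fin n → Marker) =>
          inner ℝ (collDir ⟨n, p⟩ ⟨k, h⟩) (velAfter ⟨n, p⟩ k - collVel ⟨n, p⟩ ⟨k, h⟩) :=
        Continuous.inner h1 (ih.sub h2)
      exact ih.sub (h3.smul h1)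
    · have : (fun p : (Torus × Vel) × (Fin n → Marker) => velAfter ⟨n, p⟩ (k + 1)) = fun p =>
          velAfter ⟨n, p⟩ k := by
        funext p
        rw [velAfter, dif_neg h]
      rw [this]
      exact ih

theorem continuous_pos (n : ℕ) :
    Continuous fun p : ((Torus × Vel) × (Fin n → Marker)) × ℝ => pos ⟨n, p.1⟩ p.2 := by
  have h0 : Continuous fun p : ((Torus × Vel) × (Fin n → Marker)) × ℝ => p.1.1.1 := by fun_prop
  have h0' : Continuous fun p : ((Torus × Vel) × (Fin n → Marker)) × ℝ => p.2 • p.1.1.2 := by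
    fun_prop
  have h1 := fun j => (continuous_collTime n j).comp
    (continuous_fst : Continuous fun p : ((Torus × Vel) × (Fin n → Marker)) × ℝ => p.1)
  have h2 := fun k => (continuous_velAfter n k).comp
    (continuous_fst : Continuous fun p : ((Torus × Vel) × (Fin n → Marker)) × ℝ => p.1)
  have h3 : Continuous fun p : ((Torus × Vel) × (Fin n → Marker)) × ℝ => ∑ j : Fin n,
      max (p.2 - collTime ⟨n, p.1⟩ j) 0 •
        (velAfter ⟨n, p.1⟩ ((j : ℕ) + 1) - velAfter ⟨n, p.1⟩ (j : ℕ)) :=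
    continuous_finsetSum _ fun j _ =>
      ((continuous_snd.sub (h1 j)).max continuous_const).smul ((h2 (j + 1)).sub (h2 j))
  exact h0.add (continuous_toTorus.comp (h0'.add h3))

theorem continuous_partnerStart (ε : ℝ) (n : ℕ) (j : Fin n) :
    Continuous fun p : (Torus × Vel) × (Fin n → Marker) => partnerStart ε ⟨n, p⟩ j := by
  unfold partnerStart
  refine Continuous.add ?_ (continuous_toTorus.comp ?_)
  · exact (continuous_pos n).comp (continuous_id.prodMk (continuous_collTime n j))
  · exact ((continuous_collDir n j).const_smul ε).sub
      ((continuous_collTime n j).smul (continuous_collVel n j))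

theorem continuous_partnerPos (ε : ℝ) (n : ℕ) (j : Fin n) :
    Continuous fun p : ((Torus × Vel) × (Fin n → Marker)) × ℝ => partnerPos ε ⟨n, p.1⟩ j p.2 := by
  unfold partnerPos
  exact ((continuous_partnerStart ε n j).comp continuous_fst).add
    (continuous_toTorus.comp (continuous_snd.smul ((continuous_collVel n j).comp continuous_fst)))

/-! Velocities along a tree. -/

theorem velBefore_collTime {Φ : CollisionTree} (h : StrictMono (collTime Φ))
    (j : Fin (numColl Φ)) : velBefore Φ (collTime Φ j) = velAfter Φ j := by
  unfold velBefore
  congr 1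
  have : (Finset.univ.filter fun i => collTime Φ i < collTime Φ j) = Finset.Iio j := by
    ext i
    simp [h.lt_iff_lt]
  rw [this, Fin.card_Iio]

theorem vel_collTime {Φ : CollisionTree} (h : StrictMono (collTime Φ))
    (j : Fin (numColl Φ)) : vel Φ (collTime Φ j) = velAfter Φ (j + 1) := by
  unfold vel
  congr 1
  have : (Finset.univ.filter fun i => collTime Φ i ≤ collTime Φ j) = Finset.Iic j := by
    ext i
    simp [h.le_iff_le]
  rw [this, Fin.card_Iic]

theorem vel_zero {Φ : CollisionTree} (h : ∀ j, 0 < collTime Φ j) : vel Φ 0 = rootVel Φ := by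
  unfold vel
  have : (Finset.univ.filter fun i => collTime Φ i ≤ 0) = ∅ := by
    ext i
    simp [h i]
  rw [this, Finset.card_empty]
  rfl

/-- The cut-off and `maxRate` refer to velocities at times in [0, T], the computations to velocities
after k collisions. This translates from the former to the latter. -/
theorem exists_vel_eq_velAfter {T : ℝ} (hT : 0 ≤ T) {Φ : CollisionTree} (h : IsTree T Φ) {k : ℕ}
    (hk : k ≤ numColl Φ) : ∃ s ∈ Icc 0 T, vel Φ s = velAfter Φ k := by
  cases k with
  | zero => exact ⟨0, ⟨le_rfl, hT⟩, vel_zero fun j => (h.1 j).1⟩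
  | succ k =>
    exact ⟨collTime Φ ⟨k, hk⟩, ⟨(h.1 _).1.le, (h.1 _).2⟩, vel_collTime h.2 ⟨k, hk⟩⟩

theorem torusDist_partnerPos_le {ε : ℝ} (hε : 0 ≤ ε) (Φ : CollisionTree) (j : Fin (numColl Φ)) :
    torusDist (pos Φ (collTime Φ j)) (partnerPos ε Φ j (collTime Φ j)) ≤ ε := by
  have h : pos Φ (collTime Φ j) - partnerPos ε Φ j (collTime Φ j)
      = toTorus (-(ε • collDir Φ j)) := by
    unfold partnerPos partnerStart
    rw [toTorus_neg, toTorus_sub]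
    abel
  refine (torusDist_le_norm h).trans ?_
  rw [norm_neg, norm_smul_of_nonneg hε]
  unfold collDir
  rw [norm_direction, mul_one]

/-! Uniqueness of the history. -/

/-- `Φ` is the history of collisions, and `p` lists the particles with which they take place. -/
structure IsHistoryVia {N : ℕ} (ε t : ℝ) (z : Config N) (Φ : CollisionTree)
    (p : Fin (numColl Φ) → Fin N) : Prop where
  root : Φ.2.1 = z.1
  isTree : IsTree t Φ
  noOverlap : ∀ i, ε < torusDist z.1.1 (z.2 i).1
  vel_eq : ∀ j, (z.2 (p j)).2 = collVel Φ j
  pos_eq : ∀ j, bgPos z (p j) (collTime Φ j) = pos Φ (collTime Φ j) + toTorus (ε • collDir Φ j)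
  contact : ∀ s ∈ Icc 0 t, ∀ i, torusDist (pos Φ s) (bgPos z i s) ≤ ε →
    ∃ j, p j = i ∧ collTime Φ j = s

theorem isHistory_iff {N : ℕ} {ε t : ℝ} {z : Config N} {Φ : CollisionTree} :
    IsHistory ε t z Φ ↔ ∃ p, IsHistoryVia ε t z Φ p := by
  constructor
  · rintro ⟨h1, h2, h3, p, h4, h5⟩
    exact ⟨p, h1, h2, h3, fun j => (h4 j).1, fun j => (h4 j).2, h5⟩
  · rintro ⟨p, h⟩
    exact ⟨h.root, h.isTree, h.noOverlap, p, fun j => ⟨h.vel_eq j, h.pos_eq j⟩, h.contact⟩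

theorem torusDist_add_smul_le {ε : ℝ} (hε : 0 ≤ ε) (x : Torus) (ν : Direction) :
    torusDist x (x + toTorus (ε • (ν : Vel))) ≤ ε := by
  have h : x - (x + toTorus (ε • (ν : Vel))) = toTorus (-(ε • (ν : Vel))) := by
    rw [toTorus_neg]
    abel
  refine (torusDist_le_norm h).trans ?_
  rw [norm_neg, norm_smul_of_nonneg hε, norm_direction, mul_one]

theorem direction_eq_of_toTorus {ε : ℝ} (hε : 0 < ε) (hε2 : ε < 1 / 2) {ν ν' : Direction}
    (h : toTorus (ε • (ν : Vel)) = toTorus (ε • (ν' : Vel))) : ν = ν' := by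
  have hn : ∀ ν : Direction, ‖ε • (ν : Vel)‖ ≤ ε := fun ν => by
    rw [norm_smul_of_nonneg hε.le, norm_direction, mul_one]
  have := toTorus_injOn_small hε2 (hn ν) (hn ν') h
  exact Subtype.ext (smul_right_injective _ hε.ne' this)

namespace IsHistoryVia

variable {N : ℕ} {ε t : ℝ} {z : Config N} {Φ Ψ : CollisionTree}
  {p : Fin (numColl Φ) → Fin N} {q : Fin (numColl Ψ) → Fin N}

theorem dist_le (hε : 0 ≤ ε) (h : IsHistoryVia ε t z Φ p) (j : Fin (numColl Φ)) :
    torusDist (pos Φ (collTime Φ j)) (bgPos z (p j) (collTime Φ j)) ≤ ε := by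
  rw [h.pos_eq j]
  exact torusDist_add_smul_le hε _ (Φ.2.2 j).2.1

/-- A collision under one labelling is a contact, hence a listed collision under the other. Distinct
collisions have distinct times, so the indices agree. -/
theorem labels_unique (hε : 0 ≤ ε) {p' : Fin (numColl Φ) → Fin N} (h : IsHistoryVia ε t z Φ p)
    (h' : IsHistoryVia ε t z Φ p') : p = p' := by
  funext j
  obtain ⟨j', h1, h2⟩ := h'.contact (collTime Φ j)
    ⟨(h.isTree.1 j).1.le, (h.isTree.1 j).2⟩ (p j) (h.dist_le hε j)
  rw [h.isTree.2.injective h2] at h1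
  exact h1.symm

/-- The trajectories coincide until the earlier of the two next collisions. That contact therefore
occurs along both trees, must be listed in both, and determines partner, direction and velocity. -/
theorem agree_succ (hε : 0 < ε) (hε2 : ε < 1 / 2) (h : IsHistoryVia ε t z Φ p)
    (h' : IsHistoryVia ε t z Ψ q) {k : ℕ} (ha : AgreeUpTo k Φ Ψ) (hk : k < numColl Φ)
    (hle : ∀ hk' : k < numColl Ψ, collTime Φ ⟨k, hk⟩ ≤ collTime Ψ ⟨k, hk'⟩) :
    AgreeUpTo (k + 1) Φ Ψ := by
  set s := collTime Φ ⟨k, hk⟩ with hs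
  have h1 : ∀ j : Fin (numColl Φ), k ≤ j → s ≤ collTime Φ j := fun j hj =>
    h.isTree.2.monotone (Fin.mk_le_of_le_val hj)
  have h2 : ∀ j : Fin (numColl Ψ), k ≤ j → s ≤ collTime Ψ j := fun j hj =>
    (hle (lt_of_le_of_lt hj j.2)).trans (h'.isTree.2.monotone (Fin.mk_le_of_le_val hj))
  have hpos : pos Φ s = pos Ψ s := ha.pos_eq h1 h2
  have hst : s ∈ Icc 0 t := ⟨(h.isTree.1 _).1.le, (h.isTree.1 _).2⟩
  obtain ⟨j, hj1, hj2⟩ := h'.contact s hst (p ⟨k, hk⟩) (by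
    rw [← hpos]; exact h.dist_le hε.le ⟨k, hk⟩)
  -- A collision of `Ψ` with index below k is shared with `Φ`, so it happens strictly before `s`.
  have hkj : k ≤ j := by
    by_contra hcon
    push Not at hcon
    have hjΦ : (j : ℕ) < numColl Φ := hcon.trans hk
    have e1 : collTime Φ ⟨j, hjΦ⟩ = collTime Ψ j := by
      unfold collTime
      rw [ha.marker j hjΦ j.2 hcon]
    have e2 : collTime Φ ⟨j, hjΦ⟩ < s := h.isTree.2 (Fin.mk_lt_mk.2 hcon)
    rw [e1, hj2] at e2
    exact lt_irrefl _ e2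
  have hk' : k < numColl Ψ := lt_of_le_of_lt hkj j.2
  have hjk : j = ⟨k, hk'⟩ := by
    refine h'.isTree.2.injective (le_antisymm ?_ ?_)
    · rw [hj2]; exact hle hk'
    · exact h'.isTree.2.monotone (Fin.mk_le_of_le_val hkj)
  subst hjk
  have hm : Φ.2.2 ⟨k, hk⟩ = Ψ.2.2 ⟨k, hk'⟩ := by
    refine Prod.ext hj2.symm (Prod.ext ?_ ?_)
    · refine direction_eq_of_toTorus hε hε2 ?_
      have e1 := h.pos_eq ⟨k, hk⟩
      have e2 := h'.pos_eq ⟨k, hk'⟩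
      rw [hj1, hj2, ← hpos] at e2
      rw [e2] at e1
      exact (add_left_cancel e1).symm
    · have e1 := h.vel_eq ⟨k, hk⟩
      have e2 := h'.vel_eq ⟨k, hk'⟩
      rw [hj1, e1] at e2
      exact e2
  refine ⟨ha.root, hk, hk', fun i hi hi' hik => ?_⟩
  rcases Nat.lt_succ_iff_lt_or_eq.1 hik with h3 | h3
  · exact ha.marker i hi hi' h3
  · subst h3
    exact hm

theorem agree (hε : 0 < ε) (hε2 : ε < 1 / 2) (h : IsHistoryVia ε t z Φ p)
    (h' : IsHistoryVia ε t z Ψ q) (k : ℕ) (hk : k ≤ numColl Φ) : AgreeUpTo k Φ Ψ := by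
  induction k with
  | zero => exact ⟨h.root.trans h'.root.symm, Nat.zero_le _, Nat.zero_le _, fun i _ _ hi => by omega⟩
  | succ k ih =>
    have ha := ih (by omega)
    by_cases hle : ∀ hk' : k < numColl Ψ, collTime Φ ⟨k, hk⟩ ≤ collTime Ψ ⟨k, hk'⟩
    · exact agree_succ hε hε2 h h' ha hk hle
    · push Not at hle
      obtain ⟨hk', hlt⟩ := hle
      exact (agree_succ hε hε2 h' h ha.symm hk' fun _ => hlt.le).symm

theorem tree_unique (hε : 0 < ε) (hε2 : ε < 1 / 2) (h : IsHistoryVia ε t z Φ p)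
    (h' : IsHistoryVia ε t z Ψ q) : Φ = Ψ := by
  have h1 := agree hε hε2 h h' _ le_rfl
  have h2 := agree hε hε2 h' h _ le_rfl
  obtain ⟨n, r, c⟩ := Φ
  obtain ⟨m, r', c'⟩ := Ψ
  have hnm : n = m := le_antisymm h1.le_right h2.le_right
  subst hnm
  have hr : r = r' := h1.root
  subst hr
  have hc : c = c' := funext fun i => h1.marker i i.2 i.2 i.2
  rw [hc]

end IsHistoryVia

/-! Measurability of conditions quantified over a time interval. -/

/-- Projection along a compact interval is a closed map. This is what makes conditions over
uncountably many times measurable. -/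
theorem isClosed_exists_mem_Icc {X : Type*} [TopologicalSpace X] {a b : ℝ} {D : Set (X × ℝ)}
    (hD : IsClosed D) : IsClosed {x | ∃ s ∈ Icc a b, (x, s) ∈ D} := by
  have h1 : IsClosed ((fun p : X × Icc a b => (p.1, (p.2 : ℝ))) ⁻¹' D) :=
    hD.preimage (by fun_prop)
  have h2 := isClosedMap_fst_of_compactSpace (X := X) (Y := Icc a b) _ h1
  convert h2 using 1
  ext x
  constructor
  · rintro ⟨s, hs, h⟩
    exact ⟨(x, ⟨s, hs⟩), h, rfl⟩
  · rintro ⟨⟨x', s⟩, h, rfl⟩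
    exact ⟨s, s.2, h⟩

section TimeConditions

variable {X : Type*} [TopologicalSpace X] [MeasurableSpace X] [OpensMeasurableSpace X]
  {D : X × ℝ → ℝ}

/-- The strict bound on the time is not a closed condition. The margins 1/(m+1) exhaust it by
countably many closed ones. -/
theorem measurableSet_forall_lt (hD : Continuous D) {τ : X → ℝ} (hτ : Continuous τ) (ε t : ℝ) :
    MeasurableSet {x | ∀ s ∈ Icc 0 t, s < τ x → ε < D (x, s)} := by
  have : {x | ∀ s ∈ Icc 0 t, s < τ x → ε < D (x, s)} = ⋂ m : ℕ,
      {x | ∃ s ∈ Icc 0 t, (x, s) ∈ {p : X × ℝ | p.2 + 1 / (m + 1 : ℝ) ≤ τ p.1 ∧ D p ≤ ε}}ᶜ := by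
    ext x
    simp only [mem_ofPred_eq, mem_iInter, mem_compl_iff, not_exists, not_and, not_le]
    constructor
    · intro h m s hs hle
      have : (0 : ℝ) < 1 / (m + 1 : ℝ) := by positivity
      exact h s hs (by linarith)
    · intro h s hs hlt
      obtain ⟨m, hm⟩ := exists_nat_one_div_lt (sub_pos.2 hlt)
      exact h m s hs (by linarith)
  rw [this]
  refine MeasurableSet.iInter fun m => (isClosed_exists_mem_Icc ?_).measurableSet.compl
  have h1 : Continuous fun p : X × ℝ => p.2 + 1 / (m + 1 : ℝ) := by fun_prop
  exact (isClosed_le h1 (hτ.comp continuous_fst)).inter (isClosed_le hD continuous_const)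

/-- Neighbourhoods of radius 1/(m+1) of the permitted times are removed. For a given other time,
finiteness of `ι` provides one m that works for all `τ j x` at once. -/
theorem measurableSet_contact {ι : Type*} [Finite ι] (hD : Continuous D) {τ : ι → X → ℝ}
    (hτ : ∀ j, Continuous (τ j)) (ε t : ℝ) :
    MeasurableSet {x | ∀ s ∈ Icc 0 t, D (x, s) ≤ ε → ∃ j, τ j x = s} := by
  have : {x | ∀ s ∈ Icc 0 t, D (x, s) ≤ ε → ∃ j, τ j x = s} = ⋂ m : ℕ,
      {x | ∃ s ∈ Icc 0 t, (x, s) ∈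
        {p : X × ℝ | (∀ j, 1 / (m + 1 : ℝ) ≤ |τ j p.1 - p.2|) ∧ D p ≤ ε}}ᶜ := by
    ext x
    simp only [mem_ofPred_eq, mem_iInter, mem_compl_iff, not_exists, not_and, not_le]
    constructor
    · intro h m s hs hle
      by_contra hcon
      obtain ⟨j, hj⟩ := h s hs (not_lt.1 hcon)
      have h1 := hle j
      rw [hj, sub_self, abs_zero] at h1
      have : (0 : ℝ) < 1 / (m + 1 : ℝ) := by positivity
      linarith
    · intro h s hs hle
      by_contra! hcon
      have h1 : ∀ᶠ m : ℕ in atTop, ∀ j, 1 / (m + 1 : ℝ) ≤ |τ j x - s| := by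
        rw [eventually_all]
        intro j
        have h2 : 0 < |τ j x - s| := abs_pos.2 (sub_ne_zero.2 (hcon j))
        exact (tendsto_one_div_add_atTop_nhds_zero_nat.eventually_lt_const h2).mono
          fun m hm => hm.le
      obtain ⟨m, hm⟩ := h1.exists
      exact absurd hle (not_le.2 (h m s hs hm))
  rw [this]
  refine MeasurableSet.iInter fun m => (isClosed_exists_mem_Icc ?_).measurableSet.compl
  have : {p : X × ℝ | (∀ j, 1 / (m + 1 : ℝ) ≤ |τ j p.1 - p.2|) ∧ D p ≤ ε}
      = (⋂ j, {p : X × ℝ | 1 / (m + 1 : ℝ) ≤ |τ j p.1 - p.2|}) ∩ {p | D p ≤ ε} := by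
    ext p
    simp
  rw [this]
  refine (isClosed_iInter fun j => ?_).inter (isClosed_le hD continuous_const)
  exact isClosed_le continuous_const ((((hτ j).comp continuous_fst).sub continuous_snd).abs)

end TimeConditions

theorem measurableSet_isTree (n : ℕ) (t : ℝ) :
    MeasurableSet {p : (Torus × Vel) × (Fin n → Marker) | IsTree t ⟨n, p⟩} := by
  have hm := fun j => (continuous_collTime n j).measurable
  have : {p : (Torus × Vel) × (Fin n → Marker) | IsTree t ⟨n, p⟩}
      = (⋂ j : Fin n, {p | 0 < collTime ⟨n, p⟩ j} ∩ {p | collTime ⟨n, p⟩ j ≤ t}) ∩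
        ⋂ i : Fin n, ⋂ j : Fin n, ⋂ _ : i < j, {p | collTime ⟨n, p⟩ i < collTime ⟨n, p⟩ j} := by
    ext p
    simp [IsTree, StrictMono]
  rw [this]
  refine (MeasurableSet.iInter fun j => ?_).inter (MeasurableSet.iInter fun i =>
    MeasurableSet.iInter fun j => MeasurableSet.iInter fun _ => measurableSet_lt (hm i) (hm j))
  exact (measurableSet_lt measurable_const (hm j)).inter (measurableSet_le (hm j) measurable_const)

/-! ### Change of variables from markers to initial data of background particles. -/

/-- Trees whose collisions are the first contacts, and non-grazing. -/
def firstContact (ε t : ℝ) (n : ℕ) : Set ((Torus × Vel) × (Fin n → Marker)) :=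
  {p | IsTree t ⟨n, p⟩ ∧
    (∀ j : Fin n, ∀ s ∈ Icc 0 t, s < collTime ⟨n, p⟩ j →
      ε < torusDist (pos ⟨n, p⟩ s) (partnerPos ε ⟨n, p⟩ j s)) ∧
    ∀ j : Fin n, 0 < inner ℝ (collDir ⟨n, p⟩ j) (velAfter ⟨n, p⟩ j - collVel ⟨n, p⟩ j)}

theorem continuous_normalVel (n : ℕ) (j : Fin n) :
    Continuous fun p : (Torus × Vel) × (Fin n → Marker) =>
      (inner ℝ (collDir ⟨n, p⟩ j) (velAfter ⟨n, p⟩ j - collVel ⟨n, p⟩ j) : ℝ) :=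
  Continuous.inner (continuous_collDir n j)
    ((continuous_velAfter n j).sub (continuous_collVel n j))

theorem continuous_partnerDist (ε : ℝ) (n : ℕ) (j : Fin n) :
    Continuous fun p : ((Torus × Vel) × (Fin n → Marker)) × ℝ =>
      torusDist (pos ⟨n, p.1⟩ p.2) (partnerPos ε ⟨n, p.1⟩ j p.2) :=
  continuous_torusDist (continuous_pos n) (continuous_partnerPos ε n j)

theorem measurableSet_firstContact (ε t : ℝ) (n : ℕ) : MeasurableSet (firstContact ε t n) := by
  have : firstContact ε t n = {p | IsTree t ⟨n, p⟩} ∩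
      ((⋂ j : Fin n, {p | ∀ s ∈ Icc 0 t, s < collTime ⟨n, p⟩ j →
        ε < torusDist (pos ⟨n, p⟩ s) (partnerPos ε ⟨n, p⟩ j s)}) ∩
      ⋂ j : Fin n, {p | 0 < inner ℝ (collDir ⟨n, p⟩ j) (velAfter ⟨n, p⟩ j - collVel ⟨n, p⟩ j)}) := by
    ext p
    simp [firstContact]
  rw [this]
  refine (measurableSet_isTree n t).inter ((MeasurableSet.iInter fun j => ?_).inter
    (MeasurableSet.iInter fun j =>
      measurableSet_lt measurable_const (continuous_normalVel n j).measurable))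
  exact measurableSet_forall_lt (continuous_partnerDist ε n j) (continuous_collTime n j) ε t

/-- The initial data of the background particles of a tree. -/
noncomputable def startMap (ε : ℝ) {n : ℕ} (p : (Torus × Vel) × (Fin n → Marker)) :
    Fin n → Torus × Vel :=
  fun j => (partnerStart ε ⟨n, p⟩ j, collVel ⟨n, p⟩ j)

theorem measurable_startMap (ε : ℝ) (n : ℕ) :
    Measurable (startMap ε : (Torus × Vel) × (Fin n → Marker) → _) :=
  measurable_pi_iff.2 fun j => ((continuous_partnerStart ε n j).measurable.prodMk
    (continuous_collVel n j).measurable :)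

/-- The Jacobian of `startMap`. -/
noncomputable def startJac (ε : ℝ) {n : ℕ} (p : (Torus × Vel) × (Fin n → Marker)) : ENNReal :=
  ∏ j : Fin n, ENNReal.ofReal
    (ε ^ 2 * max (inner ℝ (collDir ⟨n, p⟩ j) (velAfter ⟨n, p⟩ j - collVel ⟨n, p⟩ j)) 0)

theorem measurable_startJac (ε : ℝ) (n : ℕ) :
    Measurable (startJac ε : (Torus × Vel) × (Fin n → Marker) → _) := by
  unfold startJac
  refine Finset.measurable_prod _ fun j _ => ?_
  exact ((((continuous_normalVel n j).measurable.max measurable_const).const_mul _).ennreal_ofReal)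

theorem measurable_snoc {α : Type*} [MeasurableSpace α] (n : ℕ) :
    Measurable fun p : (Fin n → α) × α => (Fin.snoc p.1 p.2 : Fin (n + 1) → α) := by
  refine measurable_pi_iff.2 fun i => ?_
  induction i using Fin.lastCases with
  | last =>
    simp only [Fin.snoc_last]
    fun_prop
  | cast i =>
    simp only [Fin.snoc_castSucc]
    fun_prop

theorem measurable_snoc_right {α : Type*} [MeasurableSpace α] {n : ℕ} (y : Fin n → α) :
    Measurable fun x : α => (Fin.snoc y x : Fin (n + 1) → α) :=
  (measurable_snoc n).comp (measurable_prodMk_left (x := y))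

theorem lintegral_pi_snoc {α : Type*} [MeasurableSpace α] (μ : Measure α) [SigmaFinite μ] {n : ℕ}
    {f : (Fin (n + 1) → α) → ENNReal} (hf : Measurable f) :
    ∫⁻ c, f c ∂(Measure.pi fun _ => μ) = ∫⁻ c, ∫⁻ m, f (Fin.snoc c m) ∂μ ∂(Measure.pi fun _ => μ) := by
  have h := (measurePreserving_piFinSuccAbove (fun _ : Fin (n + 1) => μ) (Fin.last n)).symm
  rw [← h.lintegral_comp hf, lintegral_prod_symm]
  · refine lintegral_congr fun c => lintegral_congr fun m => ?_
    congr 1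
    exact Fin.insertNth_last' m c
  · exact (hf.comp (MeasurableEquiv.measurable _)).aemeasurable

/-- Lebesgue measure on markers. -/
noncomputable abbrev markerMeasure : Measure Marker :=
  (volume : Measure ℝ).prod (sphereMeasure.prod (volume : Measure Vel))

/-- The velocity becomes the outer variable, because the flux identity works at a fixed relative
velocity. -/
theorem lintegral_marker {f : Marker → ENNReal} (hf : Measurable f) :
    ∫⁻ m, f m ∂markerMeasure
      = ∫⁻ v : Vel, ∫⁻ p : ℝ × Direction, f (p.1, p.2, v) ∂((volume : Measure ℝ).prod sphereMeasure) := by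
  have h := measurePreserving_prodAssoc (volume : Measure ℝ) sphereMeasure (volume : Measure Vel)
  rw [← h.lintegral_comp hf, lintegral_prod_symm]
  · rfl
  · exact (hf.comp (MeasurableEquiv.measurable _)).aemeasurable

theorem velAfter_init {n : ℕ} (r : Torus × Vel) (c : Fin (n + 1) → Marker) {k : ℕ} (hk : k ≤ n) :
    velAfter (treeOf r c) k = velAfter (treeOf r (Fin.init c)) k :=
  (agreeUpTo_init r c).velAfter_eq k hk

theorem velAfter_snoc {n : ℕ} (r : Torus × Vel) (c : Fin n → Marker) (m : Marker) {k : ℕ}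
    (hk : k ≤ n) :
    velAfter (treeOf r (Fin.snoc c m : Fin (n + 1) → Marker)) k = velAfter (treeOf r c) k := by
  rw [velAfter_init r _ hk, Fin.init_snoc]

theorem pos_snoc {n : ℕ} (r : Torus × Vel) (c : Fin n → Marker) (m : Marker) {s : ℝ}
    (hs : s ≤ m.1) : pos (treeOf r (Fin.snoc c m : Fin (n + 1) → Marker)) s = pos (treeOf r c) s := by
  rw [pos_init, Fin.init_snoc]
  rwa [Fin.snoc_last]

theorem marker_snoc_castSucc {n : ℕ} (r : Torus × Vel) (c : Fin n → Marker) (m : Marker)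
    (j : Fin n) : (treeOf r (Fin.snoc c m : Fin (n + 1) → Marker)).2.2 j.castSucc = c j :=
  Fin.snoc_castSucc (α := fun _ => Marker) _ _ _

theorem marker_snoc_last {n : ℕ} (r : Torus × Vel) (c : Fin n → Marker) (m : Marker) :
    (treeOf r (Fin.snoc c m : Fin (n + 1) → Marker)).2.2 (Fin.last n) = m :=
  Fin.snoc_last (α := fun _ => Marker) _ _

theorem collTime_snoc_castSucc {n : ℕ} (r : Torus × Vel) (c : Fin n → Marker) (m : Marker)
    (j : Fin n) : collTime (treeOf r (Fin.snoc c m : Fin (n + 1) → Marker)) j.castSucc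
      = collTime (treeOf r c) j :=
  congrArg (fun m : Marker => m.1) (marker_snoc_castSucc r c m j)

theorem collTime_snoc_last {n : ℕ} (r : Torus × Vel) (c : Fin n → Marker) (m : Marker) :
    collTime (treeOf r (Fin.snoc c m : Fin (n + 1) → Marker)) (Fin.last n) = m.1 :=
  congrArg (fun m : Marker => m.1) (marker_snoc_last r c m)

theorem collDir_snoc_castSucc {n : ℕ} (r : Torus × Vel) (c : Fin n → Marker) (m : Marker)
    (j : Fin n) : collDir (treeOf r (Fin.snoc c m : Fin (n + 1) → Marker)) j.castSucc
      = collDir (treeOf r c) j :=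
  congrArg (fun m : Marker => (m.2.1 : Vel)) (marker_snoc_castSucc r c m j)

theorem collDir_snoc_last {n : ℕ} (r : Torus × Vel) (c : Fin n → Marker) (m : Marker) :
    collDir (treeOf r (Fin.snoc c m : Fin (n + 1) → Marker)) (Fin.last n) = m.2.1 :=
  congrArg (fun m : Marker => (m.2.1 : Vel)) (marker_snoc_last r c m)

theorem collVel_snoc_castSucc {n : ℕ} (r : Torus × Vel) (c : Fin n → Marker) (m : Marker)
    (j : Fin n) : collVel (treeOf r (Fin.snoc c m : Fin (n + 1) → Marker)) j.castSucc
      = collVel (treeOf r c) j :=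
  congrArg (fun m : Marker => m.2.2) (marker_snoc_castSucc r c m j)

theorem collVel_snoc_last {n : ℕ} (r : Torus × Vel) (c : Fin n → Marker) (m : Marker) :
    collVel (treeOf r (Fin.snoc c m : Fin (n + 1) → Marker)) (Fin.last n) = m.2.2 :=
  congrArg (fun m : Marker => m.2.2) (marker_snoc_last r c m)

theorem partnerStart_snoc_castSucc {n : ℕ} (ε : ℝ) (r : Torus × Vel) (c : Fin n → Marker)
    (m : Marker) (j : Fin n) (hj : collTime (treeOf r c) j ≤ m.1) :
    partnerStart ε (treeOf r (Fin.snoc c m : Fin (n + 1) → Marker)) j.castSucc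
      = partnerStart ε (treeOf r c) j := by
  unfold partnerStart
  rw [collTime_snoc_castSucc, collDir_snoc_castSucc, collVel_snoc_castSucc, pos_snoc r c m hj]

theorem partnerStart_snoc_last {n : ℕ} (ε : ℝ) (r : Torus × Vel) (c : Fin n → Marker)
    (m : Marker) (h : ∀ j, collTime (treeOf r c) j ≤ m.1) :
    partnerStart ε (treeOf r (Fin.snoc c m : Fin (n + 1) → Marker)) (Fin.last n)
      = flightBase (treeOf r c) +
        toTorus (m.1 • (velAfter (treeOf r c) n - m.2.2) + ε • (m.2.1 : Vel)) := by
  unfold partnerStart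
  rw [collTime_snoc_last, collDir_snoc_last, collVel_snoc_last, pos_snoc r c m le_rfl,
    pos_eq_flightBase h, add_assoc, ← toTorus_add]
  congr 2
  module

theorem isTree_snoc {n : ℕ} {t : ℝ} {r : Torus × Vel} {c : Fin n → Marker} {m : Marker}
    (h : IsTree t (treeOf r (Fin.snoc c m : Fin (n + 1) → Marker))) :
    IsTree t (treeOf r c) ∧ (0 < m.1 ∧ m.1 ≤ t) ∧ ∀ j, collTime (treeOf r c) j < m.1 := by
  refine ⟨⟨fun j => ?_, fun i j hij => ?_⟩, ?_, fun j => ?_⟩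
  · simpa only [collTime_snoc_castSucc] using h.1 j.castSucc
  · simpa only [collTime_snoc_castSucc] using h.2 (Fin.castSucc_lt_castSucc_iff.2 hij)
  · simpa only [collTime_snoc_last] using h.1 (Fin.last n)
  · simpa only [collTime_snoc_castSucc, collTime_snoc_last] using h.2 (Fin.castSucc_lt_last j)

/-- By causality the conditions on earlier collisions do not involve the last marker. This drives
the induction on the number of markers. -/
theorem firstContact_of_snoc {n : ℕ} {ε t : ℝ} {r : Torus × Vel} {c : Fin n → Marker}
    {m : Marker} (h : (r, (Fin.snoc c m : Fin (n + 1) → Marker)) ∈ firstContact ε t (n + 1)) :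
    (r, c) ∈ firstContact ε t n := by
  obtain ⟨h1, h2, h3⟩ := h
  obtain ⟨k1, k2, k3⟩ := isTree_snoc h1
  refine ⟨k1, fun j s hs hsj => ?_, fun j => ?_⟩
  · have := h2 j.castSucc s hs (by
      change s < collTime (treeOf r (Fin.snoc c m : Fin (n + 1) → Marker)) j.castSucc
      rw [collTime_snoc_castSucc]
      exact hsj)
    change ε < torusDist (pos (treeOf r (Fin.snoc c m : Fin (n + 1) → Marker)) s)
      (partnerPos ε (treeOf r (Fin.snoc c m : Fin (n + 1) → Marker)) j.castSucc s) at this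
    unfold partnerPos at this
    rw [partnerStart_snoc_castSucc ε r c m j (k3 j).le, collVel_snoc_castSucc,
      pos_snoc r c m (hsj.trans (k3 j)).le] at this
    exact this
  · have := h3 j.castSucc
    change 0 < inner ℝ (collDir (treeOf r (Fin.snoc c m : Fin (n + 1) → Marker)) j.castSucc)
      (velAfter (treeOf r (Fin.snoc c m : Fin (n + 1) → Marker)) j -
        collVel (treeOf r (Fin.snoc c m : Fin (n + 1) → Marker)) j.castSucc) at this
    rw [collDir_snoc_castSucc, collVel_snoc_castSucc, velAfter_snoc r c m j.2.le] at this
    exact this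

theorem startMap_snoc {n : ℕ} {ε : ℝ} {r : Torus × Vel} {c : Fin n → Marker} {m : Marker}
    (h : ∀ j, collTime (treeOf r c) j ≤ m.1) :
    startMap ε (r, (Fin.snoc c m : Fin (n + 1) → Marker)) =
      Fin.snoc (startMap ε (r, c)) (flightBase (treeOf r c) +
        toTorus (m.1 • (velAfter (treeOf r c) n - m.2.2) + ε • (m.2.1 : Vel)), m.2.2) := by
  funext j
  induction j using Fin.lastCases with
  | last =>
    rw [Fin.snoc_last]
    exact Prod.ext (partnerStart_snoc_last ε r c m h) (collVel_snoc_last r c m)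
  | cast j =>
    rw [Fin.snoc_castSucc]
    exact Prod.ext (partnerStart_snoc_castSucc ε r c m j (h j)) (collVel_snoc_castSucc r c m j)

theorem startJac_snoc {n : ℕ} (ε : ℝ) (r : Torus × Vel) (c : Fin n → Marker) (m : Marker) :
    startJac ε (r, (Fin.snoc c m : Fin (n + 1) → Marker)) = startJac ε (r, c) *
      ENNReal.ofReal (ε ^ 2 * max (inner ℝ (m.2.1 : Vel) (velAfter (treeOf r c) n - m.2.2)) 0) := by
  unfold startJac
  rw [Fin.prod_univ_castSucc]
  congr 1
  · refine Finset.prod_congr rfl fun j _ => ?_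
    change ENNReal.ofReal (ε ^ 2 * max (inner ℝ
      (collDir (treeOf r (Fin.snoc c m : Fin (n + 1) → Marker)) j.castSucc)
      (velAfter (treeOf r (Fin.snoc c m : Fin (n + 1) → Marker)) j -
        collVel (treeOf r (Fin.snoc c m : Fin (n + 1) → Marker)) j.castSucc)) 0) = _
    rw [collDir_snoc_castSucc, collVel_snoc_castSucc, velAfter_snoc r c m j.2.le]
  · change ENNReal.ofReal (ε ^ 2 * max (inner ℝ
      (collDir (treeOf r (Fin.snoc c m : Fin (n + 1) → Marker)) (Fin.last n))
      (velAfter (treeOf r (Fin.snoc c m : Fin (n + 1) → Marker)) n -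
        collVel (treeOf r (Fin.snoc c m : Fin (n + 1) → Marker)) (Fin.last n))) 0) = _
    rw [collDir_snoc_last, collVel_snoc_last, velAfter_snoc r c m le_rfl]

/-- Equal start and equal velocity mean the same background particle. If its collision came later
for `m'`, it would already be in contact at the time of `m`, against the first-contact condition. By
symmetry the start determines the collision time. -/
theorem time_le_of_start_eq {n : ℕ} {ε t : ℝ} (hε : 0 ≤ ε) {r : Torus × Vel} {c : Fin n → Marker}
    {m m' : Marker}
    (h : (r, (Fin.snoc c m : Fin (n + 1) → Marker)) ∈ firstContact ε t (n + 1))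
    (h' : (r, (Fin.snoc c m' : Fin (n + 1) → Marker)) ∈ firstContact ε t (n + 1))
    (hv : m.2.2 = m'.2.2)
    (hs : partnerStart ε (treeOf r (Fin.snoc c m : Fin (n + 1) → Marker)) (Fin.last n)
      = partnerStart ε (treeOf r (Fin.snoc c m' : Fin (n + 1) → Marker)) (Fin.last n)) :
    m'.1 ≤ m.1 := by
  by_contra! hlt
  obtain ⟨-, k1, -⟩ := isTree_snoc h.1
  have h1 := h'.2.1 (Fin.last n) m.1 ⟨k1.1.le, k1.2⟩ (by
    change m.1 < collTime (treeOf r (Fin.snoc c m' : Fin (n + 1) → Marker)) (Fin.last n)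
    rwa [collTime_snoc_last])
  have h2 := torusDist_partnerPos_le hε (treeOf r (Fin.snoc c m : Fin (n + 1) → Marker))
    (Fin.last n)
  rw [collTime_snoc_last] at h2
  change ε < torusDist (pos (treeOf r (Fin.snoc c m' : Fin (n + 1) → Marker)) m.1)
      (partnerPos ε (treeOf r (Fin.snoc c m' : Fin (n + 1) → Marker)) (Fin.last n) m.1) at h1
  unfold partnerPos at h1 h2
  rw [← hs, collVel_snoc_last, ← hv, pos_snoc r c m' hlt.le] at h1
  rw [collVel_snoc_last, pos_snoc r c m le_rfl] at h2
  exact absurd h2 (not_le.2 h1)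

/-- The change of variables from markers to initial data of the background particles. -/
theorem lintegral_startMap_le {ε : ℝ} (hε : 0 < ε) (hε2 : ε < 1 / 2) (t : ℝ) (r : Torus × Vel)
    (n : ℕ) {q : (Fin n → Torus × Vel) → ENNReal} (hq : Measurable q) :
    ∫⁻ c, (firstContact ε t n).indicator
        (fun p => startJac ε p * q (startMap ε p)) (r, c) ∂(Measure.pi fun _ => markerMeasure)
      ≤ ∫⁻ y, q y ∂(Measure.pi fun _ => volume) := by
  induction n with
  | zero =>
    rw [Measure.pi_of_empty (fun _ : Fin 0 => markerMeasure) Fin.elim0,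
      Measure.pi_of_empty (fun _ : Fin 0 => (volume : Measure (Torus × Vel))) Fin.elim0,
      lintegral_dirac' _ hq, lintegral_dirac]
    refine (indicator_le_self _ _ _).trans (le_of_eq ?_)
    unfold startJac
    rw [Finset.univ_eq_empty, Finset.prod_empty, one_mul]
    congr 1
    exact Subsingleton.elim _ _
  | succ n ih =>
    have hF : ∀ n : ℕ, ∀ q : (Fin n → Torus × Vel) → ENNReal, Measurable q → Measurable
        ((firstContact ε t n).indicator (fun p => startJac ε p * q (startMap ε p))) := fun n q hq =>
      ((measurable_startJac ε n).mul (hq.comp (measurable_startMap ε n))).indicator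
        (measurableSet_firstContact ε t n)
    have hFr : Measurable fun c => (firstContact ε t (n + 1)).indicator
        (fun p => startJac ε p * q (startMap ε p)) (r, c) :=
      (hF (n + 1) q hq).comp measurable_prodMk_left
    have hsnoc := measurable_snoc (α := Torus × Vel) n
    -- The last particle is integrated out with the earlier ones fixed; the induction hypothesis is
    -- then applied to the resulting function.
    set K : (Fin n → Torus × Vel) → ENNReal := fun y => ∫⁻ x, q (Fin.snoc y x) with hK
    have hKm : Measurable K := (hq.comp hsnoc).lintegral_prod_right'
    rw [lintegral_pi_snoc _ hFr, lintegral_pi_snoc _ hq]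
    refine le_trans (lintegral_mono fun c => ?_) (ih hKm)
    by_cases hc : (r, c) ∈ firstContact ε t n
    swap
    · have : ∀ m, (firstContact ε t (n + 1)).indicator (fun p => startJac ε p * q (startMap ε p))
          (r, Fin.snoc c m) = 0 := fun m =>
        indicator_of_notMem (fun h => hc (firstContact_of_snoc h)) _
      simp [this]
    rw [indicator_of_mem hc]
    have hcm : Measurable fun m : Marker => (firstContact ε t (n + 1)).indicator
        (fun p => startJac ε p * q (startMap ε p)) (r, Fin.snoc c m) :=
      hFr.comp (measurable_snoc_right c)
    have hqc : Measurable fun x => q (Fin.snoc (startMap ε (r, c)) x) :=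
      hq.comp (measurable_snoc_right _)
    have hKc : K (startMap ε (r, c)) = ∫⁻ v : Vel, ∫⁻ x : Torus,
        q (Fin.snoc (startMap ε (r, c)) (x, v)) := by
      simp only [hK]
      rw [Measure.volume_eq_prod, lintegral_prod_symm _ hqc.aemeasurable]
    change _ ≤ startJac ε (r, c) * K (startMap ε (r, c))
    rw [lintegral_marker hcm, hKc, ← lintegral_const_mul _ (by
      exact Measurable.lintegral_prod_left' (f := fun x => q (Fin.snoc (startMap ε (r, c)) x)) hqc)]
    refine lintegral_mono fun v => ?_
    -- For a fixed prefix and a fixed velocity `v`, the start of the last partner is `flightBase`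
    -- plus the projection of t w + ε ν, which is the setting of `lintegral_collision_le`.
    set w := velAfter (treeOf r c) n - v with hw
    set R : Set (ℝ × Direction) := {p | (r, (Fin.snoc c ((p.1, p.2, v) : Marker) :
      Fin (n + 1) → Marker)) ∈ firstContact ε t (n + 1)} with hR
    have hRm : MeasurableSet R := by
      refine (measurableSet_firstContact ε t (n + 1)).preimage ?_
      refine measurable_prodMk_left.comp (((measurable_snoc n).comp measurable_prodMk_left).comp ?_)
      fun_prop
    have hRt : ∀ p ∈ R, ∀ j, collTime (treeOf r c) j ≤ p.1 := fun p hp j =>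
      ((isTree_snoc hp.1).2.2 j).le
    have hqx : Measurable fun x : Torus => q (Fin.snoc (startMap ε (r, c)) (x, v)) :=
      hqc.comp measurable_prodMk_right
    have hpos : ∀ p ∈ R, 0 < inner ℝ (p.2 : Vel) w := by
      intro p hp
      have := hp.2.2 (Fin.last n)
      change 0 < inner ℝ
        (collDir (treeOf r (Fin.snoc c ((p.1, p.2, v) : Marker) : Fin (n + 1) → Marker)) (Fin.last n))
        (velAfter (treeOf r (Fin.snoc c ((p.1, p.2, v) : Marker) : Fin (n + 1) → Marker)) n -
          collVel (treeOf r (Fin.snoc c ((p.1, p.2, v) : Marker) : Fin (n + 1) → Marker))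
            (Fin.last n)) at this
      rwa [collDir_snoc_last, collVel_snoc_last, velAfter_snoc r c _ le_rfl] at this
    have hinj : InjOn (fun p : ℝ × Direction =>
        flightBase (treeOf r c) + toTorus (p.1 • w + ε • (p.2 : Vel))) R := by
      intro p hp p' hp' hpp
      have hpp : flightBase (treeOf r c) + toTorus (p.1 • w + ε • (p.2 : Vel))
        = flightBase (treeOf r c) + toTorus (p'.1 • w + ε • (p'.2 : Vel)) := hpp
      have e1 := partnerStart_snoc_last ε r c (p.1, p.2, v) (hRt p hp)
      have e2 := partnerStart_snoc_last ε r c (p'.1, p'.2, v) (hRt p' hp')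
      have e3 := e1.trans (hpp.trans e2.symm)
      have ht : p.1 = p'.1 := le_antisymm
        (time_le_of_start_eq (m := (p'.1, p'.2, v)) (m' := (p.1, p.2, v)) hε.le hp' hp rfl e3.symm)
        (time_le_of_start_eq (m := (p.1, p.2, v)) (m' := (p'.1, p'.2, v)) hε.le hp hp' rfl e3)
      refine Prod.ext ht (direction_eq_of_toTorus hε hε2 ?_)
      have e4 := add_left_cancel hpp
      rw [toTorus_add, toTorus_add, ht] at e4
      exact add_left_cancel e4
    have hmain := lintegral_collision_le hε (flightBase (treeOf r c)) hRm hinj hpos hqx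
    calc _ = ∫⁻ p in R, startJac ε (r, c) *
          (ENNReal.ofReal (ε ^ 2 * max (inner ℝ (p.2 : Vel) w) 0) *
          q (Fin.snoc (startMap ε (r, c)) (flightBase (treeOf r c) +
            toTorus (p.1 • w + ε • (p.2 : Vel)), v))) ∂((volume : Measure ℝ).prod sphereMeasure) := by
          rw [← lintegral_indicator hRm]
          refine lintegral_congr fun p => ?_
          by_cases hp : p ∈ R
          · have hp' : (r, (Fin.snoc c ((p.1, p.2, v) : Marker) : Fin (n + 1) → Marker)) ∈
                firstContact ε t (n + 1) := hp
            rw [indicator_of_mem hp, indicator_of_mem hp', startJac_snoc,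
              startMap_snoc (m := (p.1, p.2, v)) (hRt p hp), mul_assoc]
          · have hp' : (r, (Fin.snoc c ((p.1, p.2, v) : Marker) : Fin (n + 1) → Marker)) ∉
                firstContact ε t (n + 1) := hp
            rw [indicator_of_notMem hp, indicator_of_notMem hp']
      _ ≤ startJac ε (r, c) * ∫⁻ x : Torus, q (Fin.snoc (startMap ε (r, c)) (x, v)) := by
          rw [lintegral_const_mul]
          · exact mul_le_mul_right hmain _
          · refine Measurable.mul (by fun_prop) (hqx.comp ?_)
            exact (measurable_toTorus.comp (by fun_prop)).const_add _

/-! ### Measurability of history events and the empirical law. -/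

instance borelSpace_particle : BorelSpace (Torus × Vel) := inferInstance

instance secondCountable_particle : SecondCountableTopology (Torus × Vel) := inferInstance

instance borelSpace_particles (n : ℕ) : BorelSpace (Fin n → Torus × Vel) :=
  @Pi.borelSpace (Fin n) (fun _ => Torus × Vel) _ _ _ (fun _ => secondCountable_particle)
    fun _ => borelSpace_particle

instance secondCountable_particles (n : ℕ) : SecondCountableTopology (Fin n → Torus × Vel) :=
  @TopologicalSpace.instSecondCountableTopologyForallOfCountable _ _ _ _
    fun _ => secondCountable_particle

instance standardBorel_particle : StandardBorelSpace (Torus × Vel) := inferInstance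

instance standardBorel_particles (n : ℕ) : StandardBorelSpace (Fin n → Torus × Vel) :=
  @StandardBorelSpace.pi_countable _ _ _ _ fun _ => standardBorel_particle

instance standardBorel_marker : StandardBorelSpace Marker := inferInstance

instance standardBorel_markers (n : ℕ) : StandardBorelSpace (Fin n → Marker) :=
  @StandardBorelSpace.pi_countable _ _ _ _ fun _ => standardBorel_marker

instance standardBorel_config (n : ℕ) : StandardBorelSpace (Config n) := inferInstance

instance standardBorel_configTree (N n : ℕ) :
    StandardBorelSpace (Config N × ((Torus × Vel) × (Fin n → Marker))) := inferInstance

/-- Lusin–Souslin: a projection that is injective on a Borel set has a Borel image. Uniqueness of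
the history supplies the injectivity. -/
theorem measurableSet_image_fst {α β : Type*} [MeasurableSpace α] [MeasurableSpace β]
    [StandardBorelSpace α] [StandardBorelSpace (α × β)] {s : Set (α × β)} (hs : MeasurableSet s)
    (hinj : InjOn Prod.fst s) : MeasurableSet (Prod.fst '' s) :=
  hs.image_of_measurable_injOn measurable_fst hinj

/-- The initial data and the histories with prescribed labels. -/
def historyGraph {N n : ℕ} (ε t : ℝ) (p : Fin n → Fin N) :
    Set (Config N × ((Torus × Vel) × (Fin n → Marker))) :=
  {x | IsHistoryVia ε t x.1 ⟨n, x.2⟩ p}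

theorem continuous_bgPos (N : ℕ) (i : Fin N) :
    Continuous fun x : Config N × ℝ => bgPos x.1 i x.2 := by
  have h1 : Continuous fun x : Config N × ℝ => (x.1.2 i).1 := by fun_prop
  have h2 : Continuous fun x : Config N × ℝ => x.2 • (x.1.2 i).2 := by fun_prop
  exact h1.add (continuous_toTorus.comp h2)

theorem measurableSet_historyGraph {N n : ℕ} (ε t : ℝ) (p : Fin n → Fin N) :
    MeasurableSet (historyGraph ε t p) := by
  have hset : historyGraph ε t p =
      {x | x.2.1 = x.1.1} ∩ (Prod.snd ⁻¹' {q : (Torus × Vel) × (Fin n → Marker) | IsTree t ⟨n, q⟩} ∩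
      ((⋂ i : Fin N, {x | ε < torusDist x.1.1.1 (x.1.2 i).1}) ∩
      ((⋂ j : Fin n, {x | (x.1.2 (p j)).2 = collVel ⟨n, x.2⟩ j}) ∩
      ((⋂ j : Fin n, {x | bgPos x.1 (p j) (collTime ⟨n, x.2⟩ j) =
        pos ⟨n, x.2⟩ (collTime ⟨n, x.2⟩ j) + toTorus (ε • collDir ⟨n, x.2⟩ j)}) ∩
      ⋂ i : Fin N, {x | ∀ s ∈ Icc 0 t, torusDist (pos ⟨n, x.2⟩ s) (bgPos x.1 i s) ≤ ε →
        ∃ j : {j : Fin n // p j = i}, collTime ⟨n, x.2⟩ j.1 = s})))) := by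
    ext x
    simp only [historyGraph, mem_inter_iff, mem_ofPred_eq, mem_iInter, mem_preimage]
    constructor
    · intro h
      exact ⟨h.root, h.isTree, h.noOverlap, h.vel_eq, h.pos_eq, fun i s hs hd =>
        let ⟨j, hj, hjs⟩ := h.contact s hs i hd
        ⟨⟨j, hj⟩, hjs⟩⟩
    · rintro ⟨h1, h2, h3, h4, h5, h6⟩
      exact ⟨h1, h2, h3, h4, h5, fun s hs i hd =>
        let ⟨j, hj⟩ := h6 i s hs hd
        ⟨j.1, j.2, hj⟩⟩
  have hsnd : Continuous fun x : Config N × ((Torus × Vel) × (Fin n → Marker)) => x.2 :=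
    continuous_snd
  have hT := fun j => (continuous_collTime n j).comp hsnd
  have hbg : ∀ i : Fin N, Continuous fun x : Config N × ((Torus × Vel) × (Fin n → Marker)) =>
      (x.1.2 i).2 := fun i => by fun_prop
  have hcv : ∀ j : Fin n, Continuous fun x : Config N × ((Torus × Vel) × (Fin n → Marker)) =>
      collVel ⟨n, x.2⟩ j := fun j => (continuous_collVel n j).comp hsnd
  rw [hset]
  refine MeasurableSet.inter ?_ (((measurableSet_isTree n t).preimage measurable_snd).inter
    (MeasurableSet.inter (MeasurableSet.iInter fun i => ?_)
    (MeasurableSet.inter (MeasurableSet.iInter fun j => ?_)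
    (MeasurableSet.inter (MeasurableSet.iInter fun j => ?_) (MeasurableSet.iInter fun i => ?_)))))
  · exact (isClosed_eq (by fun_prop) (by fun_prop)).measurableSet
  · refine (isOpen_lt continuous_const ?_).measurableSet
    have h1 : Continuous fun x : Config N × ((Torus × Vel) × (Fin n → Marker)) => x.1.1.1 := by
      fun_prop
    have h2 : Continuous fun x : Config N × ((Torus × Vel) × (Fin n → Marker)) => (x.1.2 i).1 := by
      fun_prop
    exact continuous_torusDist h1 h2
  · exact (isClosed_eq (hbg (p j)) (hcv j)).measurableSet
  · have h1 : Continuous fun x : Config N × ((Torus × Vel) × (Fin n → Marker)) =>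
        bgPos x.1 (p j) (collTime ⟨n, x.2⟩ j) := (continuous_bgPos N (p j)).comp (continuous_fst.prodMk (hT j))
    have h2 : Continuous fun x : Config N × ((Torus × Vel) × (Fin n → Marker)) =>
        pos ⟨n, x.2⟩ (collTime ⟨n, x.2⟩ j) + toTorus (ε • collDir ⟨n, x.2⟩ j) :=
      ((continuous_pos n).comp (hsnd.prodMk (hT j))).add
        (continuous_toTorus.comp (((continuous_collDir n j).comp hsnd).const_smul ε))
    exact (isClosed_eq h1 h2).measurableSet
  · have hpos : Continuous fun y : (Config N × ((Torus × Vel) × (Fin n → Marker))) × ℝ =>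
        pos ⟨n, y.1.2⟩ y.2 :=
      (continuous_pos n).comp ((hsnd.comp continuous_fst).prodMk continuous_snd)
    have hb : Continuous fun y : (Config N × ((Torus × Vel) × (Fin n → Marker))) × ℝ =>
        bgPos y.1.1 i y.2 :=
      (continuous_bgPos N i).comp ((continuous_fst.comp continuous_fst).prodMk continuous_snd)
    exact measurableSet_contact (ι := {j : Fin n // p j = i}) (continuous_torusDist hpos hb)
      (τ := fun j x => collTime ⟨n, x.2⟩ j.1) (fun j => hT j.1) ε t

/-- The initial data with a history in `B` with labels `p`. -/
def historyEvent {N n : ℕ} (ε t : ℝ) (p : Fin n → Fin N)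
    (B : Set ((Torus × Vel) × (Fin n → Marker))) : Set (Config N) :=
  {z | ∃ x ∈ B, IsHistoryVia ε t z ⟨n, x⟩ p}

theorem measurableSet_historyEvent {N n : ℕ} {ε t : ℝ} (hε : 0 < ε) (hε2 : ε < 1 / 2)
    (p : Fin n → Fin N) {B : Set ((Torus × Vel) × (Fin n → Marker))} (hB : MeasurableSet B) :
    MeasurableSet (historyEvent ε t p B) := by
  have h1 : historyEvent ε t p B = Prod.fst '' (historyGraph ε t p ∩ Prod.snd ⁻¹' B) := by
    ext z
    constructor
    · rintro ⟨x, hx, h⟩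
      exact ⟨(z, x), ⟨h, hx⟩, rfl⟩
    · rintro ⟨⟨z', x⟩, ⟨h, hx⟩, rfl⟩
      exact ⟨x, hx, h⟩
  rw [h1]
  refine measurableSet_image_fst
    ((measurableSet_historyGraph ε t p).inter (hB.preimage measurable_snd)) ?_
  rintro ⟨z, x⟩ ⟨hx, -⟩ ⟨z', x'⟩ ⟨hx', -⟩ hz
  have hz : z = z' := hz
  subst hz
  have h2 : (⟨n, x⟩ : CollisionTree) = ⟨n, x'⟩ :=
    IsHistoryVia.tree_unique hε hε2 (p := p) (q := p) hx hx'
  rw [sigma_mk_injective h2]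

theorem disjoint_historyEvent {N n : ℕ} {ε t : ℝ} (hε : 0 < ε) (hε2 : ε < 1 / 2)
    {p q : Fin n → Fin N} (hpq : p ≠ q) (B C : Set ((Torus × Vel) × (Fin n → Marker))) :
    Disjoint (historyEvent ε t p B) (historyEvent ε t q C) := by
  refine Set.disjoint_left.2 ?_
  rintro z ⟨x, -, hx⟩ ⟨x', -, hx'⟩
  have h2 : (⟨n, x⟩ : CollisionTree) = ⟨n, x'⟩ :=
    IsHistoryVia.tree_unique hε hε2 (p := p) (q := q) hx hx'
  obtain rfl := sigma_mk_injective h2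
  exact hpq (IsHistoryVia.labels_unique hε.le (Φ := ⟨n, x⟩) hx hx')

/-- The tree with `n` collisions and the data `x`. -/
abbrev mkTree (n : ℕ) (x : (Torus × Vel) × (Fin n → Marker)) : CollisionTree := ⟨n, x⟩

section Empirical

variable {N : ℕ} {ε t : ℝ}

theorem history_eq (hε : 0 < ε) (hε2 : ε < 1 / 2) {z : Config N} {Φ : CollisionTree}
    (h : IsHistory ε t z Φ) : history ε t z = Φ := by
  have hex : ∃ Φ, IsHistory ε t z Φ := ⟨Φ, h⟩
  rw [history, dif_pos hex]
  obtain ⟨p, hp⟩ := isHistory_iff.1 h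
  obtain ⟨q, hq⟩ := isHistory_iff.1 hex.choose_spec
  exact hq.tree_unique hε hε2 hp

theorem preimage_history_inter (hε : 0 < ε) (hε2 : ε < 1 / 2) (A : Set CollisionTree) :
    (history ε t) ⁻¹' A ∩ {z : Config N | ∃ Φ, IsHistory ε t z Φ}
      = ⋃ n : ℕ, ⋃ p : Fin n → Fin N, historyEvent ε t p (mkTree n ⁻¹' A) := by
  ext z
  simp only [mem_inter_iff, mem_preimage, mem_ofPred_eq, mem_iUnion]
  constructor
  · rintro ⟨hA, ⟨n, x⟩, h⟩
    obtain ⟨p, hp⟩ := isHistory_iff.1 h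
    rw [history_eq hε hε2 h] at hA
    exact ⟨n, p, x, hA, hp⟩
  · rintro ⟨n, p, x, hx, hp⟩
    have h : IsHistory ε t z ⟨n, x⟩ := isHistory_iff.2 ⟨p, hp⟩
    exact ⟨by rw [history_eq hε hε2 h]; exact hx, _, h⟩

theorem measurable_sigmaMk (n : ℕ) :
    Measurable (mkTree n) := by
  intro A hA
  exact MeasurableSpace.measurableSet_iInf.1 hA n

theorem measurableSet_sigma_iff {A : Set CollisionTree} :
    MeasurableSet A ↔ ∀ n : ℕ,
      MeasurableSet (mkTree n ⁻¹' A) :=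
  MeasurableSpace.measurableSet_iInf

theorem measurableSet_preimage_history (hε : 0 < ε) (hε2 : ε < 1 / 2) {A : Set CollisionTree}
    (hA : MeasurableSet A) :
    MeasurableSet ((history ε t) ⁻¹' A ∩ {z : Config N | ∃ Φ, IsHistory ε t z Φ}) := by
  rw [preimage_history_inter hε hε2]
  exact MeasurableSet.iUnion fun n => MeasurableSet.iUnion fun p =>
    measurableSet_historyEvent hε hε2 p (measurable_sigmaMk n hA)

/-- Measurability of `history` is needed only on the event where a history exists, since the law is
restricted to it; the dummy value is irrelevant. -/
theorem empiricalLaw_apply (hε : 0 < ε) (hε2 : ε < 1 / 2) (f₀ : Torus × Vel → ℝ) (g₀ : Vel → ℝ)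
    {A : Set CollisionTree} (hA : MeasurableSet A) :
    empiricalLaw f₀ g₀ N ε t A = configLaw f₀ g₀ N
      ((history ε t) ⁻¹' A ∩ {z : Config N | ∃ Φ, IsHistory ε t z Φ}) := by
  have hdom : MeasurableSet {z : Config N | ∃ Φ, IsHistory ε t z Φ} := by
    have := measurableSet_preimage_history (N := N) (t := t) hε hε2 MeasurableSet.univ
    simpa only [preimage_univ, univ_inter] using this
  have hae : AEMeasurable (history ε t)
      ((configLaw f₀ g₀ N).restrict {z | ∃ Φ, IsHistory ε t z Φ}) := by
    refine aemeasurable_restrict_of_measurable_subtype hdom fun A hA => ?_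
    have h1 := (measurableSet_preimage_history (N := N) (t := t) hε hε2 hA).preimage
      (measurable_subtype_coe (p := fun z : Config N => z ∈ {z | ∃ Φ, IsHistory ε t z Φ}))
    convert h1 using 1
    ext z
    simp only [mem_preimage, mem_inter_iff, iff_self_and]
    intro _
    exact z.2
  rw [empiricalLaw, Measure.map_apply_of_aemeasurable hae hA, Measure.restrict_apply' hdom]

/-- Different labellings give disjoint events, so their probabilities add. Omitting the remaining
labellings and trees only loses mass. -/
theorem sum_historyEvent_le_empiricalLaw (hε : 0 < ε) (hε2 : ε < 1 / 2) (f₀ : Torus × Vel → ℝ)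
    (g₀ : Vel → ℝ) {n : ℕ} {A : Set CollisionTree} (hA : MeasurableSet A)
    (s : Finset (Fin n → Fin N)) {B : Set ((Torus × Vel) × (Fin n → Marker))}
    (hB : MeasurableSet B) (hBA : B ⊆ mkTree n ⁻¹' A) :
    ∑ p ∈ s, configLaw f₀ g₀ N (historyEvent ε t p B) ≤ empiricalLaw f₀ g₀ N ε t A := by
  rw [empiricalLaw_apply hε hε2 f₀ g₀ hA, preimage_history_inter hε hε2,
    ← measure_biUnion_finset (fun p _ q _ hpq => disjoint_historyEvent hε hε2 hpq B B)
      fun p _ => measurableSet_historyEvent hε hε2 p hB]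
  refine measure_mono (iUnion₂_subset fun p _ => ?_)
  rintro z ⟨x, hx, h⟩
  exact mem_iUnion.2 ⟨n, mem_iUnion.2 ⟨p, x, hBA hx, h⟩⟩

end Empirical

/-! ### The contribution of a single labelling. -/

/-- The law of the initial data of a background particle. -/
noncomputable def bgMeasure (g₀ : Vel → ℝ) : Measure (Torus × Vel) :=
  volume.withDensity fun p => ENNReal.ofReal (g₀ p.2)

instance (g₀ : Vel → ℝ) : SigmaFinite (bgMeasure g₀) :=
  inferInstanceAs (SigmaFinite (volume.withDensity fun p : Torus × Vel => ENNReal.ofReal (g₀ p.2)))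

theorem sigmaFinite_pi_const {X : Type*} [MeasurableSpace X] (μ : Measure X) [SigmaFinite μ]
    (n : ℕ) : SigmaFinite (Measure.pi fun _ : Fin n => μ) := inferInstance

instance (n : ℕ) : SigmaFinite (Measure.pi fun _ : Fin n => markerMeasure) :=
  sigmaFinite_pi_const markerMeasure n

instance (g₀ : Vel → ℝ) (n : ℕ) : SigmaFinite (Measure.pi fun _ : Fin n =>
    (volume.withDensity fun p : Torus × Vel => ENNReal.ofReal (g₀ p.2))) :=
  sigmaFinite_pi_const (bgMeasure g₀) n

/-- Initial data of background particles that stay away from the tagged particle in `[0, t]`. -/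
def survivalSet (ε t : ℝ) (Φ : CollisionTree) : Set (Torus × Vel) :=
  {y | ∀ s ∈ Icc 0 t, ε < torusDist (pos Φ s) (y.1 + toTorus (s • y.2))}

theorem isClosed_compl_survivalGraph (ε t : ℝ) (n : ℕ) :
    IsClosed {q : ((Torus × Vel) × (Fin n → Marker)) × (Torus × Vel) |
      q.2 ∉ survivalSet ε t (mkTree n q.1)} := by
  have h1 : Continuous fun q : (((Torus × Vel) × (Fin n → Marker)) × (Torus × Vel)) × ℝ =>
      pos (mkTree n q.1.1) q.2 :=
    (continuous_pos n).comp ((continuous_fst.comp continuous_fst).prodMk continuous_snd)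
  have h2 : Continuous fun q : (((Torus × Vel) × (Fin n → Marker)) × (Torus × Vel)) × ℝ =>
      q.1.2.1 := by fun_prop
  have h3 : Continuous fun q : (((Torus × Vel) × (Fin n → Marker)) × (Torus × Vel)) × ℝ =>
      q.2 • q.1.2.2 := by fun_prop
  have h4 := isClosed_le (continuous_torusDist h1 (h2.add (continuous_toTorus.comp h3)))
    (continuous_const (y := ε))
  convert isClosed_exists_mem_Icc (a := 0) (b := t) h4 using 1
  ext q
  simp [survivalSet, and_assoc]

theorem measurableSet_survivalGraph (ε t : ℝ) (n : ℕ) :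
    MeasurableSet {q : ((Torus × Vel) × (Fin n → Marker)) × (Torus × Vel) |
      q.2 ∈ survivalSet ε t (mkTree n q.1)} := by
  have := (isClosed_compl_survivalGraph ε t n).measurableSet.compl
  convert this using 1
  ext q
  simp

theorem measurableSet_survivalSet (ε t : ℝ) (Φ : CollisionTree) :
    MeasurableSet (survivalSet ε t Φ) := by
  obtain ⟨n, x⟩ := Φ
  have h : MeasurableSet {y | y ∈ survivalSet ε t (mkTree n x)} :=
    measurable_prodMk_left (x := x) (measurableSet_survivalGraph ε t n)
  exact h

/-- The probability that a background particle stays away from the tagged particle. -/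
noncomputable def survivalProb (g₀ : Vel → ℝ) (ε t : ℝ) (Φ : CollisionTree) : ENNReal :=
  bgMeasure g₀ (survivalSet ε t Φ)

theorem measurable_survivalProb (g₀ : Vel → ℝ) (ε t : ℝ) (n : ℕ) :
    Measurable fun x => survivalProb g₀ ε t (mkTree n x) :=
  measurable_measure_prodMk_left (measurableSet_survivalGraph ε t n)

/-- Trees whose background particles meet the tagged particle at the collisions only. -/
def cleanTrees (ε t : ℝ) (n : ℕ) : Set ((Torus × Vel) × (Fin n → Marker)) :=
  {x | x ∈ firstContact ε t n ∧ ∀ j : Fin n, ∀ s ∈ Icc 0 t,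
    torusDist (pos (mkTree n x) s) (partnerPos ε (mkTree n x) j s) ≤ ε →
      collTime (mkTree n x) j = s}

theorem measurableSet_cleanTrees (ε t : ℝ) (n : ℕ) : MeasurableSet (cleanTrees ε t n) := by
  have : cleanTrees ε t n = firstContact ε t n ∩ ⋂ j : Fin n, {x | ∀ s ∈ Icc 0 t,
      torusDist (pos (mkTree n x) s) (partnerPos ε (mkTree n x) j s) ≤ ε →
      ∃ _ : Unit, collTime (mkTree n x) j = s} := by
    ext x
    simp [cleanTrees]
  rw [this]
  refine (measurableSet_firstContact ε t n).inter (MeasurableSet.iInter fun j => ?_)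
  exact measurableSet_contact (ι := Unit) (continuous_partnerDist ε n j)
    (fun _ => continuous_collTime n j) ε t

/-- Partners touch the tagged particle at their collisions only, and the others never. Initial
overlap is the contact at time 0, which is excluded for partners because collision times are
positive. -/
theorem isHistoryVia_of_clean {N n : ℕ} {ε t : ℝ} (ht : 0 ≤ t) {p : Fin n → Fin N}
    {x : (Torus × Vel) × (Fin n → Marker)} (hx : x ∈ cleanTrees ε t n) {z : Config N}
    (hr : z.1 = x.1) (hp : ∀ j, z.2 (p j) = startMap ε x j)
    (ho : ∀ i, i ∉ range p → z.2 i ∈ survivalSet ε t (mkTree n x)) :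
    IsHistoryVia ε t z (mkTree n x) p := by
  have hbg : ∀ j s, bgPos z (p j) s = partnerPos ε (mkTree n x) j s := by
    intro j s
    rw [bgPos, hp j]
    rfl
  have hT : IsTree t (mkTree n x) := hx.1.1
  have h0 : pos (mkTree n x) 0 = z.1.1 := by
    rw [pos_zero _ fun j => (hT.1 j).1, hr]
    rfl
  refine ⟨hr.symm, hT, fun i => ?_, fun j => ?_, fun j => ?_, fun s hs i hd => ?_⟩
  · have hb0 : bgPos z i 0 = (z.2 i).1 := by
      rw [bgPos, zero_smul, toTorus_zero, add_zero]
    by_cases hi : i ∈ range p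
    · obtain ⟨j, rfl⟩ := hi
      by_contra! hcon
      have h1 := hx.2 j 0 ⟨le_rfl, ht⟩ (by rw [h0, ← hbg, hb0]; exact hcon)
      exact absurd h1 (hT.1 j).1.ne'
    · have h1 := ho i hi 0 ⟨le_rfl, ht⟩
      rw [h0] at h1
      rwa [← hb0]
  · rw [hp j]
    rfl
  · rw [hbg]
    unfold partnerPos partnerStart
    rw [toTorus_sub]
    abel
  · by_cases hi : i ∈ range p
    · obtain ⟨j, rfl⟩ := hi
      exact ⟨j, rfl, hx.2 j s hs (by rw [← hbg]; exact hd)⟩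
    · exact absurd hd (not_le.2 (ho i hi s hs))

/-- Separates the collision partners from the remaining particles, which are independent of them. -/
theorem exists_pi_split {X : Type*} [MeasurableSpace X] (μ : Measure X) [SigmaFinite μ] {n N : ℕ}
    {p : Fin n → Fin N} (hp : Function.Injective p) :
    ∃ Ψ : (Fin n → X) × (↥(range p)ᶜ → X) → (Fin N → X),
      MeasurePreserving Ψ ((Measure.pi fun _ => μ).prod (Measure.pi fun _ => μ))
        (Measure.pi fun _ => μ) ∧
      (∀ y w j, Ψ (y, w) (p j) = y j) ∧ ∀ y w (i : ↥(range p)ᶜ), Ψ (y, w) i = w i := by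
  classical
  set e : Fin n ⊕ ↥(range p)ᶜ ≃ Fin N :=
    (Equiv.sumCongr (Equiv.ofInjective p hp) (Equiv.refl _)).trans (Equiv.Set.sumCompl (range p))
    with he
  have h1 := measurePreserving_sumPiEquivProdPi_symm (fun _ : Fin n ⊕ ↥(range p)ᶜ => μ)
  have h2 := measurePreserving_piCongrLeft (fun _ : Fin N => μ) e
  have h3 : ∀ x i, MeasurableEquiv.piCongrLeft (fun _ : Fin N => X) e x (e i) = x i := fun x i =>
    MeasurableEquiv.piCongrLeft_apply_apply (β := fun _ => X) e x i
  refine ⟨_, h2.comp h1, fun y w j => ?_, fun y w i => ?_⟩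
  · have : p j = e (Sum.inl j) := by simp [he]
    rw [this]
    exact h3 _ _
  · have : (i : Fin N) = e (Sum.inr i) := by simp [he]
    rw [this]
    exact h3 _ _

theorem lintegral_pi_withDensity {X : Type*} [MeasurableSpace X] (μ : Measure X) [SigmaFinite μ]
    {g : X → ENNReal} (hg : Measurable g) [SigmaFinite (μ.withDensity g)] (n : ℕ)
    {q : (Fin n → X) → ENNReal} (hq : Measurable q) :
    ∫⁻ y, q y ∂(Measure.pi fun _ => μ.withDensity g)
      = ∫⁻ y, (∏ j, g (y j)) * q y ∂(Measure.pi fun _ => μ) := by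
  induction n with
  | zero =>
    rw [Measure.pi_of_empty (fun _ : Fin 0 => μ.withDensity g) Fin.elim0,
      Measure.pi_of_empty (fun _ : Fin 0 => μ) Fin.elim0]
    simp
  | succ n ih =>
    have hm : ∀ k : ℕ, Measurable fun y : Fin k → X => ∏ j, g (y j) := fun k =>
      Finset.measurable_prod _ fun j _ => hg.comp (measurable_pi_apply j)
    have hK : Measurable fun y : Fin n → X => ∫⁻ x, q (Fin.snoc y x) ∂(μ.withDensity g) :=
      Measurable.lintegral_prod_right' (f := fun a : (Fin n → X) × X => q (Fin.snoc a.1 a.2))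
        (hq.comp (measurable_snoc n))
    have hmq : Measurable fun y : Fin (n + 1) → X => (∏ j, g (y j)) * q y := (hm _).mul hq
    rw [lintegral_pi_snoc _ hq, lintegral_pi_snoc _ hmq, ih hK]
    refine lintegral_congr fun y => ?_
    have hqy : Measurable fun x => q (Fin.snoc y x) := hq.comp (measurable_snoc_right y)
    rw [lintegral_withDensity_eq_lintegral_mul _ hg hqy, ← lintegral_const_mul _ (hg.mul hqy)]
    refine lintegral_congr fun x => ?_
    simp only [Pi.mul_apply]
    rw [Fin.prod_univ_castSucc, ← mul_assoc]
    simp only [Fin.snoc_castSucc, Fin.snoc_last]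

/-- A lower bound for the density of the law of the history, for one labelling of the collisions
by particles. -/
noncomputable def labelledDensity (f₀ : Torus × Vel → ℝ) (g₀ : Vel → ℝ) (N : ℕ) (ε t : ℝ) {n : ℕ}
    (x : (Torus × Vel) × (Fin n → Marker)) : ENNReal :=
  ENNReal.ofReal (f₀ x.1) * (startJac ε x * (∏ j : Fin n, ENNReal.ofReal (g₀ (collVel (mkTree n x) j))) *
    survivalProb g₀ ε t (mkTree n x) ^ (N - n))

theorem measurable_prod_collVel {g₀ : Vel → ℝ} (hg : Measurable g₀) (n : ℕ) :
    Measurable fun x : (Torus × Vel) × (Fin n → Marker) =>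
      ∏ j : Fin n, ENNReal.ofReal (g₀ (collVel (mkTree n x) j)) := by
  have h : ∀ j : Fin n, Measurable fun x : (Torus × Vel) × (Fin n → Marker) =>
      ENNReal.ofReal (g₀ (collVel (mkTree n x) j)) := fun j =>
    (hg.comp (continuous_collVel n j).measurable).ennreal_ofReal
  exact Finset.measurable_prod _ fun j _ => h j

theorem measurable_labelledDensity {f₀ : Torus × Vel → ℝ} (hf : Measurable f₀) {g₀ : Vel → ℝ}
    (hg : Measurable g₀) (N : ℕ) (ε t : ℝ) (n : ℕ) :
    Measurable (labelledDensity f₀ g₀ N ε t (n := n)) := by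
  unfold labelledDensity
  exact (hf.comp measurable_fst).ennreal_ofReal.mul (((measurable_startJac ε n).mul
    (measurable_prod_collVel hg n)).mul ((measurable_survivalProb g₀ ε t n).pow_const _))

/-- Lebesgue measure on the trees with `n` collisions. -/
noncomputable abbrev treeMeasureN (n : ℕ) : Measure ((Torus × Vel) × (Fin n → Marker)) :=
  (volume : Measure (Torus × Vel)).prod (Measure.pi fun _ : Fin n => markerMeasure)

/-- Given the tagged particle and its partners, the remaining N - n particles are independent and
all survive with probability `survivalProb ^ (N - n)`. Averaging over the partners is bounded below
by an integral over markers through `lintegral_startMap_le`. -/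
theorem lintegral_labelledDensity_le {f₀ : Torus × Vel → ℝ} (hf : Measurable f₀) {g₀ : Vel → ℝ}
    (hg : Measurable g₀) {N n : ℕ} {ε t : ℝ} (ht : 0 ≤ t) (hε : 0 < ε) (hε2 : ε < 1 / 2)
    {p : Fin n → Fin N} (hp : Function.Injective p)
    {B : Set ((Torus × Vel) × (Fin n → Marker))} (hB : MeasurableSet B)
    (hBc : B ⊆ cleanTrees ε t n) :
    ∫⁻ x in B, labelledDensity f₀ g₀ N ε t x ∂(treeMeasureN n)
      ≤ configLaw f₀ g₀ N (historyEvent ε t p B) := by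
  obtain ⟨Ψ, hΨ, hΨp, hΨo⟩ := exists_pi_split (bgMeasure g₀) hp
  have hE := measurableSet_historyEvent (t := t) hε hε2 p hB
  have hgd : Measurable fun y : Torus × Vel => ENNReal.ofReal (g₀ y.2) :=
    (hg.comp measurable_snd).ennreal_ofReal
  have hfd : Measurable fun y : Torus × Vel => ENNReal.ofReal (f₀ y) := hf.ennreal_ofReal
  -- the probability of the event, given the tagged particle and its collision partners
  set q : (Torus × Vel) → (Fin n → Torus × Vel) → ENNReal := fun r y =>
    (Measure.pi fun _ : ↥(range p)ᶜ => bgMeasure g₀) {w | (r, Ψ (y, w)) ∈ historyEvent ε t p B}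
    with hq
  have hqm : ∀ r, Measurable (q r) := fun r =>
    measurable_measure_prodMk_left
      (hE.preimage ((measurable_prodMk_left (x := r)).comp hΨ.measurable))
  have hlow : ∀ x ∈ B, survivalProb g₀ ε t (mkTree n x) ^ (N - n) ≤ q x.1 (startMap ε x) := by
    intro x hx
    have hcard : Fintype.card ↥(range p)ᶜ = N - n := by
      rw [Fintype.card_compl_set, Fintype.card_fin, Set.card_range_of_injective hp,
        Fintype.card_fin]
    have h1 : (Measure.pi fun _ : ↥(range p)ᶜ => bgMeasure g₀)
        (univ.pi fun _ => survivalSet ε t (mkTree n x))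
          = survivalProb g₀ ε t (mkTree n x) ^ (N - n) := by
      rw [Measure.pi_pi, Finset.prod_const, Finset.card_univ, hcard]
      rfl
    rw [← h1]
    refine measure_mono fun w hw => ⟨x, hx, ?_⟩
    refine isHistoryVia_of_clean ht (hBc hx) rfl (fun j => hΨp _ _ j) fun i hi => ?_
    have := hΨo (startMap ε x) w ⟨i, hi⟩
    change Ψ (startMap ε x, w) i ∈ _
    rw [this]
    exact hw ⟨i, hi⟩ (mem_univ _)
  have hprob : configLaw f₀ g₀ N (historyEvent ε t p B)
      = ∫⁻ r, ENNReal.ofReal (f₀ r) * ∫⁻ y, q r y ∂(Measure.pi fun _ => bgMeasure g₀) := by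
    have h1 : ∀ r, ∫⁻ y, q r y ∂(Measure.pi fun _ => bgMeasure g₀)
        = (Measure.pi fun _ : Fin N => bgMeasure g₀) (Prod.mk r ⁻¹' historyEvent ε t p B) := by
      intro r
      have h2 : MeasurableSet (Prod.mk r ⁻¹' historyEvent ε t p B) :=
        measurable_prodMk_left hE
      rw [← hΨ.measure_preimage h2.nullMeasurableSet, Measure.prod_apply (hΨ.measurable h2)]
      rfl
    simp_rw [h1]
    rw [configLaw, Measure.prod_apply hE, lintegral_withDensity_eq_lintegral_mul _ hfd
      (measurable_measure_prodMk_left hE)]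
    rfl
  rw [hprob, ← lintegral_indicator hB, lintegral_prod _
    ((measurable_labelledDensity hf hg N ε t n).indicator hB).aemeasurable]
  refine lintegral_mono fun r => ?_
  have hQ : Measurable fun y : Fin n → Torus × Vel =>
      (∏ j, ENNReal.ofReal (g₀ (y j).2)) * q r y :=
    (Finset.measurable_prod _ fun j _ => hgd.comp (measurable_pi_apply j)).mul (hqm r)
  calc _ ≤ ∫⁻ c, ENNReal.ofReal (f₀ r) * (firstContact ε t n).indicator (fun x => startJac ε x *
          ((∏ j, ENNReal.ofReal (g₀ (startMap ε x j).2)) * q r (startMap ε x))) (r, c)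
          ∂(Measure.pi fun _ => markerMeasure) := by
        refine lintegral_mono fun c => ?_
        by_cases hc : (r, c) ∈ B
        · rw [indicator_of_mem hc, indicator_of_mem (hBc hc).1, labelledDensity, mul_assoc]
          refine mul_le_mul_right (mul_le_mul_right (mul_le_mul_right (hlow _ hc) _) _) _
        · rw [indicator_of_notMem hc]
          exact bot_le
    _ = ENNReal.ofReal (f₀ r) * ∫⁻ c, (firstContact ε t n).indicator (fun x => startJac ε x *
          ((∏ j, ENNReal.ofReal (g₀ (startMap ε x j).2)) * q r (startMap ε x))) (r, c)
          ∂(Measure.pi fun _ => markerMeasure) := by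
        refine lintegral_const_mul _ ?_
        exact (((measurable_startJac ε n).mul (hQ.comp (measurable_startMap ε n))).indicator
          (measurableSet_firstContact ε t n)).comp measurable_prodMk_left
    _ ≤ ENNReal.ofReal (f₀ r) * ∫⁻ y, (∏ j, ENNReal.ofReal (g₀ (y j).2)) * q r y
          ∂(Measure.pi fun _ => volume) :=
        mul_le_mul_right (lintegral_startMap_le hε hε2 t r n hQ) _
    _ = _ := by
        congr 1
        exact (lintegral_pi_withDensity volume hgd n (hqm r)).symm

/-! ### Passage to densities on the space of trees. -/

/-- Absolute continuity of `μ` is not needed: the singular part vanishes on a set carrying all of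
`ν`, and the comparison can be made there. -/
theorem le_rnDeriv_of_withDensity_le {α : Type*} [MeasurableSpace α] {μ ν : Measure α}
    [SigmaFinite ν] [μ.HaveLebesgueDecomposition ν] {h : α → ENNReal} (hm : Measurable h)
    (hle : ν.withDensity h ≤ μ) : ∀ᵐ x ∂ν, h x ≤ μ.rnDeriv ν x := by
  refine ae_le_of_forall_setLIntegral_le_of_sigmaFinite hm fun s hs _ => ?_
  obtain ⟨S, hS, h1, h2⟩ := Measure.mutuallySingular_singularPart μ ν
  have h3 : ∫⁻ x in s, h x ∂ν = ∫⁻ x in s ∩ S, h x ∂ν := by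
    have : (s ∩ S : Set α) =ᵐ[ν] s := by
      have h4 : ∀ᵐ x ∂ν, x ∈ S := h2
      filter_upwards [h4] with x hx
      exact propext ⟨fun h => h.1, fun h => ⟨h, hx⟩⟩
    rw [setLIntegral_congr this]
  rw [h3, ← withDensity_apply _ (hs.inter hS)]
  refine (hle _).trans ?_
  conv_lhs => rw [μ.haveLebesgueDecomposition_add ν]
  rw [Measure.add_apply, measure_mono_null inter_subset_right h1, zero_add,
    withDensity_apply _ (hs.inter hS)]
  exact lintegral_mono_set inter_subset_left

theorem treeMeasure_eq : treeMeasure = Measure.sum fun n : ℕ =>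
    Measure.map (mkTree n) (treeMeasureN n) := rfl

theorem lintegral_treeMeasure {F : CollisionTree → ENNReal} (hF : Measurable F) :
    ∫⁻ Φ, F Φ ∂treeMeasure = ∑' n : ℕ, ∫⁻ x, F (mkTree n x) ∂(treeMeasureN n) := by
  rw [treeMeasure_eq, lintegral_sum_measure]
  exact tsum_congr fun n => lintegral_map hF (measurable_sigmaMk n)

theorem treeMeasure_apply {A : Set CollisionTree} (hA : MeasurableSet A) :
    treeMeasure A = ∑' n : ℕ, treeMeasureN n (mkTree n ⁻¹' A) := by
  rw [treeMeasure_eq, Measure.sum_apply _ hA]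
  exact tsum_congr fun n => Measure.map_apply (measurable_sigmaMk n) hA

instance : SigmaFinite treeMeasure := by
  -- At most k collisions, and data in the k-th spanning set of the corresponding stratum: finitely
  -- many pieces of finite measure.
  set S : ℕ → Set CollisionTree := fun k =>
    {Φ | Φ.1 ≤ k ∧ Φ.2 ∈ spanningSets (treeMeasureN Φ.1) k} with hS
  have hpre : ∀ k n, mkTree n ⁻¹' S k = {x | n ≤ k ∧ x ∈ spanningSets (treeMeasureN n) k} :=
    fun k n => rfl
  have hm : ∀ k, MeasurableSet (S k) := fun k => measurableSet_sigma_iff.2 fun n => by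
    rw [hpre]
    exact (MeasurableSet.const _).inter (measurableSet_spanningSets _ _)
  refine ⟨⟨⟨S, fun _ => trivial, fun k => ?_, ?_⟩⟩⟩
  · rw [treeMeasure_apply (hm k), tsum_eq_sum (s := Finset.range (k + 1))]
    · refine ENNReal.sum_lt_top.2 fun n _ => ?_
      rw [hpre]
      exact (measure_mono fun x hx => hx.2).trans_lt (measure_spanningSets_lt_top _ k)
    · intro n hn
      have : ¬ n ≤ k := by simpa [Nat.lt_succ_iff] using hn
      rw [hpre]
      simp [this]
  · refine eq_univ_of_forall fun Φ => ?_
    have h1 : Φ.2 ∈ ⋃ k, spanningSets (treeMeasureN Φ.1) k := by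
      rw [iUnion_spanningSets]
      trivial
    obtain ⟨k, hk⟩ := mem_iUnion.1 h1
    exact mem_iUnion.2 ⟨max k Φ.1, le_max_right _ _,
      monotone_spanningSets _ (le_max_left _ _) hk⟩

theorem card_filter_injective (n N : ℕ) :
    (Finset.univ.filter fun p : Fin n → Fin N => Function.Injective p).card
      = N.descFactorial n := by
  rw [← Fintype.card_subtype,
    Fintype.card_congr (Equiv.subtypeInjectiveEquivEmbedding (Fin n) (Fin N)),
    Fintype.card_embedding_eq, Fintype.card_fin, Fintype.card_fin]

/-- A lower bound for the density of the empirical distribution on clean trees. -/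
theorem labelledDensity_le_rnDeriv {f₀ : Torus × Vel → ℝ} (hf : Measurable f₀) {g₀ : Vel → ℝ}
    (hg : Measurable g₀) [∀ N, IsFiniteMeasure (configLaw f₀ g₀ N)] {N : ℕ} {ε t : ℝ}
    (ht : 0 ≤ t) (hε : 0 < ε) (hε2 : ε < 1 / 2) :
    ∀ᵐ Φ ∂treeMeasure, Φ.2 ∈ cleanTrees ε t Φ.1 →
      (N.descFactorial Φ.1 : ENNReal) * labelledDensity f₀ g₀ N ε t Φ.2
        ≤ (empiricalLaw f₀ g₀ N ε t).rnDeriv treeMeasure Φ := by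
  set H : CollisionTree → ENNReal := fun Φ => (cleanTrees ε t Φ.1).indicator
    (fun x => (N.descFactorial Φ.1 : ENNReal) * labelledDensity f₀ g₀ N ε t x) Φ.2 with hH
  have hHm : Measurable H := by
    intro s hs
    refine measurableSet_sigma_iff.2 fun n => ?_
    have h : Measurable ((cleanTrees ε t n).indicator fun x =>
        (N.descFactorial n : ENNReal) * labelledDensity f₀ g₀ N ε t x) :=
      ((measurable_labelledDensity hf hg N ε t n).const_mul _).indicator
        (measurableSet_cleanTrees ε t n)
    exact h hs
  have : IsFiniteMeasure (empiricalLaw f₀ g₀ N ε t) := by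
    unfold empiricalLaw
    infer_instance
  have hle : treeMeasure.withDensity H ≤ empiricalLaw f₀ g₀ N ε t := by
    refine Measure.le_iff.2 fun A hA => ?_
    set F : ℕ → Set CollisionTree := fun n => A ∩ {Φ | Φ.1 = n} with hF
    have hFm : ∀ n, MeasurableSet (F n) := fun n => hA.inter <|
      measurableSet_sigma_iff.2 fun m => MeasurableSet.const (m = n)
    have hFA : A = ⋃ n, F n := by
      ext Φ
      simp [hF]
    have hFd : Pairwise (Function.onFun Disjoint F) := by
      intro n m hnm
      refine Set.disjoint_left.2 ?_
      rintro Φ ⟨-, h1⟩ ⟨-, h2⟩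
      exact hnm (h1.symm.trans h2)
    have hFpre : ∀ n, mkTree n ⁻¹' A ⊆ mkTree n ⁻¹' F n := fun n x hx => ⟨hx, rfl⟩
    rw [withDensity_apply _ hA, ← lintegral_indicator hA,
      lintegral_treeMeasure (hHm.indicator hA)]
    conv_rhs => rw [hFA, measure_iUnion hFd hFm]
    refine ENNReal.tsum_le_tsum fun n => ?_
    have hAn : MeasurableSet (mkTree n ⁻¹' A) := measurable_sigmaMk n hA
    have hB := hAn.inter (measurableSet_cleanTrees ε t n)
    have e1 : ∀ x, A.indicator H (mkTree n x) = (mkTree n ⁻¹' A ∩ cleanTrees ε t n).indicator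
        (fun x => (N.descFactorial n : ENNReal) * labelledDensity f₀ g₀ N ε t x) x := by
      intro x
      rw [← indicator_indicator]
      rfl
    simp_rw [e1]
    rw [lintegral_indicator hB, lintegral_const_mul _ (measurable_labelledDensity hf hg N ε t n)]
    refine le_trans ?_ (sum_historyEvent_le_empiricalLaw hε hε2 f₀ g₀ (hFm n)
      (Finset.univ.filter fun p : Fin n → Fin N => Function.Injective p) hB
      (inter_subset_left.trans (hFpre n)))
    -- Every injective labelling obeys the same lower bound, and the falling factorial counts them.
    rw [← card_filter_injective, ← nsmul_eq_mul]
    refine Finset.card_nsmul_le_sum _ _ _ fun p hp => ?_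
    exact lintegral_labelledDensity_le hf hg ht hε hε2 (Finset.mem_filter.1 hp).2 hB
      inter_subset_right
  filter_upwards [le_rnDeriv_of_withDensity_le hHm hle] with Φ hΦ hc
  have h : H Φ = _ := indicator_of_mem hc _
  rwa [h] at hΦ

/-! ### The probability that a background particle hits the tagged particle. -/

theorem volume_torus_ball_le {ε : ℝ} (hε : 0 < ε) (x : Torus) :
    volume {y : Torus | torusDist x y ≤ ε} ≤ ENNReal.ofReal (4 / 3 * Real.pi * ε ^ 3) := by
  have hm : MeasurableSet {y : Torus | torusDist 0 y ≤ ε} :=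
    (isClosed_le (continuous_torusDist continuous_const continuous_id)
      continuous_const).measurableSet
  have h1 : {y : Torus | torusDist x y ≤ ε} = (fun y => y + -x) ⁻¹' {y : Torus | torusDist 0 y ≤ ε} := by
    ext y
    simp only [mem_ofPred_eq, mem_preimage]
    rw [torusDist_congr (x := x) (y := y) (x' := 0) (y' := y + -x) (by abel)]
  rw [h1, measure_preimage_add_right, ← volume_vel_closedBall hε.le]
  refine volume_torus_le measurableSet_closedBall hm fun y hy => ?_
  obtain ⟨z, hz, hzy⟩ := exists_lift y 0
  refine ⟨z, ?_, by rw [← hzy, sub_zero]⟩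
  rw [mem_closedBall_zero_iff, hz, torusDist_comm]
  exact hy

/-- The volume of the set of initial positions of a background particle of velocity `u` that is met
during a free flight, but not at its beginning. -/
theorem volume_newContact_le {ε : ℝ} (hε : 0 < ε) (a : Torus) (v u : Vel) (t₁ t₂ : ℝ) :
    volume {x : Torus | (∃ s ∈ Icc t₁ t₂,
        torusDist (a + toTorus (s • v)) (x + toTorus (s • u)) ≤ ε) ∧
        ε < torusDist (a + toTorus (t₁ • v)) (x + toTorus (t₁ • u))}
      ≤ ENNReal.ofReal (ε ^ 2) * (ENNReal.ofReal (t₂ - t₁) * flux (v - u)) := by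
  -- In the frame of the background particle, with the start of the flight moved to the origin, the
  -- set becomes a translate of a swept tube without its initial ball.
  set b : Torus := a + toTorus (t₁ • v) - toTorus (t₁ • u) with hb
  set B : Set Torus := {x | (∃ s ∈ Icc t₁ t₂,
      torusDist (toTorus ((s - t₁) • (v - u))) x ≤ ε) ∧ ε < torusDist 0 x} with hB
  set A : Set Vel := {y | ∃ s ∈ Icc 0 (t₂ - t₁), ‖y - s • (v - u)‖ ≤ ε ∧ ε < ‖y‖} with hA
  have hBm : MeasurableSet B := by
    refine MeasurableSet.inter (IsClosed.measurableSet ?_) (IsOpen.measurableSet ?_)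
    · have h : Continuous fun q : Torus × ℝ =>
          torusDist (toTorus ((q.2 - t₁) • (v - u))) q.1 :=
        continuous_torusDist (continuous_toTorus.comp (by fun_prop)) continuous_fst
      exact isClosed_exists_mem_Icc (isClosed_le h continuous_const)
    · exact isOpen_lt continuous_const (continuous_torusDist continuous_const continuous_id)
  have hAm : MeasurableSet A := by
    have : A = {y | ∃ s ∈ Icc 0 (t₂ - t₁), ‖y - s • (v - u)‖ ≤ ε} ∩ {y | ε < ‖y‖} := by
      ext y
      simp only [hA, mem_ofPred_eq, mem_inter_iff]
      exact ⟨fun ⟨s, h1, h2, h3⟩ => ⟨⟨s, h1, h2⟩, h3⟩, fun ⟨⟨s, h1, h2⟩, h3⟩ => ⟨s, h1, h2, h3⟩⟩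
    rw [this]
    refine MeasurableSet.inter (IsClosed.measurableSet ?_)
      (isOpen_lt continuous_const continuous_norm).measurableSet
    have h : Continuous fun q : Vel × ℝ => ‖q.1 - q.2 • (v - u)‖ := by fun_prop
    exact isClosed_exists_mem_Icc (isClosed_le h continuous_const)
  have h1 : {x : Torus | (∃ s ∈ Icc t₁ t₂,
        torusDist (a + toTorus (s • v)) (x + toTorus (s • u)) ≤ ε) ∧
        ε < torusDist (a + toTorus (t₁ • v)) (x + toTorus (t₁ • u))}
      = (fun x => x + -b) ⁻¹' B := by
    have h2 : ∀ s : ℝ, ∀ x, torusDist (a + toTorus (s • v)) (x + toTorus (s • u))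
        = torusDist (toTorus ((s - t₁) • (v - u))) (x + -b) := by
      intro s x
      refine torusDist_congr ?_
      have e : (s - t₁) • (v - u) = s • v - t₁ • v - (s • u - t₁ • u) := by module
      rw [e, toTorus_sub, toTorus_sub, toTorus_sub, hb]
      abel
    ext x
    simp only [mem_ofPred_eq, mem_preimage, hB, h2]
    rw [sub_self, zero_smul, toTorus_zero]
  rw [h1, measure_preimage_add_right]
  refine (volume_torus_le hAm hBm ?_).trans (volume_swept_le (v - u) hε)
  rintro x ⟨⟨s, hs, hsx⟩, hx⟩
  obtain ⟨z, hz, hzx⟩ := exists_lift x (toTorus ((s - t₁) • (v - u)))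
  have hxz : x = toTorus (z + (s - t₁) • (v - u)) := by
    rw [toTorus_add, ← hzx]
    abel
  refine ⟨z + (s - t₁) • (v - u), ⟨s - t₁, ⟨by linarith [hs.1], by linarith [hs.2]⟩, ?_, ?_⟩,
    hxz.symm⟩
  · rw [add_sub_cancel_right, hz, torusDist_comm]
    exact hsx
  · rw [torusDist_comm] at hx
    exact hx.trans_le (torusDist_le_norm (by rw [sub_zero, ← hxz]))

/-- The integral over `[0, t]` of a function of the velocity of the tagged particle. -/
noncomputable def pathIntegral (F : Vel → ENNReal) (r : Torus × Vel) :
    (n : ℕ) → (Fin n → Marker) → ℝ → ENNReal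
  | 0, _, t => ENNReal.ofReal t * F r.2
  | n + 1, c, t => ENNReal.ofReal (t - (c (Fin.last n)).1) * F (velAfter (treeOf r c) (n + 1)) +
      pathIntegral F r n (Fin.init c) (c (Fin.last n)).1

theorem isTree_init {n : ℕ} {t : ℝ} {r : Torus × Vel} {c : Fin (n + 1) → Marker}
    (h : IsTree t (treeOf r c)) : IsTree (c (Fin.last n)).1 (treeOf r (Fin.init c)) ∧
      0 < (c (Fin.last n)).1 ∧ (c (Fin.last n)).1 ≤ t ∧
      ∀ j, collTime (treeOf r c) j ≤ (c (Fin.last n)).1 := by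
  have h0 : ∀ j, collTime (treeOf r c) j ≤ (c (Fin.last n)).1 := fun j =>
    h.2.monotone (Fin.le_last j)
  refine ⟨⟨fun j => ⟨(h.1 j.castSucc).1, h0 j.castSucc⟩, fun i j hij => ?_⟩,
    (h.1 (Fin.last n)).1, (h.1 (Fin.last n)).2, h0⟩
  exact h.2 (Fin.castSucc_lt_castSucc_iff.2 hij)

/-- The volume of the set of initial positions of a background particle of velocity `u` that meets
the tagged particle before time `t`. -/
theorem volume_contact_le {ε : ℝ} (hε : 0 < ε) (u : Vel) (r : Torus × Vel) :
    ∀ (n : ℕ) (c : Fin n → Marker) (t : ℝ), IsTree t (treeOf r c) →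
      volume {x : Torus | ∃ s ∈ Icc 0 t,
          torusDist (pos (treeOf r c) s) (x + toTorus (s • u)) ≤ ε}
        ≤ ENNReal.ofReal (4 / 3 * Real.pi * ε ^ 3) +
          ENNReal.ofReal (ε ^ 2) * pathIntegral (fun v => flux (v - u)) r n c t
  | 0, c, t, _ => by
    have hpos : ∀ s, pos (treeOf r c) s = r.1 + toTorus (s • r.2) := fun s => by
      simp [pos, rootPos, rootVel]
    have h1 := volume_newContact_le hε r.1 r.2 u 0 t
    rw [sub_zero] at h1
    refine (measure_mono ?_).trans ((measure_union_le _ _).trans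
      (add_le_add (volume_torus_ball_le hε r.1) h1))
    rintro x ⟨s, hs, hx⟩
    by_cases h0 : torusDist r.1 x ≤ ε
    · exact Or.inl h0
    · refine Or.inr ⟨⟨s, hs, by rwa [← hpos]⟩, ?_⟩
      simpa [toTorus_zero] using h0
  | n + 1, c, t, h => by
    obtain ⟨h1, h2, h3, h4⟩ := isTree_init h
    set τ := (c (Fin.last n)).1 with hτ
    have ih := volume_contact_le hε u r n (Fin.init c) τ h1
    have hn := volume_newContact_le hε (flightBase (treeOf r c)) (velAfter (treeOf r c) (n + 1))
      u τ t
    have hpos : ∀ s, τ ≤ s → pos (treeOf r c) s = flightBase (treeOf r c) +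
        toTorus (s • velAfter (treeOf r c) (n + 1)) := fun s hs =>
      pos_eq_flightBase fun j => (h4 j).trans hs
    refine (measure_mono ?_).trans ((measure_union_le _ _).trans ((add_le_add hn ih).trans ?_))
    · rintro x ⟨s, hs, hx⟩
      -- Without a contact up to time `τ`, the particle is outside the ball when the last flight
      -- begins, so a later contact is a new one on that flight.
      by_cases h0 : ∃ s ∈ Icc 0 τ,
          torusDist (pos (treeOf r (Fin.init c)) s) (x + toTorus (s • u)) ≤ ε
      · exact Or.inr h0
      · push Not at h0
        have hsτ : τ < s := by
          by_contra hcon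
          push Not at hcon
          have := h0 s ⟨hs.1, hcon⟩
          rw [← pos_init r c hcon] at this
          linarith
        refine Or.inl ⟨⟨s, ⟨hsτ.le, hs.2⟩, by rwa [← hpos s hsτ.le]⟩, ?_⟩
        have := h0 τ ⟨h2.le, le_rfl⟩
        rwa [← pos_init r c le_rfl, hpos τ le_rfl] at this
    · rw [pathIntegral, mul_add]
      refine le_of_eq ?_
      ring

theorem measurable_flux : Measurable flux := by
  have h : Measurable fun q : Vel × Direction =>
      ENNReal.ofReal (max (inner ℝ (q.2 : Vel) q.1) 0) := by fun_prop
  exact h.lintegral_prod_right'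

theorem measurable_pathIntegral {F : Vel → Vel → ENNReal} (hF : ∀ v, Measurable (F v))
    (r : Torus × Vel) : ∀ (n : ℕ) (c : Fin n → Marker) (t : ℝ),
      Measurable fun u => pathIntegral (fun v => F v u) r n c t
  | 0, _, _ => (hF _).const_mul _
  | n + 1, _, _ => ((hF _).const_mul _).add (measurable_pathIntegral hF r n _ _)

/-- Tonelli flight by flight. It turns the swept volume averaged over background velocities into the
collision rate integrated along the trajectory. -/
theorem lintegral_pathIntegral {μ : Measure Vel} {G : Vel → ENNReal} (hG : Measurable G)
    {F : Vel → Vel → ENNReal} (hF : ∀ v, Measurable (F v))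
    (r : Torus × Vel) : ∀ (n : ℕ) (c : Fin n → Marker) (t : ℝ),
      ∫⁻ u, G u * pathIntegral (fun v => F v u) r n c t ∂μ
        = pathIntegral (fun v => ∫⁻ u, G u * F v u ∂μ) r n c t
  | 0, c, t => by
    have h0 : Measurable fun u => G u * F r.2 u := hG.mul (hF _)
    simp only [pathIntegral]
    rw [← lintegral_const_mul _ h0]
    exact lintegral_congr fun u => by ring
  | n + 1, c, t => by
    have h0 : Measurable fun u => G u * F (velAfter (treeOf r c) (n + 1)) u := hG.mul (hF _)
    simp only [pathIntegral]
    rw [← lintegral_pathIntegral hG hF r n, ← lintegral_const_mul _ h0,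
      ← lintegral_add_left (h0.const_mul _)]
    exact lintegral_congr fun u => by ring

/-- The collision rate, as an integral over background velocities. -/
noncomputable def lrate (g₀ : Vel → ℝ) (v : Vel) : ENNReal :=
  ∫⁻ u, ENNReal.ofReal (g₀ u) * flux (v - u)

/-- At each background velocity the initial positions that lead to a hit fill at most a ball and the
swept tubes; averaging against g₀ gives the overlap term and ε² times the accumulated rate. -/
theorem bgMeasure_compl_survivalSet_le {g₀ : Vel → ℝ} (hg : Measurable g₀)
    (hg1 : ∫⁻ u, ENNReal.ofReal (g₀ u) = 1) {ε : ℝ} (hε : 0 < ε) {r : Torus × Vel} {n : ℕ}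
    {c : Fin n → Marker} {t : ℝ} (h : IsTree t (treeOf r c)) :
    bgMeasure g₀ (survivalSet ε t (treeOf r c))ᶜ
      ≤ ENNReal.ofReal (4 / 3 * Real.pi * ε ^ 3) +
        ENNReal.ofReal (ε ^ 2) * pathIntegral (lrate g₀) r n c t := by
  have hm := (measurableSet_survivalSet ε t (treeOf r c)).compl
  have hG : Measurable fun u => ENNReal.ofReal (g₀ u) := hg.ennreal_ofReal
  have hF : ∀ v : Vel, Measurable fun u => flux (v - u) := fun v =>
    measurable_flux.comp (measurable_const.sub measurable_id)
  have hP := measurable_pathIntegral hF r n c t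
  have hGm : Measurable fun p : Torus × Vel => ENNReal.ofReal (g₀ p.2) := hG.comp measurable_snd
  have e1 : bgMeasure g₀ (survivalSet ε t (treeOf r c))ᶜ = ∫⁻ u, ENNReal.ofReal (g₀ u) *
      volume {x : Torus | ∃ s ∈ Icc 0 t,
          torusDist (pos (treeOf r c) s) (x + toTorus (s • u)) ≤ ε} := by
    rw [bgMeasure, withDensity_apply _ hm, ← lintegral_indicator hm, Measure.volume_eq_prod,
      lintegral_prod_symm _ (hGm.indicator hm).aemeasurable]
    refine lintegral_congr fun u => ?_
    have hu : MeasurableSet ((fun x : Torus => (x, u)) ⁻¹' (survivalSet ε t (treeOf r c))ᶜ) :=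
      measurable_prodMk_right hm
    have e2 : {x : Torus | ∃ s ∈ Icc 0 t,
          torusDist (pos (treeOf r c) s) (x + toTorus (s • u)) ≤ ε}
        = (fun x : Torus => (x, u)) ⁻¹' (survivalSet ε t (treeOf r c))ᶜ := by
      ext x
      simp [survivalSet, and_assoc]
    rw [e2, ← lintegral_indicator_const hu]
    rfl
  have hGP : Measurable fun u =>
      ENNReal.ofReal (g₀ u) * pathIntegral (fun v => flux (v - u)) r n c t := hG.mul hP
  rw [e1]
  calc _ ≤ ∫⁻ u, ENNReal.ofReal (4 / 3 * Real.pi * ε ^ 3) * ENNReal.ofReal (g₀ u) +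
          ENNReal.ofReal (ε ^ 2) * (ENNReal.ofReal (g₀ u) *
            pathIntegral (fun v => flux (v - u)) r n c t) := by
        refine lintegral_mono fun u => ?_
        refine (mul_le_mul_right (volume_contact_le hε u r n c t h) _).trans (le_of_eq ?_)
        ring
    _ = _ := by
        rw [lintegral_add_left (hG.const_mul _), lintegral_const_mul _ hG,
          lintegral_const_mul _ hGP, hg1, mul_one, lintegral_pathIntegral hG hF]
        rfl

/-! ### Integrability and growth of the collision rate. -/

variable {f₀ : Torus × Vel → ℝ} {g₀ : Vel → ℝ}

namespace Admissible

theorem g_integrable (h : Admissible f₀ g₀) : Integrable g₀ :=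
  .of_integral_ne_zero (by rw [h.g_integral]; exact one_ne_zero)

theorem f_integrable (h : Admissible f₀ g₀) : Integrable f₀ :=
  .of_integral_ne_zero (by rw [h.f_integral]; exact one_ne_zero)

theorem lintegral_g (h : Admissible f₀ g₀) : ∫⁻ u, ENNReal.ofReal (g₀ u) = 1 := by
  rw [← ofReal_integral_eq_lintegral_ofReal h.g_integrable (.of_forall h.g_nonneg), h.g_integral,
    ENNReal.ofReal_one]

theorem lintegral_f (h : Admissible f₀ g₀) : ∫⁻ p, ENNReal.ofReal (f₀ p) = 1 := by
  rw [← ofReal_integral_eq_lintegral_ofReal h.f_integrable (.of_forall h.f_nonneg), h.f_integral,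
    ENNReal.ofReal_one]

theorem g_norm_integrable (h : Admissible f₀ g₀) : Integrable fun u => g₀ u * ‖u‖ := by
  refine h.g_moment.mono' (h.g_meas.mul measurable_norm).aestronglyMeasurable (.of_forall fun u => ?_)
  have h0 := h.g_nonneg u
  rw [Real.norm_of_nonneg (by positivity)]
  gcongr
  nlinarith [sq_nonneg (‖u‖ - 1)]

theorem collision_integrable (h : Admissible f₀ g₀) (v : Vel) :
    Integrable (fun p : Direction × Vel => g₀ p.2 * max (inner ℝ (v - p.2) (p.1 : Vel)) 0)
      (sphereMeasure.prod volume) := by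
  have h1 : Integrable (fun u => g₀ u * (‖v‖ + ‖u‖)) := by
    have := (h.g_integrable.mul_const ‖v‖).add h.g_norm_integrable
    refine this.congr (.of_forall fun u => ?_)
    simp only [Pi.add_apply]
    ring
  have h2 := (integrable_const (μ := sphereMeasure) (1 : ℝ)).mul_prod h1
  have hm : Measurable fun p : Direction × Vel =>
      g₀ p.2 * max (inner ℝ (v - p.2) (p.1 : Vel)) 0 :=
    (h.g_meas.comp measurable_snd).mul (by fun_prop)
  refine h2.mono' hm.aestronglyMeasurable (.of_forall fun p => ?_)
  have h0 := h.g_nonneg p.2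
  rw [Real.norm_of_nonneg (by positivity), one_mul]
  gcongr
  refine max_le ((real_inner_le_norm _ _).trans ?_) (by positivity)
  rw [norm_direction, mul_one]
  exact norm_sub_le _ _

theorem ofReal_rate (h : Admissible f₀ g₀) (v : Vel) :
    ENNReal.ofReal (rate g₀ v) = lrate g₀ v := by
  have hi := h.collision_integrable v
  have hnn : ∀ u : Vel, ∀ ν : Direction, 0 ≤ g₀ u * max (inner ℝ (v - u) (ν : Vel)) 0 :=
    fun u ν => mul_nonneg (h.g_nonneg u) (le_max_right _ _)
  have e1 : rate g₀ v = ∫ p : Direction × Vel, g₀ p.2 * max (inner ℝ (v - p.2) (p.1 : Vel)) 0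
      ∂(sphereMeasure.prod volume) := (integral_prod _ hi).symm
  have hm : Measurable fun p : Direction × Vel =>
      ENNReal.ofReal (g₀ p.2 * max (inner ℝ (v - p.2) (p.1 : Vel)) 0) :=
    ((h.g_meas.comp measurable_snd).mul (by fun_prop)).ennreal_ofReal
  rw [e1, ofReal_integral_eq_lintegral_ofReal hi (.of_forall fun p => hnn _ _),
    lintegral_prod_symm _ hm.aemeasurable]
  refine lintegral_congr fun u => ?_
  rw [flux, ← lintegral_const_mul _ (by fun_prop)]
  refine lintegral_congr fun ν => ?_
  rw [ENNReal.ofReal_mul (h.g_nonneg u), real_inner_comm]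

theorem rate_nonneg (h : Admissible f₀ g₀) (v : Vel) : 0 ≤ rate g₀ v :=
  integral_nonneg fun _ => integral_nonneg fun u => mul_nonneg (h.g_nonneg u) (le_max_right _ _)

/-- From ‖v - u‖ ≤ (1 + ‖u‖²)(1 + ‖v‖): the constant is the second-moment integral of g₀ times the
area of the sphere. -/
theorem exists_rate_le (h : Admissible f₀ g₀) :
    ∃ K : ℝ, 0 ≤ K ∧ ∀ v, rate g₀ v ≤ K * (1 + ‖v‖) := by
  set m := ∫ u, g₀ u * (1 + ‖u‖ ^ 2) with hm
  have hm0 : 0 ≤ m := integral_nonneg fun u => mul_nonneg (h.g_nonneg u) (by positivity)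
  refine ⟨m * sphereMeasure.real univ, by positivity, fun v => ?_⟩
  have h1 : ∀ ν : Direction, ‖∫ u : Vel, g₀ u * max (inner ℝ (v - u) (ν : Vel)) 0‖
      ≤ m * (1 + ‖v‖) := by
    intro ν
    have hnn : ∀ u : Vel, 0 ≤ g₀ u * max (inner ℝ (v - u) (ν : Vel)) 0 :=
      fun u => mul_nonneg (h.g_nonneg u) (le_max_right _ _)
    rw [Real.norm_of_nonneg (integral_nonneg hnn), hm, ← integral_mul_const]
    refine integral_mono_of_nonneg (.of_forall hnn) (h.g_moment.mul_const _)
      (.of_forall fun u => ?_)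
    simp only
    rw [mul_assoc]
    refine mul_le_mul_of_nonneg_left (max_le ((real_inner_le_norm _ _).trans ?_) (by positivity))
      (h.g_nonneg u)
    rw [norm_direction, mul_one]
    have := norm_sub_le v u
    nlinarith [sq_nonneg (‖u‖ - 1), norm_nonneg u, norm_nonneg v,
      mul_nonneg (norm_nonneg v) (sq_nonneg ‖u‖)]
  have h2 := norm_integral_le_of_norm_le_const (μ := sphereMeasure) (.of_forall h1)
  calc rate g₀ v ≤ ‖rate g₀ v‖ := le_abs_self _
    _ ≤ _ := h2
    _ = _ := by ring

end Admissible

/-! ### Accumulated rate and the closed form of the idealized density. -/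

/-- The integral of the collision rate along the trajectory up to time `t`. -/
noncomputable def exposure (g₀ : Vel → ℝ) (r : Torus × Vel) :
    (n : ℕ) → (Fin n → Marker) → ℝ → ℝ
  | 0, _, t => t * rate g₀ r.2
  | n + 1, c, t => (t - (c (Fin.last n)).1) * rate g₀ (velAfter (treeOf r c) (n + 1)) +
      exposure g₀ r n (Fin.init c) (c (Fin.last n)).1

theorem exposure_nonneg (h : Admissible f₀ g₀) (r : Torus × Vel) :
    ∀ (n : ℕ) (c : Fin n → Marker) (t : ℝ), 0 ≤ t → IsTree t (treeOf r c) →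
      0 ≤ exposure g₀ r n c t
  | 0, _, _, ht, _ => mul_nonneg ht (h.rate_nonneg _)
  | n + 1, c, t, _, hc => by
    obtain ⟨h1, h2, h3, -⟩ := isTree_init hc
    exact add_nonneg (mul_nonneg (sub_nonneg.2 h3) (h.rate_nonneg _))
      (exposure_nonneg h r n _ _ h2.le h1)

theorem pathIntegral_lrate (h : Admissible f₀ g₀) (r : Torus × Vel) :
    ∀ (n : ℕ) (c : Fin n → Marker) (t : ℝ), 0 ≤ t → IsTree t (treeOf r c) →
      pathIntegral (lrate g₀) r n c t = ENNReal.ofReal (exposure g₀ r n c t)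
  | 0, _, _, ht, _ => by
    rw [pathIntegral, exposure, ENNReal.ofReal_mul ht, h.ofReal_rate]
  | n + 1, c, t, _, hc => by
    obtain ⟨h1, h2, h3, -⟩ := isTree_init hc
    have h4 := sub_nonneg.2 h3
    rw [pathIntegral, exposure, ENNReal.ofReal_add (mul_nonneg h4 (h.rate_nonneg _))
      (exposure_nonneg h r n _ _ h2.le h1), ENNReal.ofReal_mul h4, h.ofReal_rate,
      pathIntegral_lrate h r n _ _ h2.le h1]

theorem exposure_le {R : ℝ} (r : Torus × Vel) :
    ∀ (n : ℕ) (c : Fin n → Marker) (t : ℝ), 0 ≤ t → IsTree t (treeOf r c) →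
      (∀ k ≤ n, rate g₀ (velAfter (treeOf r c) k) ≤ R) → exposure g₀ r n c t ≤ t * R
  | 0, _, _, ht, _, hR => mul_le_mul_of_nonneg_left (hR 0 le_rfl) ht
  | n + 1, c, t, _, hc, hR => by
    obtain ⟨h1, h2, h3, -⟩ := isTree_init hc
    have h4 := mul_le_mul_of_nonneg_left (hR (n + 1) le_rfl) (sub_nonneg.2 h3)
    have h5 := exposure_le r n _ _ h2.le h1 fun k hk => by
      rw [← velAfter_init r c hk]
      exact hR k (Nat.le_succ_of_le hk)
    rw [exposure]
    linarith

/-- Unrolling the recursion: the exponents of the free flights add up to the exposure. -/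
theorem idealAux_eq (r : Torus × Vel) :
    ∀ (n : ℕ) (c : Fin n → Marker) (t : ℝ), IsTree t (treeOf r c) →
      idealAux f₀ g₀ r n c t = Real.exp (-exposure g₀ r n c t) * f₀ r *
        ∏ j : Fin n, (g₀ (collVel (treeOf r c) j) * max (inner ℝ (collDir (treeOf r c) j)
          (velAfter (treeOf r c) j - collVel (treeOf r c) j)) 0)
  | 0, _, _, _ => by simp [idealAux, exposure]
  | n + 1, c, t, hc => by
    obtain ⟨h1, h2, h3, -⟩ := isTree_init hc
    have ih := idealAux_eq r n _ _ h1
    have e1 : velBefore (treeOf r c) (c (Fin.last n)).1 = velAfter (treeOf r c) n :=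
      velBefore_collTime hc.2 (Fin.last n)
    have e2 : vel (treeOf r c) (c (Fin.last n)).1 = velAfter (treeOf r c) (n + 1) :=
      vel_collTime hc.2 (Fin.last n)
    have e3 : ∀ j : Fin n, (g₀ (collVel (treeOf r c) j.castSucc) *
        max (inner ℝ (collDir (treeOf r c) j.castSucc)
          (velAfter (treeOf r c) (j.castSucc : Fin (n + 1)) - collVel (treeOf r c) j.castSucc)) 0)
        = g₀ (collVel (treeOf r (Fin.init c)) j) * max (inner ℝ (collDir (treeOf r (Fin.init c)) j)
          (velAfter (treeOf r (Fin.init c)) j - collVel (treeOf r (Fin.init c)) j)) 0 := by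
      intro j
      rw [Fin.val_castSucc, velAfter_init r c j.2.le]
      rfl
    rw [idealAux, if_pos h3, e1, e2, ih, exposure, Fin.prod_univ_castSucc, Finset.prod_congr rfl fun j _ => e3 j,
      neg_add, Real.exp_add, real_inner_comm]
    change _ = _ * _ * (_ * (g₀ (c (Fin.last n)).2.2 * max (inner ℝ ((c (Fin.last n)).2.1 : Vel)
      (velAfter (treeOf r c) n - (c (Fin.last n)).2.2)) 0))
    ring

/-- Only the last collision can violate the time bound decisively: if it is at most t, so are all
others; if not, the indicator in P_t vanishes. -/
theorem idealDensity_eq_zero {T t : ℝ} {Φ : CollisionTree} (hΦ : IsTree T Φ)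
    (h : ¬ IsTree t Φ) : idealDensity f₀ g₀ t Φ = 0 := by
  obtain ⟨n, r, c⟩ := Φ
  cases n with
  | zero => exact absurd ⟨fun j => j.elim0, hΦ.2⟩ h
  | succ n =>
    have h1 : ¬ (c (Fin.last n)).1 ≤ t := fun h1 =>
      h ⟨fun j => ⟨(hΦ.1 j).1, (hΦ.2.monotone (Fin.le_last j)).trans h1⟩, hΦ.2⟩
    rw [idealDensity, idealAux]
    exact if_neg h1

/-- The velocity takes finitely many values. Boundedness matters because an unbounded real supremum
is 0 by convention. -/
theorem bddAbove_rate_vel (g₀ : Vel → ℝ) (T : ℝ) (Φ : CollisionTree) :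
    BddAbove (range fun s : Icc (0 : ℝ) T => rate g₀ (vel Φ s)) := by
  refine (((finite_Iic (numColl Φ)).image fun k => rate g₀ (velAfter Φ k)).bddAbove).mono ?_
  rintro _ ⟨s, rfl⟩
  refine ⟨_, ?_, rfl⟩
  exact (Finset.card_le_univ _).trans (by simp)

theorem rate_velAfter_le {T : ℝ} (hT : 0 ≤ T) {Φ : CollisionTree} (h : IsTree T Φ) {k : ℕ}
    (hk : k ≤ numColl Φ) : rate g₀ (velAfter Φ k) ≤ maxRate g₀ T Φ / 2 := by
  obtain ⟨s, hs, e⟩ := exists_vel_eq_velAfter hT h hk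
  rw [← e, maxRate, mul_div_cancel_left₀ _ two_ne_zero]
  exact le_ciSup (bddAbove_rate_vel g₀ T Φ) ⟨s, hs⟩

theorem maxRate_nonneg (h : Admissible f₀ g₀) (T : ℝ) (Φ : CollisionTree) :
    0 ≤ maxRate g₀ T Φ :=
  mul_nonneg zero_le_two (Real.iSup_nonneg fun _ => h.rate_nonneg _)

theorem isProbabilityMeasure_bgMeasure (h : Admissible f₀ g₀) :
    IsProbabilityMeasure (bgMeasure g₀) := by
  have hm : Measurable fun p : Torus × Vel => ENNReal.ofReal (g₀ p.2) :=
    (h.g_meas.comp measurable_snd).ennreal_ofReal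
  refine ⟨?_⟩
  rw [bgMeasure, withDensity_apply _ .univ, Measure.restrict_univ, Measure.volume_eq_prod,
    lintegral_prod_symm _ hm.aemeasurable]
  have h1 : volume (univ : Set Torus) = 1 := by
    rw [volume_pi, Measure.pi_univ]
    simp
  simp only [lintegral_const, h1, mul_one]
  exact h.lintegral_g

theorem isProbabilityMeasure_configLaw (h : Admissible f₀ g₀) (N : ℕ) :
    IsProbabilityMeasure (configLaw f₀ g₀ N) := by
  have h1 := isProbabilityMeasure_bgMeasure h
  have h2 : IsProbabilityMeasure
      ((volume : Measure (Torus × Vel)).withDensity fun p => ENNReal.ofReal (f₀ p)) :=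
    ⟨by rw [withDensity_apply _ .univ, Measure.restrict_univ]; exact h.lintegral_f⟩
  have h3 : IsProbabilityMeasure (Measure.pi fun _ : Fin N =>
      (volume : Measure (Torus × Vel)).withDensity fun p => ENNReal.ofReal (g₀ p.2)) :=
    inferInstanceAs (IsProbabilityMeasure (Measure.pi fun _ : Fin N => bgMeasure g₀))
  unfold configLaw
  infer_instance

/-! ### Hitting probability and the error term η. -/

theorem continuous_separation (Φ : CollisionTree) :
    Continuous fun q : (Torus × Vel) × ℝ =>
      torusDist (pos Φ q.2) (q.1.1 + toTorus (q.2 • q.1.2)) := by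
  obtain ⟨n, x⟩ := Φ
  have h1 : Continuous fun q : (Torus × Vel) × ℝ => pos (mkTree n x) q.2 :=
    (continuous_pos n).comp (continuous_const.prodMk continuous_snd)
  have h2 : Continuous fun q : (Torus × Vel) × ℝ => q.2 • q.1.2 := by fun_prop
  exact continuous_torusDist h1 ((continuous_fst.comp continuous_fst).add
    (continuous_toTorus.comp h2))

theorem continuous_separation_right (Φ : CollisionTree) (p : Torus × Vel) :
    Continuous fun s : ℝ => torusDist (pos Φ s) (p.1 + toTorus (s • p.2)) := by
  have hp : Continuous fun s : ℝ => ((p, s) : (Torus × Vel) × ℝ) := by fun_prop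
  have h := (continuous_separation Φ).comp hp
  simpa only [Function.comp_def] using h

theorem measurableSet_avoidSet (ε t : ℝ) (Φ : CollisionTree) : MeasurableSet (avoidSet ε t Φ) := by
  have h : avoidSet ε t Φ = ⋂ m : ℕ, {p | ∃ s ∈ Icc (1 / (m + 1 : ℝ)) (t - 1 / (m + 1 : ℝ)),
      torusDist (pos Φ s) (p.1 + toTorus (s • p.2)) ≤ ε}ᶜ := by
    ext p
    simp only [avoidSet, mem_ofPred_eq, mem_iInter, mem_compl_iff, not_exists, not_and, not_le]
    constructor
    · intro h m s hs
      have : (0 : ℝ) < 1 / (m + 1 : ℝ) := by positivity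
      exact h s ⟨by linarith [hs.1], by linarith [hs.2]⟩
    · intro h s hs
      obtain ⟨m, hm⟩ := exists_nat_one_div_lt (lt_min hs.1 (sub_pos.2 hs.2))
      exact h m s ⟨(hm.trans_le (min_le_left _ _)).le,
        by linarith [hm.trans_le (min_le_right _ _)]⟩
  rw [h]
  exact MeasurableSet.iInter fun m => (isClosed_exists_mem_Icc
    (isClosed_le (continuous_separation Φ) continuous_const)).measurableSet.compl

theorem volume_torus_sphere {ε : ℝ} (hε : 0 < ε) (x : Torus) :
    volume {y : Torus | torusDist x y = ε} = 0 := by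
  have hm : MeasurableSet {y : Torus | torusDist 0 y = ε} :=
    (isClosed_eq (continuous_torusDist continuous_const continuous_id)
      continuous_const).measurableSet
  have h1 : {y : Torus | torusDist x y = ε} = (fun y => y + -x) ⁻¹' {y : Torus | torusDist 0 y = ε} := by
    ext y
    simp only [mem_ofPred_eq, mem_preimage]
    rw [torusDist_congr (x := x) (y := y) (x' := 0) (y' := y + -x) (by abel)]
  rw [h1, measure_preimage_add_right, ← nonpos_iff_eq_zero,
    ← Measure.addHaar_sphere_of_ne_zero (volume : Measure Vel) 0 hε.ne']
  refine volume_torus_le Metric.isClosed_sphere.measurableSet hm fun y hy => ?_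
  obtain ⟨z, hz, hzy⟩ := exists_lift y 0
  refine ⟨z, ?_, by rw [← hzy, sub_zero]⟩
  rw [mem_sphere_zero_iff_norm, hz, torusDist_comm]
  exact hy

theorem bgMeasure_contact_eq_zero (g₀ : Vel → ℝ) {ε : ℝ} (hε : 0 < ε) (Φ : CollisionTree) (s : ℝ) :
    bgMeasure g₀ {p | torusDist (pos Φ s) (p.1 + toTorus (s • p.2)) = ε} = 0 := by
  refine withDensity_absolutelyContinuous _ _ ?_
  have hm : MeasurableSet {p : Torus × Vel | torusDist (pos Φ s) (p.1 + toTorus (s • p.2)) = ε} :=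
    (isClosed_eq ((continuous_separation Φ).comp
      (continuous_id.prodMk continuous_const)) continuous_const).measurableSet
  rw [Measure.volume_eq_prod, Measure.prod_apply_symm hm]
  refine (lintegral_congr fun u => ?_).trans lintegral_zero
  have h : (fun x : Torus => (x, u)) ⁻¹'
      {p : Torus × Vel | torusDist (pos Φ s) (p.1 + toTorus (s • p.2)) = ε}
      = {x | torusDist (pos Φ s - toTorus (s • u)) x = ε} := by
    ext x
    simp only [mem_preimage, mem_ofPred_eq]
    rw [torusDist_congr (x := pos Φ s) (y := x + toTorus (s • u))
      (x' := pos Φ s - toTorus (s • u)) (y' := x) (by abel)]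
  rw [h]
  exact volume_torus_sphere hε _

/-- η uses the open interval (0, t), the hitting probability the closed one. By continuity a
particle avoiding contact on (0, t) keeps distance at least ε on [0, t], with equality only at the
end points, and each equality is a null event. -/
theorem bgMeasure_compl_survivalSet_le_avoidSet (g₀ : Vel → ℝ) {ε t : ℝ} (hε : 0 < ε)
    (ht : 0 < t) (Φ : CollisionTree) :
    bgMeasure g₀ (survivalSet ε t Φ)ᶜ ≤ bgMeasure g₀ (avoidSet ε t Φ)ᶜ := by
  have hsub : (survivalSet ε t Φ)ᶜ ⊆ (avoidSet ε t Φ)ᶜ ∪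
      ({p | torusDist (pos Φ 0) (p.1 + toTorus ((0 : ℝ) • p.2)) = ε} ∪
        {p | torusDist (pos Φ t) (p.1 + toTorus (t • p.2)) = ε}) := by
    intro p hp
    by_cases hpa : p ∈ avoidSet ε t Φ
    swap
    · exact Or.inl hpa
    refine Or.inr ?_
    have hcont := continuous_separation_right Φ p
    have hsub : Icc 0 t ⊆ {s : ℝ | ε ≤ torusDist (pos Φ s) (p.1 + toTorus (s • p.2))} := by
      rw [← closure_Ioo ht.ne]
      exact closure_minimal (fun s hs => (hpa s hs).le) (isClosed_le continuous_const hcont)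
    have hge : ∀ s ∈ Icc 0 t, ε ≤ torusDist (pos Φ s) (p.1 + toTorus (s • p.2)) :=
      fun s hs => hsub hs
    simp only [survivalSet, mem_compl_iff, mem_ofPred_eq, not_forall, not_lt] at hp
    obtain ⟨s, hs, hle⟩ := hp
    have heq := le_antisymm hle (hge s hs)
    rcases hs.1.eq_or_lt with h0 | h0
    · subst h0
      exact Or.inl heq
    rcases hs.2.eq_or_lt with h1 | h1
    · subst h1
      exact Or.inr heq
    · exact absurd (hpa s ⟨h0, h1⟩) (not_lt.2 hle)
  refine (measure_mono hsub).trans ((measure_union_le _ _).trans ?_)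
  rw [measure_union_null (bgMeasure_contact_eq_zero g₀ hε Φ 0)
    (bgMeasure_contact_eq_zero g₀ hε Φ t), add_zero]

theorem etaErr_eq (h : Admissible f₀ g₀) (ε t : ℝ) (Φ : CollisionTree) :
    etaErr g₀ ε t Φ = (bgMeasure g₀ (avoidSet ε t Φ)ᶜ).toReal := by
  have hA := measurableSet_avoidSet ε t Φ
  have hm : Measurable fun p : Torus × Vel =>
      g₀ p.2 * (1 - (avoidSet ε t Φ).indicator (fun _ => (1 : ℝ)) p) :=
    (h.g_meas.comp measurable_snd).mul
      (measurable_const.sub (measurable_const.indicator hA))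
  have hnn : ∀ p : Torus × Vel,
      0 ≤ g₀ p.2 * (1 - (avoidSet ε t Φ).indicator (fun _ => (1 : ℝ)) p) := fun p => by
    refine mul_nonneg (h.g_nonneg _) (sub_nonneg.2 ?_)
    exact indicator_le_self' (fun _ _ => zero_le_one) p
  rw [etaErr, integral_eq_lintegral_of_nonneg_ae (.of_forall hnn) hm.aestronglyMeasurable,
    bgMeasure, withDensity_apply _ hA.compl, ← lintegral_indicator hA.compl]
  congr 1
  refine lintegral_congr fun p => ?_
  by_cases hp : p ∈ avoidSet ε t Φ
  · simp [hp]
  · simp [hp]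

theorem etaErr_nonneg (h : Admissible f₀ g₀) (ε t : ℝ) (Φ : CollisionTree) :
    0 ≤ etaErr g₀ ε t Φ := by
  rw [etaErr_eq h]
  exact ENNReal.toReal_nonneg

theorem hitProb_le_etaErr (h : Admissible f₀ g₀) {ε t : ℝ} (hε : 0 < ε) (ht : 0 < t)
    (Φ : CollisionTree) :
    (bgMeasure g₀ (survivalSet ε t Φ)ᶜ).toReal ≤ etaErr g₀ ε t Φ := by
  have := isProbabilityMeasure_bgMeasure h
  rw [etaErr_eq h]
  exact ENNReal.toReal_mono (measure_ne_top _ _)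
    (bgMeasure_compl_survivalSet_le_avoidSet g₀ hε ht Φ)

theorem hitProb_le (h : Admissible f₀ g₀) {ε : ℝ} (hε : 0 < ε) {r : Torus × Vel} {n : ℕ}
    {c : Fin n → Marker} {t : ℝ} (ht : 0 ≤ t) (hc : IsTree t (treeOf r c)) :
    (bgMeasure g₀ (survivalSet ε t (treeOf r c))ᶜ).toReal
      ≤ 4 / 3 * Real.pi * ε ^ 3 + ε ^ 2 * exposure g₀ r n c t := by
  have h0 := exposure_nonneg h r n c t ht hc
  have h1 := bgMeasure_compl_survivalSet_le h.g_meas h.lintegral_g hε hc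
  have h2 := Real.pi_pos
  rw [pathIntegral_lrate h r n c t ht hc, ← ENNReal.ofReal_mul (by positivity),
    ← ENNReal.ofReal_add (by positivity) (by positivity)] at h1
  exact ENNReal.toReal_le_of_le_ofReal (by positivity) h1

theorem survivalProb_eq (h : Admissible f₀ g₀) (ε t : ℝ) (Φ : CollisionTree) :
    survivalProb g₀ ε t Φ
      = ENNReal.ofReal (1 - (bgMeasure g₀ (survivalSet ε t Φ)ᶜ).toReal) := by
  have := isProbabilityMeasure_bgMeasure h
  have h1 := prob_add_prob_compl (μ := bgMeasure g₀) (measurableSet_survivalSet ε t Φ)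
  rw [survivalProb, ENNReal.ofReal_sub _ ENNReal.toReal_nonneg, ENNReal.ofReal_one,
    ENNReal.ofReal_toReal (measure_ne_top _ _), ← h1,
    ENNReal.add_sub_cancel_right (measure_ne_top _ _)]

/-! ### Elementary inequalities. -/

/-- Each factor satisfies (N - k) ε² ≥ 1 - k ε² ≥ 1 - ε, because k ε ≤ 1. Truncated subtraction can
only increase N - k. -/
theorem pow_le_descFactorial_mul {N : ℕ} {ε : ℝ} (hε : 0 ≤ ε) (hε1 : ε ≤ 1)
    (hN : (N : ℝ) * ε ^ 2 = 1) :
    ∀ n : ℕ, (n : ℝ) * ε ≤ 1 → (1 - ε) ^ n ≤ (N.descFactorial n : ℝ) * (ε ^ 2) ^ n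
  | 0, _ => by simp
  | n + 1, hn => by
    push_cast at hn
    have ih := pow_le_descFactorial_mul hε hε1 hN n (by linarith)
    have h1 : (N : ℝ) ≤ ((N - n : ℕ) : ℝ) + n := by
      have : N ≤ (N - n) + n := by omega
      exact_mod_cast this
    have h2 : 1 - ε ≤ ((N - n : ℕ) : ℝ) * ε ^ 2 := by
      nlinarith [mul_le_mul_of_nonneg_right h1 (sq_nonneg ε),
        mul_le_mul_of_nonneg_right (show (n : ℝ) * ε ≤ 1 by linarith) hε]
    rw [Nat.descFactorial_succ, Nat.cast_mul, pow_succ, pow_succ]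
    calc (1 - ε) ^ n * (1 - ε)
        ≤ ((N.descFactorial n : ℝ) * (ε ^ 2) ^ n) * (((N - n : ℕ) : ℝ) * ε ^ 2) :=
          mul_le_mul ih h2 (sub_nonneg.2 hε1) (by positivity)
      _ = _ := by ring

/-- The recursion says 1 - ρ_{k+1} = (1 - ε)(1 - ρ_k) - ηCt, and the last term may be dropped. -/
theorem one_sub_rho_le (h : Admissible f₀ g₀) (T : ℝ) {ε t : ℝ} (ht : 0 ≤ t) (hε1 : ε ≤ 1)
    (Φ : CollisionTree) : ∀ k : ℕ, 1 - rho g₀ T ε t Φ k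
      ≤ (1 - ε) ^ k * (1 - etaErr g₀ ε t Φ * maxRate g₀ T Φ * t)
  | 0 => by simp [rho]
  | k + 1 => by
    have ih := mul_le_mul_of_nonneg_left (one_sub_rho_le h T ht hε1 Φ k) (sub_nonneg.2 hε1)
    have h0 := mul_nonneg (mul_nonneg (etaErr_nonneg h ε t Φ) (maxRate_nonneg h T Φ)) ht
    rw [rho, pow_succ]
    linarith

/-- Bound exp x below by 1 + x + x²/2 at x = y + y²; times 1 - y this equals 1 - y³ + y²(1 + y)(1 -
y²)/2, which is at least 1 for y ≤ 1/4. -/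
theorem exp_neg_le_one_sub {y : ℝ} (h0 : 0 ≤ y) (h1 : y ≤ 1 / 4) :
    Real.exp (-(y + y ^ 2)) ≤ 1 - y := by
  have h2 := Real.quadratic_le_exp_of_nonneg (show 0 ≤ y + y ^ 2 by positivity)
  have h3 : 1 ≤ (1 - y) * Real.exp (y + y ^ 2) := by
    refine le_trans ?_ (mul_le_mul_of_nonneg_left h2 (by linarith))
    nlinarith [mul_nonneg (sq_nonneg y) h0, mul_nonneg (sq_nonneg y) (sub_nonneg.2 h1),
      mul_nonneg (mul_nonneg (sq_nonneg y) h0) (sub_nonneg.2 h1),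
      mul_nonneg (mul_nonneg (sq_nonneg y) (sq_nonneg y)) (sub_nonneg.2 h1)]
  rw [Real.exp_neg]
  exact inv_le_of_inv_le₀ (by linarith) (by
    rw [inv_le_iff_one_le_mul₀ (by linarith)]
    linarith)

/-- Here c stands for the overlap volume and b for the hitting probability. Writing 1 - b = (1 -
c)(1 - y), the number N y is at most about L, since N ε² = 1; the correction beyond first order
costs the factor 1 - 2bL. -/
theorem exp_mul_le_pow {N : ℕ} {ε b c L : ℝ} (hN : (N : ℝ) * ε ^ 2 = 1) (hb : 0 ≤ b)
    (hc4 : c ≤ 1 / 4) (hL : 0 ≤ L) (hLε : ε ^ 2 * L ≤ 1 / 8)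
    (hbc : b ≤ c + ε ^ 2 * L) :
    (1 - c) ^ N * (Real.exp (-L) * (1 - 2 * b * L)) ≤ (1 - b) ^ N := by
  have hc1 : 0 < 1 - c := by linarith
  -- For b ≤ c the claim is immediate, as the factor multiplying (1 - c)^N is at most 1.
  rcases le_total b c with hle | hle
  · have h1 : Real.exp (-L) * (1 - 2 * b * L) ≤ 1 := by
      have h2 : Real.exp (-L) ≤ 1 := Real.exp_le_one_iff.2 (by linarith)
      have h3 : 1 - 2 * b * L ≤ 1 := by nlinarith [mul_nonneg hb hL]
      calc Real.exp (-L) * (1 - 2 * b * L) ≤ Real.exp (-L) * 1 :=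
            mul_le_mul_of_nonneg_left h3 (Real.exp_pos _).le
        _ ≤ 1 := by rwa [mul_one]
    calc _ ≤ (1 - c) ^ N * 1 := mul_le_mul_of_nonneg_left h1 (by positivity)
      _ ≤ (1 - b) ^ N := by
        rw [mul_one]
        exact pow_le_pow_left₀ hc1.le (by linarith) N
  set y := (b - c) / (1 - c) with hy
  have hy0 : 0 ≤ y := div_nonneg (by linarith) hc1.le
  have hyb : y * (1 - c) = b - c := div_mul_cancel₀ _ hc1.ne'
  have hy1 : y ≤ 1 / 4 := by
    rw [hy, div_le_iff₀ hc1]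
    linarith
  have h1 : 1 - b = (1 - c) * (1 - y) := by linarith
  -- After clearing denominators this becomes b (1 - 4c) + c² + 2bc² ≥ 0, which is where c ≤ 1/4
  -- enters.
  have h2 : y + y ^ 2 ≤ (b - c) * (1 + 2 * b) := by
    have e : y + y ^ 2 = (b - c) * (1 - 2 * c + b) / (1 - c) ^ 2 := by
      rw [hy]
      field_simp
      ring
    rw [e, div_le_iff₀ (by positivity), mul_assoc]
    refine mul_le_mul_of_nonneg_left ?_ (by linarith)
    nlinarith [mul_nonneg hb (show 0 ≤ 1 - 4 * c by linarith),
      mul_nonneg (sq_nonneg c) hb, sq_nonneg c]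
  have h3 : (N : ℝ) * (y + y ^ 2) ≤ L + 2 * b * L := by
    have h4 : (N : ℝ) * (b - c) ≤ L := by
      calc (N : ℝ) * (b - c) ≤ N * (ε ^ 2 * L) :=
            mul_le_mul_of_nonneg_left (by linarith) (Nat.cast_nonneg _)
        _ = L := by rw [← mul_assoc, hN, one_mul]
    calc (N : ℝ) * (y + y ^ 2) ≤ N * ((b - c) * (1 + 2 * b)) :=
          mul_le_mul_of_nonneg_left h2 (Nat.cast_nonneg _)
      _ = (N * (b - c)) * (1 + 2 * b) := by ring
      _ ≤ L * (1 + 2 * b) := mul_le_mul_of_nonneg_right h4 (by linarith)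
      _ = _ := by ring
  rw [h1, mul_pow]
  refine mul_le_mul_of_nonneg_left ?_ (by positivity)
  calc Real.exp (-L) * (1 - 2 * b * L)
      ≤ Real.exp (-L) * Real.exp (-(2 * b * L)) := by
        refine mul_le_mul_of_nonneg_left ?_ (Real.exp_pos _).le
        have := Real.add_one_le_exp (-(2 * b * L))
        linarith
    _ = Real.exp (-(L + 2 * b * L)) := by rw [← Real.exp_add]; ring_nf
    _ ≤ Real.exp (-(N * (y + y ^ 2))) := Real.exp_le_exp.2 (neg_le_neg h3)
    _ = Real.exp (-(y + y ^ 2)) ^ N := by rw [← Real.exp_nat_mul]; ring_nf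
    _ ≤ (1 - y) ^ N := pow_le_pow_left₀ (Real.exp_pos _).le (exp_neg_le_one_sub hy0 hy1) N

/-! ### Comparison with the idealized density and conclusion. -/

/-- Absence of recollisions, taken at the full diameter, excludes contacts before t_j; the
no-later-contact condition excludes those after. -/
theorem mem_cleanTrees {T : ℝ} {V M : ℝ → ℝ} {ε t : ℝ} (hε : 0 ≤ ε) {n : ℕ}
    {x : (Torus × Vel) × (Fin n → Marker)} (hx : mkTree n x ∈ goodTrees T V M ε)
    (hnl : NoLaterContact ε t (mkTree n x)) (ht : IsTree t (mkTree n x)) :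
    x ∈ cleanTrees ε t n := by
  obtain ⟨-, -, -, -, h1, -, h2⟩ := hx
  refine ⟨⟨ht, fun j s hs hsj => h1 ε hε le_rfl j s hs.1 hsj, fun j => ?_⟩, fun j s hs hd => ?_⟩
  · have := h2 j
    rwa [velBefore_collTime ht.2] at this
  · rcases lt_trichotomy s (collTime (mkTree n x) j) with h | h | h
    · exact absurd (h1 ε hε le_rfl j s hs.1 h) (not_lt.2 hd)
    · exact h.symm
    · exact absurd (hnl j s h hs.2) (not_lt.2 hd)

/-- The total collision weight of a tree, without the factor for free flight. -/
noncomputable def collisionWeight (g₀ : Vel → ℝ) (Φ : CollisionTree) : ℝ :=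
  ∏ j : Fin Φ.1, (g₀ (collVel Φ j) * max (inner ℝ (collDir Φ j)
    (velAfter Φ j - collVel Φ j)) 0)

theorem collisionWeight_nonneg (h : Admissible f₀ g₀) (Φ : CollisionTree) :
    0 ≤ collisionWeight g₀ Φ :=
  Finset.prod_nonneg fun _ _ => mul_nonneg (h.g_nonneg _) (le_max_right _ _)

theorem labelledDensity_eq (h : Admissible f₀ g₀) (N : ℕ) (ε t : ℝ) {n : ℕ}
    (x : (Torus × Vel) × (Fin n → Marker))
    (hb : (bgMeasure g₀ (survivalSet ε t (mkTree n x))ᶜ).toReal ≤ 1) :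
    labelledDensity f₀ g₀ N ε t x = ENNReal.ofReal (f₀ x.1 * ((ε ^ 2) ^ n *
      collisionWeight g₀ (mkTree n x) *
      (1 - (bgMeasure g₀ (survivalSet ε t (mkTree n x))ᶜ).toReal) ^ (N - n))) := by
  have h1 : ∀ j : Fin n, 0 ≤ g₀ (collVel (mkTree n x) j) * max (inner ℝ (collDir (mkTree n x) j)
      (velAfter (mkTree n x) j - collVel (mkTree n x) j)) 0 :=
    fun j => mul_nonneg (h.g_nonneg _) (le_max_right _ _)
  have h2 : startJac ε x * (∏ j : Fin n, ENNReal.ofReal (g₀ (collVel (mkTree n x) j)))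
      = ENNReal.ofReal ((ε ^ 2) ^ n * collisionWeight g₀ (mkTree n x)) := by
    unfold startJac collisionWeight
    rw [← Finset.prod_mul_distrib, ENNReal.ofReal_mul (by positivity),
      ENNReal.ofReal_prod_of_nonneg fun j _ => h1 j, ENNReal.ofReal_pow (by positivity)]
    have e : ENNReal.ofReal (ε ^ 2) ^ n = ∏ _j : Fin n, ENNReal.ofReal (ε ^ 2) := by simp
    rw [e, ← Finset.prod_mul_distrib]
    refine Finset.prod_congr rfl fun j _ => ?_
    rw [ENNReal.ofReal_mul (by positivity), ENNReal.ofReal_mul (h.g_nonneg _)]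
    ring
  have h3 := collisionWeight_nonneg h (mkTree n x)
  rw [labelledDensity, h2, survivalProb_eq h, ← ENNReal.ofReal_pow (sub_nonneg.2 hb),
    ← ENNReal.ofReal_mul (by positivity), ← ENNReal.ofReal_mul (h.f_nonneg _)]

/-- The lower bound for a labelled density in terms of the idealized density. -/
theorem ideal_le_labelled (h : Admissible f₀ g₀) {T : ℝ} (hT : 0 ≤ T) {N n : ℕ} {ε t R : ℝ}
    (hε : 0 < ε) (hε3 : ε ≤ 1 / 3) (hN : (N : ℝ) * ε ^ 2 = 1) (hn : (n : ℝ) * ε ≤ 1)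
    (ht : t ∈ Icc 0 T) {r : Torus × Vel} {c : Fin n → Marker} (hcT : IsTree T (treeOf r c))
    (hct : IsTree t (treeOf r c)) (hR : ∀ k ≤ n, rate g₀ (velAfter (treeOf r c) k) ≤ R)
    (hRT : ε ^ 2 * (T * R) ≤ 1 / 8) :
    ENNReal.ofReal ((1 - rhoHat g₀ T ε t (treeOf r c)) *
        (zeta N ε * idealDensity f₀ g₀ t (treeOf r c)))
      ≤ (N.descFactorial n : ENNReal) * labelledDensity f₀ g₀ N ε t (r, c) := by
  set b := (bgMeasure g₀ (survivalSet ε t (treeOf r c))ᶜ).toReal with hb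
  set L := exposure g₀ r n c t with hL
  set C := 4 / 3 * Real.pi * ε ^ 3 with hC
  have hπ := Real.pi_pos
  have hC0 : 0 ≤ C := by positivity
  have hC4 : C ≤ 1 / 4 := by
    have h1 : ε ^ 3 ≤ (1 / 3) ^ 3 := pow_le_pow_left₀ hε.le hε3 3
    have h2 := Real.pi_le_four
    calc C ≤ 4 / 3 * 4 * (1 / 3) ^ 3 := by rw [hC]; gcongr
      _ ≤ 1 / 4 := by norm_num
  have hb0 : 0 ≤ b := ENNReal.toReal_nonneg
  have hL0 : 0 ≤ L := exposure_nonneg h r n c t ht.1 hct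
  have hR0 : 0 ≤ R := (h.rate_nonneg _).trans (hR 0 (Nat.zero_le _))
  have hLR : L ≤ T * R :=
    (exposure_le r n c t ht.1 hct hR).trans (mul_le_mul_of_nonneg_right ht.2 hR0)
  have hLε : ε ^ 2 * L ≤ 1 / 8 :=
    (mul_le_mul_of_nonneg_left hLR (sq_nonneg ε)).trans hRT
  have hbC : b ≤ C + ε ^ 2 * L := hitProb_le h hε ht.1 hct
  have hb1 : b ≤ 1 := by linarith
  -- The factor 2 in `maxRate` is spent here: L ≤ t · `maxRate` / 2.
  have hloss : 2 * b * L ≤ etaErr g₀ ε t (treeOf r c) * maxRate g₀ T (treeOf r c) * t := by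
    have hLm := exposure_le (R := maxRate g₀ T (treeOf r c) / 2) r n c t ht.1 hct
      fun k hk => rate_velAfter_le hT hcT hk
    -- At t = 0 the interval (0, t) is empty and η = 0, which does not control the initial overlap
    -- contained in b; but then L = 0.
    rcases ht.1.eq_or_lt with h0 | h0
    · have : L ≤ 0 := by
        refine hLm.trans (le_of_eq ?_)
        rw [← h0, zero_mul]
      rw [← h0, mul_zero]
      exact mul_nonpos_of_nonneg_of_nonpos (by positivity) this
    · have h1 := hitProb_le_etaErr h hε h0 (treeOf r c)
      have h2 : 2 * L ≤ maxRate g₀ T (treeOf r c) * t := by linarith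
      calc 2 * b * L = b * (2 * L) := by ring
        _ ≤ etaErr g₀ ε t (treeOf r c) * (maxRate g₀ T (treeOf r c) * t) :=
          mul_le_mul h1 h2 (by positivity) (etaErr_nonneg h _ _ _)
        _ = _ := by ring
  have hsurv := exp_mul_le_pow hN hb0 hC4 hL0 hLε hbC
  have hW := collisionWeight_nonneg h (treeOf r c)
  have hf := h.f_nonneg r
  have hζ : 0 ≤ (1 - C) ^ N := pow_nonneg (by linarith) N
  have hε1 : 0 ≤ 1 - ε := by linarith
  have hideal : idealDensity f₀ g₀ t (treeOf r c)
      = Real.exp (-L) * f₀ r * collisionWeight g₀ (treeOf r c) := idealAux_eq r n c t hct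
  have hz : zeta N ε = (1 - C) ^ N := rfl
  rw [labelledDensity_eq h N ε t (r, c) hb1, ← ENNReal.ofReal_natCast,
    ← ENNReal.ofReal_mul (Nat.cast_nonneg _), hideal, hz]
  refine ENNReal.ofReal_le_ofReal ?_
  change _ ≤ (N.descFactorial n : ℝ) * (f₀ r * ((ε ^ 2) ^ n * collisionWeight g₀ (treeOf r c) *
    (1 - b) ^ (N - n)))
  have hfW : 0 ≤ f₀ r * collisionWeight g₀ (treeOf r c) := mul_nonneg hf hW
  calc (1 - rhoHat g₀ T ε t (treeOf r c)) *
        ((1 - C) ^ N * (Real.exp (-L) * f₀ r * collisionWeight g₀ (treeOf r c)))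
      ≤ ((1 - ε) ^ n * (1 - 2 * b * L)) *
        ((1 - C) ^ N * (Real.exp (-L) * f₀ r * collisionWeight g₀ (treeOf r c))) := by
        refine mul_le_mul_of_nonneg_right ?_ (by positivity)
        refine (one_sub_rho_le h T ht.1 (by linarith) _ n).trans ?_
        exact mul_le_mul_of_nonneg_left (by linarith) (by positivity)
    _ = (1 - ε) ^ n * ((f₀ r * collisionWeight g₀ (treeOf r c)) *
        ((1 - C) ^ N * (Real.exp (-L) * (1 - 2 * b * L)))) := by ring
    _ ≤ (1 - ε) ^ n * ((f₀ r * collisionWeight g₀ (treeOf r c)) * (1 - b) ^ (N - n)) := by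
        refine mul_le_mul_of_nonneg_left (mul_le_mul_of_nonneg_left (hsurv.trans ?_) hfW)
          (by positivity)
        -- Since 0 ≤ 1 - b ≤ 1, the exponent N - n may be raised to N.
        exact pow_le_pow_of_le_one (by linarith) (by linarith) (Nat.sub_le _ _)
    _ ≤ ((N.descFactorial n : ℝ) * (ε ^ 2) ^ n) *
        ((f₀ r * collisionWeight g₀ (treeOf r c)) * (1 - b) ^ (N - n)) := by
        refine mul_le_mul_of_nonneg_right
          (pow_le_descFactorial_mul hε.le (by linarith) hN n hn)
          (mul_nonneg hfW (pow_nonneg (by linarith) _))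
    _ = _ := by ring

end RayleighGas

theorem proposition5p1 (T : ℝ) (hT : 0 < T)
    (f₀ : RayleighGas.Torus × RayleighGas.Vel → ℝ) (g₀ : RayleighGas.Vel → ℝ)
    (hfg : RayleighGas.Admissible f₀ g₀)
    (V M : ℝ → ℝ) (hVM : RayleighGas.IsCutoff V M) :
    ∃ ε₀ : ℝ, 0 < ε₀ ∧
      ∀ (N : ℕ) (ε : ℝ), 0 < ε → ε < ε₀ → (N : ℝ) * ε ^ 2 = 1 →
        ∀ t ∈ Set.Icc 0 T, ∀ᵐ Φ ∂(RayleighGas.treeMeasure),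
          Φ ∈ RayleighGas.goodTrees T V M ε → RayleighGas.NoLaterContact ε t Φ →
            RayleighGas.empiricalDensity f₀ g₀ N ε t Φ
                - RayleighGas.zeta N ε * RayleighGas.idealDensity f₀ g₀ t Φ
              ≥ -(RayleighGas.rhoHat g₀ T ε t Φ *
                  (RayleighGas.zeta N ε * RayleighGas.idealDensity f₀ g₀ t Φ)) := by
  open RayleighGas in
  obtain ⟨K, hK0, hK⟩ := hfg.exists_rate_le
  -- The bound 1/3 makes the overlap volume at most 1/4. The other bound gives ε T K ≤ 1/16, which
  -- together with ε (1 + V ε) ≤ 2 yields ε² T R ≤ 1/8 for R = K (1 + V ε).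
  refine ⟨min (1 / 3) (1 / (16 * (T * K + 1))), by positivity, fun N ε hε hε0 hN t ht => ?_⟩
  have hε3 : ε < 1 / 3 := hε0.trans_le (min_le_left _ _)
  have hεK : ε * (T * K) ≤ 1 / 16 := by
    have h1 := hε0.trans_le (min_le_right _ _)
    rw [lt_div_iff₀ (by positivity)] at h1
    nlinarith
  have hconf : ∀ N, IsProbabilityMeasure (configLaw f₀ g₀ N) :=
    isProbabilityMeasure_configLaw hfg
  have hfin : MeasureTheory.IsFiniteMeasure (empiricalLaw f₀ g₀ N ε t) := by
    unfold empiricalLaw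
    infer_instance
  filter_upwards [labelledDensity_le_rnDeriv (N := N) hfg.f_meas hfg.g_meas ht.1 hε
    (show ε < 1 / 2 by linarith), (empiricalLaw f₀ g₀ N ε t).rnDeriv_lt_top treeMeasure]
    with Φ hΦ hΦt hgood hnl
  -- Trees with a collision after t have P_t = 0, and the claim reduces to nonnegativity of the
  -- empirical density.
  by_cases htree : IsTree t Φ
  swap
  · rw [idealDensity_eq_zero hgood.1 htree, mul_zero, mul_zero, neg_zero, sub_zero]
    exact ENNReal.toReal_nonneg
  obtain ⟨n, r, c⟩ := Φ
  have hclean := mem_cleanTrees hε.le hgood hnl htree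
  obtain ⟨hcT, hnM, -, hvel, -⟩ := hgood
  have hnε : (n : ℝ) * ε ≤ 1 := by
    have h1 : (n : ℝ) ≤ 1 / √ε := hnM.trans (hVM.M_le ε hε (by linarith))
    have h2 : ε ≤ √ε := Real.le_sqrt_of_sq_le (by nlinarith)
    have h3 : 0 < √ε := Real.sqrt_pos.2 hε
    calc (n : ℝ) * ε ≤ 1 / √ε * √ε := by gcongr
      _ = 1 := by field_simp
  have hV0 := hVM.V_nonneg ε hε
  -- From V ≤ 1 + V³ and ε V³ ≤ 1/8: the left side is at most 2ε + 1/8.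
  have hεV : ε * (1 + V ε) ≤ 2 := by
    have h1 := hVM.V_le ε hε (by linarith)
    have h2 : V ε ≤ 1 + V ε ^ 3 := by
      rcases le_total (V ε) 1 with h | h
      · nlinarith [pow_nonneg hV0 3]
      · nlinarith [mul_nonneg hV0 (mul_nonneg (sub_nonneg.2 h) (by linarith : 0 ≤ V ε + 1))]
    nlinarith
  have hRk : ∀ k ≤ n, rate g₀ (velAfter (treeOf r c) k) ≤ K * (1 + V ε) := by
    intro k hk
    obtain ⟨s, hs, e⟩ := exists_vel_eq_velAfter hT.le hcT hk
    refine (hK _).trans (mul_le_mul_of_nonneg_left ?_ hK0)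
    rw [← e]
    linarith [hvel s hs]
  have hRT : ε ^ 2 * (T * (K * (1 + V ε))) ≤ 1 / 8 := by
    calc ε ^ 2 * (T * (K * (1 + V ε))) = (ε * (T * K)) * (ε * (1 + V ε)) := by ring
      _ ≤ 1 / 16 * 2 := by gcongr
      _ = 1 / 8 := by norm_num
  have hlow := (ideal_le_labelled hfg hT.le hε hε3.le hN hnε ht hcT htree hRk hRT).trans
    (hΦ hclean)
  have hfinal := (ENNReal.ofReal_le_iff_le_toReal hΦt.ne).1 hlow
  change _ ≤ empiricalDensity f₀ g₀ N ε t (treeOf r c) at hfinal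
  change empiricalDensity f₀ g₀ N ε t (treeOf r c) -
    zeta N ε * idealDensity f₀ g₀ t (treeOf r c) ≥ -(rhoHat g₀ T ε t (treeOf r c) *
      (zeta N ε * idealDensity f₀ g₀ t (treeOf r c)))
  linarith
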